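/- Let $\mathcal{C}$ be a small category and $\mathcal{M}\subseteq\mathcal{C}$ a subcategory. Let $\mathcal{C}^{\square}$ be the category of pairs: its objects are the arrows $Y\to X$ of $\mathcal{M}$, written $(X,Y)$, and its morphisms are the commutative squares of $\mathcal{C}$. For composable arrows $f:Z\to Y$, $g:Y\to X$ of $\mathcal{M}$ there are morphisms of pairs $(Y,Z)\to (X,Z)$, given by $(\mathrm{id}_Z,g)$, $(X,Z)\to (X,Y)$, given by $(f,\mathrm{id}_X)$, and their composite $\partial=(f,g):(Y,Z)\to (X,Y)$. Let $\mathbb{T}$ be the regular theory of homology theories on $\mathcal{C}^{\square}$. Its signature has a sort $h_n(X,Y)$ for each $n\in\mathbb{Z}$ and each pair, function symbols $+,-,0$ on each sort, a function symbol $\square_n:h_n(P)\to h_n(Q)$ for each morphism $\square:P\to Q$ of $\mathcal{C}^{\square}$, and a function symbol $\partial_n:h_n(X,Y)\to h_{n-1}(Y,Z)$ for each composable pair $Z\to Y\to X$ in $\mathcal{M}$. Its axioms are the regular sequents saying that each $h_n(X,Y)$ is an abelian group, that $\square_n$ and $\partial_n$ are homomorphisms, that $h_n$ is a functor on $\mathcal{C}^{\square}$,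 that $\partial_n$ is natural (for every commutative square $\square\circ\partial=\partial'\circ\Diamond$ in $\mathcal{C}^{\square}$, $\Diamond_{n-1}\partial_n=\partial'_n\square_n$), and that $h_n(Y,Z)\to h_n(X,Z)\to h_n(X,Y)\to h_{n-1}(Y,Z)\to h_{n-1}(X,Z)$ is exact. Alternatively, let $\mathbb{T}$ be the regular theory of cohomology theories, obtained by reversing the directions of all $\square_n$ and $\partial_n$ (sorts $h^n(X,Y)$, $\partial^n:h^n(Y,Z)\to h^{n+1}(X,Y)$) and of the axioms. Let $\mathcal{C}_{\mathbb{T}}^{\mathrm{reg}}$ be the regular syntactic category of $\mathbb{T}$ (formulas in context, and provably functional formulas up to provable equivalence) and let $\mathcal{A}[\mathbb{T}]$ be its Barr exact completion, i.e. the full subcategory of the sheaves on $\mathcal{C}_{\mathbb{T}}^{\mathrm{reg}}$ for the regular topology given by the coequalizers of equivalence relations in $\mathcal{C}_{\mathbb{T}}^{\mathrm{reg}}$. Then: (1) $\operatorname{Ind}(\mathcal{A}[\mathbb{T}])$ is a Grothendieck abelian category. (2) For every Grothendieck abelian category $\mathcal{A}$, evaluation at the universal model $\{y:s\mid\top\}_s$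 of $\mathbb{T}$ in $\mathcal{C}_{\mathbb{T}}^{\mathrm{reg}}\to\mathcal{A}[\mathbb{T}]\to\operatorname{Ind}(\mathcal{A}[\mathbb{T}])$ is an equivalence of categories $$\mathsf{Ex}(\operatorname{Ind}(\mathcal{A}[\mathbb{T}]),\mathcal{A})\;\simeq\;\mathbb{T}\text{-}\mathsf{Mod}(\mathcal{A}),$$ where $\mathsf{Ex}(\operatorname{Ind}(\mathcal{A}[\mathbb{T}]),\mathcal{A})$ is the category of the exact functors that preserve (small) filtered colimits, with all natural transformations, and $\mathbb{T}\text{-}\mathsf{Mod}(\mathcal{A})$ is the category of $\mathbb{T}$-models in $\mathcal{A}$. -/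

import Mathlib

open CategoryTheory CategoryTheory.Limits

universe w v u

namespace TMotives

/-! ## Regular logic -/

/-- A (many-sorted) signature without relation symbols: a set of sorts and, for every finite string
`Δ` of sorts and every sort `s`, a set of function symbols `Δ → s` (constants are the function
symbols with `Δ = []`). -/
structure Sig where
  Sorts : Type w
  Ops : List Sorts → Sorts → Type w

/-- `Var Γ s` is the set of the variables of sort `s` in the context `Γ`. A context is a finite
string of sorts; variables are its positions, so that formulas are automatically taken up to
renaming of variables. -/
inductive Var {S : Type w} : List S → S → Type w
  | zero {s : S} {Γ : List S} : Var (s :: Γ) s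
  | succ {s t : S} {Γ : List S} : Var Γ s → Var (t :: Γ) s

namespace Var

variable {S : Type w}

/-- The variables of `Δ` in the concatenated context `Δ ++ Γ`. -/
def inl (Γ : List S) : ∀ {Δ : List S} {s : S}, Var Δ s → Var (Δ ++ Γ) s
  | _, _, .zero => .zero
  | _, _, .succ x => .succ (inl Γ x)

/-- The variables of `Γ` in the concatenated context `Δ ++ Γ`. -/
def inr : ∀ (Δ : List S) {Γ : List S} {s : S}, Var Γ s → Var (Δ ++ Γ) s
  | [], _, _, x => x
  | _ :: Δ, _, _, x => .succ (inr Δ x)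

end Var

/-- Terms in a context `Γ`. -/
inductive Term (L : Sig.{w}) (Γ : List L.Sorts) : L.Sorts → Type w
  | var {s : L.Sorts} (x : Var Γ s) : Term L Γ s
  | app {Δ : List L.Sorts} {s : L.Sorts} (f : L.Ops Δ s)
      (a : ∀ t, Var Δ t → Term L Γ t) : Term L Γ s

/-- `Subst L Γ Δ`: a term in the context `Δ` for each variable of `Γ`. -/
abbrev Subst (L : Sig.{w}) (Γ Δ : List L.Sorts) : Type w := ∀ s, Var Γ s → Term L Δ s

/-- Regular formulas in a context, built with `⊤`, `=`, `∧`, `∃`. -/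
inductive Formula (L : Sig.{w}) : List L.Sorts → Type w
  | top {Γ : List L.Sorts} : Formula L Γ
  | eq {Γ : List L.Sorts} {s : L.Sorts} (t t' : Term L Γ s) : Formula L Γ
  | and {Γ : List L.Sorts} (φ ψ : Formula L Γ) : Formula L Γ
  | ex {Γ : List L.Sorts} (s : L.Sorts) (φ : Formula L (s :: Γ)) : Formula L Γ

section Substitution

variable {L : Sig.{w}}

/-- Substitution in terms. -/
def Term.subst {Γ Δ : List L.Sorts} (σ : Subst L Γ Δ) : ∀ {s : L.Sorts}, Term L Γ s → Term L Δ s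
  | _, .var x => σ _ x
  | _, .app f a => .app f (fun t x => (a t x).subst σ)

namespace Subst

/-- The identity substitution. -/
def id (Γ : List L.Sorts) : Subst L Γ Γ := fun _ x => .var x

/-- Composition of substitutions. -/
def comp {Γ Δ Θ : List L.Sorts} (σ : Subst L Γ Δ) (τ : Subst L Δ Θ) : Subst L Γ Θ :=
  fun _ x => (σ _ x).subst τ

/-- Weakening by one variable. -/
def wk (Γ : List L.Sorts) (s : L.Sorts) : Subst L Γ (s :: Γ) := fun _ x => .var x.succ

def nil (Δ : List L.Sorts) : Subst L [] Δ := fun _ x => nomatch x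

def cons {Γ Δ : List L.Sorts} {s : L.Sorts} (t : Term L Δ s) (σ : Subst L Γ Δ) :
    Subst L (s :: Γ) Δ
  | _, .zero => t
  | _, .succ x => σ _ x

/-- Extension of a substitution under a quantifier. -/
def up {Γ Δ : List L.Sorts} (s : L.Sorts) (σ : Subst L Γ Δ) : Subst L (s :: Γ) (s :: Δ) :=
  cons (.var .zero) (σ.comp (wk Δ s))

/-- Juxtaposition of substitutions. -/
def append : ∀ {Δ Γ Ξ : List L.Sorts}, Subst L Δ Ξ → Subst L Γ Ξ → Subst L (Δ ++ Γ) Ξ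
  | [], _, _, _, τ => τ
  | _ :: _, _, _, σ, τ => cons (σ _ .zero) (append (fun _ x => σ _ x.succ) τ)

/-- The substitution that renames the variables of `Δ` to the first part of `Δ ++ Γ`. -/
def inl (Δ Γ : List L.Sorts) : Subst L Δ (Δ ++ Γ) := fun _ x => .var (x.inl Γ)

/-- The substitution that renames the variables of `Γ` to the last part of `Δ ++ Γ`. -/
def inr (Δ Γ : List L.Sorts) : Subst L Γ (Δ ++ Γ) := fun _ x => .var (x.inr Δ)

end Subst

namespace Formula

/-- (Capture-avoiding) substitution in formulas. -/
def subst : ∀ {Γ Δ : List L.Sorts}, Subst L Γ Δ → Formula L Γ → Formula L Δ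
  | _, _, _, .top => .top
  | _, _, σ, .eq t t' => .eq (t.subst σ) (t'.subst σ)
  | _, _, σ, .and φ ψ => .and (φ.subst σ) (ψ.subst σ)
  | _, _, σ, .ex s φ => .ex s (φ.subst (σ.up s))

/-- Quantification `∃ y⃗` over a string of variables. -/
def exs : ∀ (Δ : List L.Sorts) {Γ : List L.Sorts}, Formula L (Δ ++ Γ) → Formula L Γ
  | [], _, φ => φ
  | s :: Δ, _, φ => exs Δ (.ex s φ)

/-- The conjunction of the equations `σ x = τ x`, where `x` runs over the variables of `Δ`. -/
def eqs : ∀ {Δ Ξ : List L.Sorts}, Subst L Δ Ξ → Subst L Δ Ξ → Formula L Ξ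
  | [], _, _, _ => .top
  | _ :: _, _, σ, τ =>
    .and (.eq (σ _ .zero) (τ _ .zero)) (eqs (fun _ x => σ _ x.succ) (fun _ x => τ _ x.succ))

end Formula

end Substitution

/-- A regular theory: a signature and a set of axioms, each of which is a regular sequent
`φ ⊢_Γ ψ`. -/
structure RegularTheory where
  sig : Sig.{w}
  Ax : ∀ {Γ : List sig.Sorts}, Formula sig Γ → Formula sig Γ → Prop

/-- `Provable T φ ψ`: the sequent `φ ⊢_Γ ψ` is derivable from the axioms of `T` in the sequent
calculus of regular logic (identity, cut, substitution, equality, finite conjunction, existential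
quantification and Frobenius). -/
inductive Provable (T : RegularTheory.{w}) :
    ∀ {Γ : List T.sig.Sorts}, Formula T.sig Γ → Formula T.sig Γ → Prop
  | ax {Γ : List T.sig.Sorts} {φ ψ : Formula T.sig Γ} (h : T.Ax φ ψ) : Provable T φ ψ
  | refl {Γ : List T.sig.Sorts} (φ : Formula T.sig Γ) : Provable T φ φ
  | cut {Γ : List T.sig.Sorts} {φ ψ χ : Formula T.sig Γ} :
      Provable T φ ψ → Provable T ψ χ → Provable T φ χ
  | subst {Γ Δ : List T.sig.Sorts} {φ ψ : Formula T.sig Γ} (σ : Subst T.sig Γ Δ) :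
      Provable T φ ψ → Provable T (φ.subst σ) (ψ.subst σ)
  | eq_refl {Γ : List T.sig.Sorts} {s : T.sig.Sorts} (t : Term T.sig Γ s) :
      Provable T .top (.eq t t)
  | eq_subst {Γ Δ : List T.sig.Sorts} (φ : Formula T.sig Γ) (σ τ : Subst T.sig Γ Δ) :
      Provable T (.and (.eqs σ τ) (φ.subst σ)) (φ.subst τ)
  | top_intro {Γ : List T.sig.Sorts} (φ : Formula T.sig Γ) : Provable T φ .top
  | and_left {Γ : List T.sig.Sorts} (φ ψ : Formula T.sig Γ) : Provable T (.and φ ψ) φ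
  | and_right {Γ : List T.sig.Sorts} (φ ψ : Formula T.sig Γ) : Provable T (.and φ ψ) ψ
  | and_intro {Γ : List T.sig.Sorts} {φ ψ χ : Formula T.sig Γ} :
      Provable T φ ψ → Provable T φ χ → Provable T φ (.and ψ χ)
  | ex_intro {Γ : List T.sig.Sorts} {s : T.sig.Sorts} {φ : Formula T.sig (s :: Γ)}
      {ψ : Formula T.sig Γ} :
      Provable T (.ex s φ) ψ → Provable T φ (ψ.subst (.wk Γ s))
  | ex_elim {Γ : List T.sig.Sorts} {s : T.sig.Sorts} {φ : Formula T.sig (s :: Γ)}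
      {ψ : Formula T.sig Γ} :
      Provable T φ (ψ.subst (.wk Γ s)) → Provable T (.ex s φ) ψ
  | frobenius {Γ : List T.sig.Sorts} {s : T.sig.Sorts} (φ : Formula T.sig Γ)
      (ψ : Formula T.sig (s :: Γ)) :
      Provable T (.and φ (.ex s ψ)) (.ex s (.and (φ.subst (.wk Γ s)) ψ))

/-! ### Helper facts on substitution and derivations -/

section Helpers

variable {L : Sig.{w}}

theorem Term.subst_subst {Γ Δ Θ : List L.Sorts} (σ : Subst L Γ Δ) (τ : Subst L Δ Θ)
    {s : L.Sorts} (t : Term L Γ s) : (t.subst σ).subst τ = t.subst (σ.comp τ) := by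
  induction t with
  | var x => rfl
  | app f a ih => simp only [Term.subst]; congr; funext t x; exact ih t x

theorem Term.subst_id {Γ : List L.Sorts} {s : L.Sorts} (t : Term L Γ s) :
    t.subst (Subst.id Γ) = t := by
  induction t with
  | var x => rfl
  | app f a ih => simp only [Term.subst]; congr; funext t x; exact ih t x

theorem Subst.comp_assoc {Γ Δ Θ Ξ : List L.Sorts} (σ : Subst L Γ Δ) (τ : Subst L Δ Θ)
    (ρ : Subst L Θ Ξ) : (σ.comp τ).comp ρ = σ.comp (τ.comp ρ) := by
  funext s x; exact Term.subst_subst _ _ _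

theorem Subst.comp_id {Γ Δ : List L.Sorts} (σ : Subst L Γ Δ) : σ.comp (.id Δ) = σ := by
  funext s x; exact Term.subst_id _

theorem Subst.id_comp {Γ Δ : List L.Sorts} (σ : Subst L Γ Δ) : (Subst.id Γ).comp σ = σ := rfl

theorem Subst.wk_cons {Γ Δ : List L.Sorts} {s : L.Sorts} (t : Term L Δ s) (σ : Subst L Γ Δ) :
    (wk Γ s).comp (cons t σ) = σ := rfl

theorem Subst.cons_comp {Γ Δ Θ : List L.Sorts} {s : L.Sorts} (t : Term L Δ s) (σ : Subst L Γ Δ)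
    (τ : Subst L Δ Θ) : (cons t σ).comp τ = cons (t.subst τ) (σ.comp τ) := by
  funext r x; cases x <;> rfl

theorem Subst.up_cons {Γ Δ Θ : List L.Sorts} {s : L.Sorts} (t : Term L Θ s) (σ : Subst L Γ Δ)
    (τ : Subst L Δ Θ) : (σ.up s).comp (cons t τ) = cons t (σ.comp τ) := by
  rw [up, cons_comp, comp_assoc, wk_cons]; rfl

theorem Subst.up_comp {Γ Δ Θ : List L.Sorts} (s : L.Sorts) (σ : Subst L Γ Δ)
    (τ : Subst L Δ Θ) : (σ.up s).comp (τ.up s) = (σ.comp τ).up s := by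
  conv_lhs => rw [up.eq_def s τ, up_cons]
  rw [up, comp_assoc]

theorem Subst.up_id (Γ : List L.Sorts) (s : L.Sorts) : (Subst.id Γ).up s = .id (s :: Γ) := by
  funext r x; cases x <;> rfl

theorem Formula.subst_subst {Γ Δ Θ : List L.Sorts} (σ : Subst L Γ Δ) (τ : Subst L Δ Θ)
    (φ : Formula L Γ) : (φ.subst σ).subst τ = φ.subst (σ.comp τ) := by
  induction φ generalizing Δ Θ with
  | top => rfl
  | eq t t' => simp only [subst, Term.subst_subst]
  | and φ ψ ih1 ih2 => simp only [subst, ih1, ih2]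
  | ex s φ ih => simp only [subst, ih, Subst.up_comp]

theorem Formula.subst_id {Γ : List L.Sorts} (φ : Formula L Γ) : φ.subst (.id Γ) = φ := by
  induction φ with
  | top => rfl
  | eq t t' => simp only [subst, Term.subst_id]
  | and φ ψ ih1 ih2 => simp only [subst, ih1, ih2]
  | ex s φ ih => simp only [subst, Subst.up_id, ih]

theorem Subst.append_comp {Δ Γ Ξ Θ : List L.Sorts} (σ : Subst L Δ Ξ) (τ : Subst L Γ Ξ)
    (ρ : Subst L Ξ Θ) : (append σ τ).comp ρ = append (σ.comp ρ) (τ.comp ρ) := by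
  induction Δ with
  | nil => rfl
  | cons s Δ ih => simp only [append, cons_comp, ih]; rfl

theorem Subst.inl_append {Δ Γ Ξ : List L.Sorts} (σ : Subst L Δ Ξ) (τ : Subst L Γ Ξ) :
    (inl Δ Γ).comp (append σ τ) = σ := by
  induction Δ with
  | nil => funext s x; cases x
  | cons s Δ ih =>
    funext r x
    cases x with
    | zero => rfl
    | succ x => exact congrFun (congrFun (ih (fun _ x => σ _ x.succ)) r) x

theorem Subst.inr_append {Δ Γ Ξ : List L.Sorts} (σ : Subst L Δ Ξ) (τ : Subst L Γ Ξ) :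
    (inr Δ Γ).comp (append σ τ) = τ := by
  induction Δ with
  | nil => rfl
  | cons s Δ ih => exact ih (fun _ x => σ _ x.succ)

theorem Subst.append_inl_inr (Δ Γ : List L.Sorts) : append (inl Δ Γ) (inr Δ Γ) = .id _ := by
  induction Δ with
  | nil => rfl
  | cons s Δ ih =>
    have h := append_comp (inl Δ Γ) (inr Δ Γ) (wk (Δ ++ Γ) s)
    rw [ih] at h
    change cons (.var .zero) (append ((inl Δ Γ).comp (wk _ s)) ((inr Δ Γ).comp (wk _ s))) = _
    rw [← h]
    funext r x; cases x <;> rfl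

theorem Formula.eqs_subst {Δ Ξ Θ : List L.Sorts} (σ τ : Subst L Δ Ξ) (ρ : Subst L Ξ Θ) :
    (eqs σ τ).subst ρ = eqs (σ.comp ρ) (τ.comp ρ) := by
  induction Δ with
  | nil => rfl
  | cons s Δ ih => simp only [eqs, subst, ih]; rfl

namespace Provable

variable {T : RegularTheory.{w}} {Γ Δ Ξ : List T.sig.Sorts}

theorem eqs_refl (χ : Formula T.sig Ξ) (σ : Subst T.sig Δ Ξ) : Provable T χ (.eqs σ σ) := by
  induction Δ with
  | nil => exact top_intro _
  | cons s Δ ih => exact and_intro (cut (top_intro _) (eq_refl _)) (ih _)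

theorem leibniz {χ : Formula T.sig Ξ} {σ τ : Subst T.sig Γ Ξ} (h : Provable T χ (.eqs σ τ))
    (φ : Formula T.sig Γ) (hφ : Provable T χ (φ.subst σ)) : Provable T χ (φ.subst τ) :=
  cut (and_intro h hφ) (eq_subst φ σ τ)

theorem eqs_symm {χ : Formula T.sig Ξ} {σ τ : Subst T.sig Γ Ξ} (h : Provable T χ (.eqs σ τ)) :
    Provable T χ (.eqs τ σ) := by
  have h' : Provable T χ (.eqs (Subst.append σ σ) (Subst.append τ σ)) := by
    have aux : ∀ {Δ : List T.sig.Sorts} (α β : Subst T.sig Δ Ξ), Provable T χ (.eqs α β) →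
        Provable T χ (.eqs (Subst.append α σ) (Subst.append β σ)) := by
      intro Δ α β h
      induction Δ with
      | nil => exact eqs_refl _ _
      | cons s Δ ih => exact and_intro (cut h (and_left _ _)) (ih _ _ (cut h (and_right _ _)))
    exact aux _ _ h
  have := leibniz h' (.eqs (.inl Γ Γ) (.inr Γ Γ))
  simp only [Formula.eqs_subst, Subst.inl_append, Subst.inr_append] at this
  exact this (eqs_refl _ _)

theorem eqs_trans {χ : Formula T.sig Ξ} {σ τ ρ : Subst T.sig Γ Ξ} (h : Provable T χ (.eqs σ τ))
    (h' : Provable T χ (.eqs τ ρ)) : Provable T χ (.eqs σ ρ) := by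
  have aux : ∀ {Δ : List T.sig.Sorts} (α β : Subst T.sig Δ Ξ), Provable T χ (.eqs α β) →
      Provable T χ (.eqs (Subst.append α σ) (Subst.append β σ)) := by
    intro Δ α β h
    induction Δ with
    | nil => exact eqs_refl _ _
    | cons s Δ ih => exact and_intro (cut h (and_left _ _)) (ih _ _ (cut h (and_right _ _)))
  have := leibniz (aux _ _ h') (.eqs (.inr Γ Γ) (.inl Γ Γ))
  simp only [Formula.eqs_subst, Subst.inl_append, Subst.inr_append] at this
  exact this h

theorem ex_mk {χ : Formula T.sig Ξ} {s : T.sig.Sorts} {φ : Formula T.sig (s :: Γ)}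
    (t : Term T.sig Ξ s) (σ : Subst T.sig Γ Ξ) (h : Provable T χ (φ.subst (.cons t σ))) :
    Provable T χ ((Formula.ex s φ).subst σ) := by
  have := subst (.cons t σ) (ex_intro (refl (.ex s φ)))
  rw [Formula.subst_subst, Subst.wk_cons] at this
  exact cut h this

theorem ex_cases {χ G : Formula T.sig Ξ} {s : T.sig.Sorts} {φ : Formula T.sig (s :: Γ)}
    {σ : Subst T.sig Γ Ξ} (h : Provable T χ ((Formula.ex s φ).subst σ))
    (k : ∀ {Ξ' : List T.sig.Sorts} (χ' : Formula T.sig Ξ') (ρ : Subst T.sig Ξ Ξ')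
      (t : Term T.sig Ξ' s), Provable T χ' (χ.subst ρ) →
      Provable T χ' (φ.subst (.cons t (σ.comp ρ))) → Provable T χ' (G.subst ρ)) :
    Provable T χ G :=
  cut (cut (and_intro (refl χ) h) (frobenius χ _))
    (ex_elim (k _ (.wk Ξ s) (.var .zero) (and_left _ _) (and_right _ _)))

theorem exs_mk {χ : Formula T.sig Ξ} {φ : Formula T.sig (Δ ++ Γ)}
    (τ : Subst T.sig Δ Ξ) (σ : Subst T.sig Γ Ξ) (h : Provable T χ (φ.subst (.append τ σ))) :
    Provable T χ ((Formula.exs Δ φ).subst σ) := by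
  induction Δ with
  | nil => exact h
  | cons s Δ ih => exact ih (fun _ x => τ _ x.succ) (ex_mk _ _ h)

theorem exs_cases {χ G : Formula T.sig Ξ} {φ : Formula T.sig (Δ ++ Γ)}
    {σ : Subst T.sig Γ Ξ} (h : Provable T χ ((Formula.exs Δ φ).subst σ))
    (k : ∀ {Ξ' : List T.sig.Sorts} (χ' : Formula T.sig Ξ') (ρ : Subst T.sig Ξ Ξ')
      (τ : Subst T.sig Δ Ξ'), Provable T χ' (χ.subst ρ) →
      Provable T χ' (φ.subst (.append τ (σ.comp ρ))) → Provable T χ' (G.subst ρ)) :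
    Provable T χ G := by
  induction Δ with
  | nil =>
    have := k χ (.id Ξ) (.nil Ξ) (by rw [Formula.subst_id]; exact refl _)
      (by rw [Subst.comp_id]; exact h)
    rwa [Formula.subst_id] at this
  | cons s Δ ih =>
    refine ih h fun χ' ρ τ h1 h2 => ex_cases h2 fun χ'' ρ' t h3 h4 => ?_
    rw [Formula.subst_subst]
    refine k χ'' (ρ.comp ρ') (.cons t (τ.comp ρ')) ?_ ?_
    · rw [← Formula.subst_subst]; exact cut h3 (subst ρ' h1)
    · rw [Subst.append_comp, Subst.comp_assoc] at h4; exact h4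

end Provable

end Helpers

/-! ## The regular syntactic category -/

/-- Objects of the regular syntactic category: formulas in context `{x⃗ . φ}`. -/
structure Syn (T : RegularTheory.{w}) : Type w where
  ctx : List T.sig.Sorts
  formula : Formula T.sig ctx

/-- Provably functional formulas `θ(y⃗, x⃗)` from `{x⃗ . φ}` to `{y⃗ . ψ}`. -/
structure FunctionalFormula {T : RegularTheory.{w}} (X Y : Syn T) : Type w where
  graph : Formula T.sig (Y.ctx ++ X.ctx)
  dom : Provable T graph (X.formula.subst (.inr Y.ctx X.ctx))
  cod : Provable T graph (Y.formula.subst (.inl Y.ctx X.ctx))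
  total : Provable T X.formula (.exs Y.ctx graph)
  unique : Provable T (Γ := Y.ctx ++ (Y.ctx ++ X.ctx))
    (.and
      (graph.subst (.append (.inl _ _) ((Subst.inr Y.ctx X.ctx).comp (.inr Y.ctx _))))
      (graph.subst (.append ((Subst.inl Y.ctx X.ctx).comp (.inr Y.ctx _))
        ((Subst.inr Y.ctx X.ctx).comp (.inr Y.ctx _)))))
    (.eqs (.inl _ _) ((Subst.inl Y.ctx X.ctx).comp (.inr Y.ctx _)))

namespace FunctionalFormula

variable {T : RegularTheory.{w}} {X Y Z : Syn T}

theorem dom' (θ : FunctionalFormula X Y) {Ξ : List T.sig.Sorts} {χ : Formula T.sig Ξ}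
    {y : Subst T.sig Y.ctx Ξ} {x : Subst T.sig X.ctx Ξ}
    (h : Provable T χ (θ.graph.subst (.append y x))) : Provable T χ (X.formula.subst x) := by
  have := Provable.subst (.append y x) θ.dom
  rw [Formula.subst_subst, Subst.inr_append] at this
  exact h.cut this

theorem cod' (θ : FunctionalFormula X Y) {Ξ : List T.sig.Sorts} {χ : Formula T.sig Ξ}
    {y : Subst T.sig Y.ctx Ξ} {x : Subst T.sig X.ctx Ξ}
    (h : Provable T χ (θ.graph.subst (.append y x))) : Provable T χ (Y.formula.subst y) := by
  have := Provable.subst (.append y x) θ.cod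
  rw [Formula.subst_subst, Subst.inl_append] at this
  exact h.cut this

theorem unique' (θ : FunctionalFormula X Y) {Ξ : List T.sig.Sorts} {χ : Formula T.sig Ξ}
    {y y' : Subst T.sig Y.ctx Ξ} {x : Subst T.sig X.ctx Ξ}
    (h : Provable T χ (θ.graph.subst (.append y x)))
    (h' : Provable T χ (θ.graph.subst (.append y' x))) : Provable T χ (.eqs y y') := by
  have := Provable.subst (.append y (.append y' x)) θ.unique
  simp only [Formula.subst, Formula.subst_subst, Formula.eqs_subst, Subst.append_comp,
    Subst.comp_assoc, Subst.inr_append, Subst.inl_append] at this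
  exact (Provable.and_intro h h').cut this

/-- Provable equivalence of functional formulas. -/
instance setoid (X Y : Syn T) : Setoid (FunctionalFormula X Y) where
  r θ θ' := Provable T θ.graph θ'.graph ∧ Provable T θ'.graph θ.graph
  iseqv := ⟨fun _ => ⟨.refl _, .refl _⟩, fun h => ⟨h.2, h.1⟩,
    fun h h' => ⟨h.1.cut h'.1, h'.2.cut h.2⟩⟩

theorem provable_of_forall {Γ : List T.sig.Sorts} {φ ψ : Formula T.sig Γ}
    (h : ∀ {Ξ : List T.sig.Sorts} (χ : Formula T.sig Ξ) (σ : Subst T.sig Γ Ξ),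
      Provable T χ (φ.subst σ) → Provable T χ (ψ.subst σ)) : Provable T φ ψ := by
  have := h φ (.id Γ) (by rw [Formula.subst_id]; exact .refl _)
  rwa [Formula.subst_id] at this

theorem graph_le {θ θ' : Formula T.sig (Y.ctx ++ X.ctx)}
    (h : ∀ {Ξ : List T.sig.Sorts} (χ : Formula T.sig Ξ) (y : Subst T.sig Y.ctx Ξ)
      (x : Subst T.sig X.ctx Ξ), Provable T χ (θ.subst (.append y x)) →
      Provable T χ (θ'.subst (.append y x))) : Provable T θ θ' := by
  have := h θ (.inl _ _) (.inr _ _)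
    (by rw [Subst.append_inl_inr, Formula.subst_id]; exact .refl _)
  rwa [Subst.append_inl_inr, Formula.subst_id] at this

/-- The functional formula `φ(x⃗) ∧ y⃗ = t⃗(x⃗)` given by a string of terms `t⃗`. -/
def ofTerms (X Y : Syn T) (t : Subst T.sig Y.ctx X.ctx)
    (ht : Provable T X.formula (Y.formula.subst t)) : FunctionalFormula X Y where
  graph := .and (X.formula.subst (.inr Y.ctx X.ctx)) (.eqs (t.comp (.inr Y.ctx X.ctx)) (.inl _ _))
  dom := .and_left _ _
  cod := by
    refine Provable.leibniz (.and_right _ _) _ ?_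
    rw [← Formula.subst_subst]
    exact (Provable.and_left _ _).cut (.subst _ ht)
  total := by
    have := Provable.exs_mk (Δ := Y.ctx) (Γ := X.ctx) (χ := X.formula)
      (φ := .and (X.formula.subst (.inr Y.ctx X.ctx))
        (.eqs (t.comp (.inr Y.ctx X.ctx)) (.inl _ _))) t (.id _) (by
        simp only [Formula.subst, Formula.subst_subst, Formula.eqs_subst,
          Subst.comp_assoc, Subst.inr_append, Subst.inl_append, Subst.comp_id, Formula.subst_id]
        exact .and_intro (.refl _) (.eqs_refl _ _))
    rwa [Formula.subst_id] at this
  unique := by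
    simp only [Formula.subst, Formula.subst_subst, Formula.eqs_subst,
          Subst.comp_assoc, Subst.inr_append, Subst.inl_append]
    exact .eqs_trans (.eqs_symm ((Provable.and_left _ _).cut (.and_right _ _)))
      ((Provable.and_right _ _).cut (.and_right _ _))

theorem ofTerms_iff {t : Subst T.sig Y.ctx X.ctx}
    {ht : Provable T X.formula (Y.formula.subst t)} {Ξ : List T.sig.Sorts} {χ : Formula T.sig Ξ}
    {y : Subst T.sig Y.ctx Ξ} {x : Subst T.sig X.ctx Ξ} :
    Provable T χ ((ofTerms X Y t ht).graph.subst (.append y x)) ↔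
      Provable T χ (X.formula.subst x) ∧ Provable T χ (.eqs (t.comp x) y) := by
  simp only [ofTerms, Formula.subst, Formula.subst_subst, Formula.eqs_subst,
    Subst.comp_assoc, Subst.inr_append, Subst.inl_append]
  exact ⟨fun h => ⟨h.cut (.and_left _ _), h.cut (.and_right _ _)⟩,
    fun h => .and_intro h.1 h.2⟩

/-- The formula `∃ y⃗ (θ(y⃗, x⃗) ∧ η(z⃗, y⃗))`. -/
def compGraph (θ : FunctionalFormula X Y) (η : FunctionalFormula Y Z) :
    Formula T.sig (Z.ctx ++ X.ctx) :=
  .exs Y.ctx (.and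
    (θ.graph.subst (.append (.inl Y.ctx (Z.ctx ++ X.ctx))
      ((Subst.inr Z.ctx X.ctx).comp (.inr Y.ctx _))))
    (η.graph.subst (.append ((Subst.inl Z.ctx X.ctx).comp (.inr Y.ctx _))
      (.inl Y.ctx (Z.ctx ++ X.ctx)))))

theorem compGraph_mk (θ : FunctionalFormula X Y) (η : FunctionalFormula Y Z)
    {Ξ : List T.sig.Sorts} {χ : Formula T.sig Ξ} {z : Subst T.sig Z.ctx Ξ}
    {x : Subst T.sig X.ctx Ξ} (y : Subst T.sig Y.ctx Ξ)
    (h : Provable T χ (θ.graph.subst (.append y x)))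
    (h' : Provable T χ (η.graph.subst (.append z y))) :
    Provable T χ ((compGraph θ η).subst (.append z x)) := by
  refine Provable.exs_mk y _ ?_
  simp only [Formula.subst, Formula.subst_subst, Subst.append_comp,
    Subst.comp_assoc, Subst.inr_append, Subst.inl_append]
  exact .and_intro h h'

theorem compGraph_cases (θ : FunctionalFormula X Y) (η : FunctionalFormula Y Z)
    {Ξ : List T.sig.Sorts} {χ G : Formula T.sig Ξ} {z : Subst T.sig Z.ctx Ξ}
    {x : Subst T.sig X.ctx Ξ} (h : Provable T χ ((compGraph θ η).subst (.append z x)))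
    (k : ∀ {Ξ' : List T.sig.Sorts} (χ' : Formula T.sig Ξ') (ρ : Subst T.sig Ξ Ξ')
      (y : Subst T.sig Y.ctx Ξ'), Provable T χ' (χ.subst ρ) →
      Provable T χ' (θ.graph.subst (.append y (x.comp ρ))) →
      Provable T χ' (η.graph.subst (.append (z.comp ρ) y)) → Provable T χ' (G.subst ρ)) :
    Provable T χ G := by
  refine Provable.exs_cases h fun χ' ρ y h1 h2 => ?_
  simp only [Formula.subst, Formula.subst_subst, Subst.append_comp,
    Subst.comp_assoc, Subst.inr_append, Subst.inl_append] at h2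
  exact k χ' ρ y h1 (h2.cut (.and_left _ _)) (h2.cut (.and_right _ _))

/-- Composition of functional formulas. -/
def comp (θ : FunctionalFormula X Y) (η : FunctionalFormula Y Z) : FunctionalFormula X Z where
  graph := compGraph θ η
  dom := by
    have := compGraph_cases θ η (χ := compGraph θ η) (z := .inl _ _) (x := .inr _ _)
      (G := X.formula.subst (.inr _ _))
      (by rw [Subst.append_inl_inr, Formula.subst_id]; exact .refl _)
      (fun χ' ρ y _ h2 _ => by rw [Formula.subst_subst]; exact θ.dom' h2)
    exact this
  cod := by
    have := compGraph_cases θ η (χ := compGraph θ η) (z := .inl _ _) (x := .inr _ _)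
      (G := Z.formula.subst (.inl _ _))
      (by rw [Subst.append_inl_inr, Formula.subst_id]; exact .refl _)
      (fun χ' ρ y _ _ h3 => by rw [Formula.subst_subst]; exact η.cod' h3)
    exact this
  total := by
    have h1 : Provable T X.formula ((Formula.exs Y.ctx θ.graph).subst (.id _)) := by
      rw [Formula.subst_id]; exact θ.total
    refine Provable.exs_cases h1 fun χ' ρ y _ h2 => ?_
    have h3 := (θ.cod' h2).cut (.subst y η.total)
    refine Provable.exs_cases h3 fun χ'' ρ' z h4 h5 => ?_
    rw [Formula.subst_subst]
    refine Provable.exs_mk z _ (compGraph_mk θ η (y.comp ρ') ?_ h5)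
    have := h4.cut (.subst ρ' h2)
    rwa [Formula.subst_subst, Subst.append_comp] at this
  unique := by
    generalize hχ : Formula.and (Formula.subst _ (compGraph θ η)) _ = χ
    have h1 := Provable.and_left (T := T)
      ((compGraph θ η).subst (.append (.inl _ _) ((Subst.inr Z.ctx X.ctx).comp (.inr Z.ctx _))))
      ((compGraph θ η).subst (.append ((Subst.inl Z.ctx X.ctx).comp (.inr Z.ctx _))
        ((Subst.inr Z.ctx X.ctx).comp (.inr Z.ctx _))))
    have h2 := Provable.and_right (T := T)
      ((compGraph θ η).subst (.append (.inl _ _) ((Subst.inr Z.ctx X.ctx).comp (.inr Z.ctx _))))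
      ((compGraph θ η).subst (.append ((Subst.inl Z.ctx X.ctx).comp (.inr Z.ctx _))
        ((Subst.inr Z.ctx X.ctx).comp (.inr Z.ctx _))))
    rw [hχ] at h1 h2
    refine compGraph_cases θ η h1 fun χ' ρ y k1 k2 k3 => ?_
    have h2' := k1.cut (.subst ρ h2)
    rw [Formula.subst_subst, Subst.append_comp] at h2'
    refine compGraph_cases θ η h2' fun χ'' ρ' y' l1 l2 l3 => ?_
    have k2' := l1.cut (.subst ρ' k2)
    have k3' := l1.cut (.subst ρ' k3)
    rw [Formula.subst_subst, Subst.append_comp] at k2' k3'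
    have e := θ.unique' l2 k2'
    have k4 : Provable T χ'' (η.graph.subst
        (.append (((Subst.inl Z.ctx (Z.ctx ++ X.ctx)).comp ρ).comp ρ') y')) := by
      have aux : ∀ {Δ : List T.sig.Sorts} (α : Subst T.sig Δ _),
          Provable T χ'' (.eqs (.append α (y.comp ρ')) (.append α y')) := by
        intro Δ α
        induction Δ with
        | nil => exact .eqs_symm e
        | cons s Δ ih => exact .and_intro (.cut (.top_intro _) (.eq_refl _)) (ih _)
      exact Provable.leibniz (aux _) η.graph k3'
    have := η.unique' k4 l3
    simpa only [Formula.eqs_subst] using this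

end FunctionalFormula

open FunctionalFormula in
/-- The regular syntactic category of a regular theory: objects are formulas in context, morphisms
are classes of provably functional formulas up to provable equivalence. -/
instance Syn.category (T : RegularTheory.{w}) : SmallCategory (Syn T) where
  Hom X Y := Quotient (FunctionalFormula.setoid X Y)
  id X := ⟦ofTerms X X (.id _) (by rw [Formula.subst_id]; exact .refl _)⟧
  comp {X Y Z} f g := Quotient.map₂ FunctionalFormula.comp (by
    have key : ∀ (θ θ' : FunctionalFormula X Y) (η η' : FunctionalFormula Y Z),
        Provable T θ.graph θ'.graph → Provable T η.graph η'.graph →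
        Provable T (compGraph θ η) (compGraph θ' η') := by
      intro θ θ' η η' h h'
      refine graph_le fun χ z x k => compGraph_cases θ η k fun χ' ρ y _ k2 k3 => ?_
      rw [Formula.subst_subst, Subst.append_comp]
      exact compGraph_mk θ' η' y (k2.cut (.subst _ h)) (k3.cut (.subst _ h'))
    intro θ θ' h η η' h'
    exact ⟨key _ _ _ _ h.1 h'.1, key _ _ _ _ h.2 h'.2⟩) f g
  id_comp {X Y} f := by
    induction f using Quotient.inductionOn with
    | h θ =>
      refine Quotient.sound ⟨?_, ?_⟩
      · refine graph_le fun χ y x k => compGraph_cases _ _ k fun χ' ρ x' _ k2 k3 => ?_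
        rw [ofTerms_iff] at k2
        rw [Formula.subst_subst, Subst.append_comp]
        have aux : ∀ {Δ : List T.sig.Sorts} (α : Subst T.sig Δ _),
            Provable T χ' (.eqs (.append α x') (.append α (x.comp ρ))) := by
          intro Δ α
          induction Δ with
          | nil => exact .eqs_symm k2.2
          | cons s Δ ih => exact .and_intro (.cut (.top_intro _) (.eq_refl _)) (ih _)
        exact Provable.leibniz (aux _) θ.graph k3
      · refine graph_le fun χ y x k => compGraph_mk _ _ x ?_ k
        rw [ofTerms_iff]
        exact ⟨θ.dom' k, .eqs_refl _ _⟩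
  comp_id {X Y} f := by
    induction f using Quotient.inductionOn with
    | h θ =>
      refine Quotient.sound ⟨?_, ?_⟩
      · refine graph_le fun χ y x k => compGraph_cases _ _ k fun χ' ρ y' _ k2 k3 => ?_
        rw [ofTerms_iff] at k3
        rw [Formula.subst_subst, Subst.append_comp]
        have aux : ∀ {Δ : List T.sig.Sorts} (α β : Subst T.sig Δ _),
            Provable T χ' (.eqs α β) →
            Provable T χ' (.eqs (.append α (x.comp ρ)) (.append β (x.comp ρ))) := by
          intro Δ α β h
          induction Δ with
          | nil => exact .eqs_refl _ _
          | cons s Δ ih => exact .and_intro (h.cut (.and_left _ _)) (ih _ _ (h.cut (.and_right _ _)))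
        exact Provable.leibniz (aux _ _ k3.2) θ.graph k2
      · refine graph_le fun χ y x k => compGraph_mk _ _ y k ?_
        rw [ofTerms_iff]
        exact ⟨θ.cod' k, .eqs_refl _ _⟩
  assoc {W X Y Z} f g h := by
    induction f using Quotient.inductionOn with
    | h θ =>
    induction g using Quotient.inductionOn with
    | h η =>
    induction h using Quotient.inductionOn with
    | h ζ =>
      refine Quotient.sound ⟨?_, ?_⟩
      · refine graph_le fun χ z w k => compGraph_cases _ _ k fun χ' ρ y _ k2 k3 => ?_
        refine compGraph_cases _ _ k2 fun χ'' ρ' x l1 l2 l3 => ?_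
        simp only [Formula.subst_subst, Subst.append_comp]
        have k3' := l1.cut (.subst ρ' k3)
        rw [Formula.subst_subst, Subst.append_comp] at k3'
        exact compGraph_mk _ _ x l2 (compGraph_mk _ _ _ l3 k3')
      · refine graph_le fun χ z w k => compGraph_cases _ _ k fun χ' ρ x _ k2 k3 => ?_
        refine compGraph_cases _ _ k3 fun χ'' ρ' y l1 l2 l3 => ?_
        simp only [Formula.subst_subst, Subst.append_comp]
        have k2' := l1.cut (.subst ρ' k2)
        rw [Formula.subst_subst, Subst.append_comp] at k2'
        exact compGraph_mk _ _ y (compGraph_mk _ _ _ k2' l2) l3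

/-- The object `{x⃗ . ⊤}` of the syntactic category. -/
def Syn.free (T : RegularTheory.{w}) (Γ : List T.sig.Sorts) : Syn T := ⟨Γ, .top⟩

/-- The morphism `{x⃗ . ⊤} ⟶ {y . ⊤}` of the syntactic category given by a term `t(x⃗)`. -/
def Syn.termHom {T : RegularTheory.{w}} {Γ : List T.sig.Sorts} {s : T.sig.Sorts}
    (t : Term T.sig Γ s) : Syn.free T Γ ⟶ Syn.free T [s] :=
  Quotient.mk _ (FunctionalFormula.ofTerms (Syn.free T Γ) (Syn.free T [s])
    (.cons t (.nil Γ)) (.refl _))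

/-! ## Barr exact completion -/

section ExactCompletion

variable (R : Type w) [SmallCategory R]

/-- The regular topology: the Grothendieck topology generated by the one-element families
consisting of a regular epimorphism. -/
def regTopology : GrothendieckTopology R :=
  Precoverage.toGrothendieck
    { coverings := fun X => {S | ∃ (Y : R) (f : Y ⟶ X), IsRegularEpi f ∧ S = .singleton f} }

/-- An internal equivalence relation `p₁, p₂ : E ⇉ X`. -/
structure EqRel : Type w where
  X : R
  E : R
  p₁ : E ⟶ X
  p₂ : E ⟶ X
  isEquivalenceRelation : IsEquivalenceRelation p₁ p₂

/-- The canonical functor from `R` to the topos of sheaves for the regular topology (if `R` is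
regular, this is the Yoneda embedding). -/
noncomputable def toSheaves : R ⥤ Sheaf (regTopology R) (Type w) :=
  yoneda ⋙ presheafToSheaf (regTopology R) (Type w)

variable {R} in
/-- The coequalizer of an equivalence relation in the topos of sheaves. -/
noncomputable def EqRel.quotient (S : EqRel R) : Sheaf (regTopology R) (Type w) :=
  coequalizer ((toSheaves R).map S.p₁) ((toSheaves R).map S.p₂)

/-- The Barr exact completion of a small regular category `R`: the full subcategory of the topos
of sheaves for the regular topology given by the coequalizers of the equivalence relations
in `R`. -/
abbrev ExactCompletion : Type w :=
  InducedCategory (Sheaf (regTopology R) (Type w)) (EqRel.quotient (R := R))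

variable {R} in
/-- The discrete equivalence relation `𝟙, 𝟙 : X ⇉ X`. -/
def EqRel.discrete (X : R) : EqRel R where
  X := X
  E := X
  p₁ := 𝟙 X
  p₂ := 𝟙 X
  isEquivalenceRelation := ⟨⟨{
    right_cancellation := fun _ _ _ h _ => by simpa using h
    r := 𝟙 X
    s := 𝟙 X
    c := PullbackCone.mk (𝟙 X) (𝟙 X) rfl
    isLimit := PullbackCone.IsLimit.mk _ (fun s => s.fst) (fun _ => Category.comp_id _)
      (fun s => by simpa using s.condition) (fun s m h _ => by simpa using h)
    t := 𝟙 X }⟩⟩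

/-- The embedding of `R` in its exact completion; an object `X` is the quotient of itself by the
discrete equivalence relation. -/
noncomputable def toExactCompletion : R ⥤ ExactCompletion R where
  obj X := EqRel.discrete X
  map {X Y} f := InducedCategory.homMk (X := EqRel.discrete X) (Y := EqRel.discrete Y)
    (coequalizer.desc (f := (toSheaves R).map (𝟙 X)) (g := (toSheaves R).map (𝟙 X))
      ((toSheaves R).map f ≫
        coequalizer.π ((toSheaves R).map (𝟙 Y)) ((toSheaves R).map (𝟙 Y))) rfl)
  map_id X := by
    apply InducedCategory.hom_ext
    apply coequalizer.hom_ext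
    refine (coequalizer.π_desc _ _).trans ?_
    refine (congrArg (· ≫ coequalizer.π _ _) ((toSheaves R).map_id X)).trans ?_
    exact (Category.id_comp _).trans (Category.comp_id _).symm
  map_comp f g := by
    apply InducedCategory.hom_ext
    apply coequalizer.hom_ext
    refine (coequalizer.π_desc _ _).trans ?_
    refine Eq.trans ?_ (coequalizer.π_desc_assoc _ _ _).symm
    refine Eq.trans ?_ (Category.assoc _ _ _).symm
    refine Eq.trans ?_ (congrArg _ (coequalizer.π_desc _ _).symm)
    refine (congrArg (· ≫ coequalizer.π _ _) ((toSheaves R).map_comp f g)).trans ?_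
    exact Category.assoc _ _ _

end ExactCompletion

/-- The category `𝒜[T]`: the Barr exact completion of the regular syntactic category of `T`. For a
homology or cohomology theory these are the constructible effective `T`-motives. -/
abbrev ConstructibleMotives (T : RegularTheory.{w}) : Type w := ExactCompletion (Syn T)

/-- The embedding of the syntactic category of `T` in `Ind 𝒜[T]`. -/
noncomputable def toMotives (T : RegularTheory.{w}) : Syn T ⥤ Ind (ConstructibleMotives T) :=
  toExactCompletion (Syn T) ⋙ Ind.yoneda

/-! ## Models -/

section Models

/-- The product `M s₁ ⨯ (M s₂ ⨯ ⋯)` interpreting a context. -/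
noncomputable def ctxObj {S : Type w} {A : Type u} [Category.{v} A] [HasFiniteProducts A]
    (M : S → A) : List S → A
  | [] => ⊤_ A
  | s :: Γ => M s ⨯ ctxObj M Γ

section Ctx

variable {S : Type w} {A : Type u} [Category.{v} A] [HasFiniteProducts A] {M : S → A}

/-- The projection to the factor of a variable. -/
noncomputable def ctxProj : ∀ {Γ : List S} {s : S}, Var Γ s → (ctxObj M Γ ⟶ M s)
  | _, _, .zero => prod.fst
  | _, _, .succ x => prod.snd ≫ ctxProj x

/-- The morphism to the product with given components. -/
noncomputable def ctxLift {X : A} :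
    ∀ {Γ : List S}, (∀ s, Var Γ s → (X ⟶ M s)) → (X ⟶ ctxObj M Γ)
  | [], _ => terminal.from X
  | _ :: _, a => prod.lift (a _ .zero) (ctxLift fun _ x => a _ x.succ)

end Ctx

/-- A structure for the signature `L` in a category with finite products. -/
structure Str (L : Sig.{w}) (A : Type u) [Category.{v} A] [HasFiniteProducts A] where
  obj : L.Sorts → A
  op : ∀ {Δ : List L.Sorts} {s : L.Sorts}, L.Ops Δ s → (ctxObj obj Δ ⟶ obj s)

namespace Str

variable {L : Sig.{w}} {A : Type u} [Category.{v} A]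

section

variable [HasFiniteProducts A]

/-- Morphisms of structures: families of morphisms that commute with the function symbols. -/
@[ext]
structure Hom (M N : Str L A) where
  app : ∀ s, M.obj s ⟶ N.obj s
  comm : ∀ {Δ : List L.Sorts} {s : L.Sorts} (f : L.Ops Δ s),
    M.op f ≫ app s = ctxLift (fun t x => ctxProj x ≫ app t) ≫ N.op f

theorem comp_ctxLift {S : Type w} {M : S → A} {X Y : A} (g : Y ⟶ X) {Γ : List S}
    (a : ∀ s, Var Γ s → (X ⟶ M s)) : g ≫ ctxLift a = ctxLift (fun s x => g ≫ a s x) := by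
  induction Γ with
  | nil => exact terminal.hom_ext _ _
  | cons s Γ ih => exact (prod.comp_lift _ _ _).trans (congrArg (prod.lift _) (ih _))

theorem ctxLift_proj {S : Type w} {M : S → A} {X : A} {Γ : List S}
    (a : ∀ s, Var Γ s → (X ⟶ M s)) {s : S} (x : Var Γ s) : ctxLift a ≫ ctxProj x = a s x := by
  induction x with
  | zero => exact prod.lift_fst _ _
  | succ x ih => exact (prod.lift_snd_assoc _ _ _).trans (ih _)

theorem ctxLift_ctxProj {S : Type w} {M : S → A} (Γ : List S) :
    ctxLift (fun _ x => ctxProj x) = 𝟙 (ctxObj M Γ) := by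
  induction Γ with
  | nil => exact terminal.hom_ext _ _
  | cons s Γ ih =>
    change prod.lift prod.fst (ctxLift fun _ x => prod.snd ≫ ctxProj x) = 𝟙 (M s ⨯ ctxObj M Γ)
    rw [← comp_ctxLift, ih]
    apply Limits.prod.hom_ext <;> simp

instance : Category (Str L A) where
  Hom := Hom
  id M := ⟨fun s => 𝟙 _, fun f => by simp [ctxLift_ctxProj]⟩
  comp φ ψ := ⟨fun s => φ.app s ≫ ψ.app s, fun f => by
    rw [← Category.assoc, φ.comm, Category.assoc, ψ.comm, ← Category.assoc, comp_ctxLift]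
    simp only [← Category.assoc, ctxLift_proj]⟩
  id_comp _ := Hom.ext (by funext s; exact Category.id_comp _)
  comp_id _ := Hom.ext (by funext s; exact Category.comp_id _)
  assoc _ _ _ := Hom.ext (by funext s; exact Category.assoc _ _ _)

/-- The underlying object of the sort `s`, as a functor. -/
@[simps]
def sort (s : L.Sorts) : Str L A ⥤ A where
  obj M := M.obj s
  map φ := Hom.app φ s

/-- Interpretation of terms. -/
noncomputable def term (M : Str L A) {Γ : List L.Sorts} :
    ∀ {s : L.Sorts}, Term L Γ s → (ctxObj M.obj Γ ⟶ M.obj s)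
  | _, .var x => ctxProj x
  | _, .app f a => ctxLift (fun t x => M.term (a t x)) ≫ M.op f

end

variable [HasFiniteLimits A] [HasImages A]

/-- Interpretation of a formula in context `Γ` as a subobject of the product that interprets
`Γ`. -/
noncomputable def formula (M : Str L A) :
    ∀ {Γ : List L.Sorts}, Formula L Γ → Subobject (ctxObj M.obj Γ)
  | _, .top => ⊤
  | _, .eq t t' => equalizerSubobject (M.term t) (M.term t')
  | _, .and φ ψ => M.formula φ ⊓ M.formula ψ
  | Γ, .ex s φ =>
    (Subobject.exists (prod.snd : M.obj s ⨯ ctxObj M.obj Γ ⟶ ctxObj M.obj Γ)).obj (M.formula φ)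

end Str

/-- The property of being a `T`-model: all axioms of `T` are valid. -/
def isModel (T : RegularTheory.{w}) (A : Type u) [Category.{v} A] [HasFiniteLimits A]
    [HasImages A] : ObjectProperty (Str T.sig A) :=
  fun M => ∀ ⦃Γ : List T.sig.Sorts⦄ (φ ψ : Formula T.sig Γ), T.Ax φ ψ → M.formula φ ≤ M.formula ψ

/-- The category of `T`-models in `A`. -/
abbrev Model (T : RegularTheory.{w}) (A : Type u) [Category.{v} A] [HasFiniteLimits A]
    [HasImages A] := (isModel T A).FullSubcategory

end Models

/-! ## Exact functors on ind-objects -/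

/-- Exact functors that preserve filtered colimits. -/
def isExactFinitary (B : Type (w + 1)) [Category.{w} B] (A : Type u) [Category.{v} A] :
    ObjectProperty (B ⥤ A) :=
  fun F => PreservesFiniteLimits F ∧ PreservesFiniteColimits F ∧
    PreservesFilteredColimitsOfSize.{w, w} F

/-- The category of exact functors `B ⥤ A` that preserve filtered colimits, with all natural
transformations. -/
abbrev ExactFinitary (B : Type (w + 1)) [Category.{w} B] (A : Type u) [Category.{v} A] :=
  (isExactFinitary.{w} B A).FullSubcategory

/-- `Φ` sends a functor `F : Ind 𝒜[T] ⥤ A` to the image under `F` of the universal model: naturally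
in `F`, the object of sort `s` of `Φ F` is the value of `F` at `{y : s . ⊤}`, and
the operation of `Φ F` attached to a function symbol `f : Δ → s` is, under these identifications,
the image under `F` of the morphism `f(x⃗) : {x⃗ : Δ . ⊤} ⟶ {y : s . ⊤}`. -/
def IsEvaluationAtUniversalModel {T : RegularTheory.{w}} {A : Type u} [Category.{v} A]
    [HasFiniteLimits A] [HasImages A]
    (Φ : ExactFinitary.{w} (Ind (ConstructibleMotives T)) A ⥤ Model T A) : Prop :=
  ∃ α : ∀ s : T.sig.Sorts,
    ObjectProperty.ι _ ⋙ (evaluation _ A).obj ((toMotives T).obj (Syn.free T [s])) ≅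
      Φ ⋙ ObjectProperty.ι _ ⋙ Str.sort s,
    ∀ (F : ExactFinitary.{w} (Ind (ConstructibleMotives T)) A) {Δ : List T.sig.Sorts}
      {s : T.sig.Sorts} (f : T.sig.Ops Δ s),
      F.obj.map ((toMotives T).map (Syn.termHom (.app f fun _ x => .var x))) ≫ (α s).hom.app F =
        ctxLift (fun t x =>
          F.obj.map ((toMotives T).map (Syn.termHom (.var x))) ≫ (α t).hom.app F) ≫
        (Φ.obj F).obj.op f

/-! ## Categories of pairs -/

/-- A (not necessarily wide or full) subcategory of `C`, given by its morphisms; its objects are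
the objects of `C` whose identity belongs to it. -/
structure Subcat (C : Type w) [SmallCategory C] where
  arrows : MorphismProperty C
  comp_mem : ∀ {X Y Z : C} (f : X ⟶ Y) (g : Y ⟶ Z), arrows f → arrows g → arrows (f ≫ g)
  source_mem : ∀ {X Y : C} (f : X ⟶ Y), arrows f → arrows (𝟙 X)
  target_mem : ∀ {X Y : C} (f : X ⟶ Y), arrows f → arrows (𝟙 Y)

namespace Subcat

variable {C : Type w} [SmallCategory C] (M : Subcat C)

/-- The category of pairs: objects are the arrows `Y ⟶ X` of `M`, written `(X, Y)`, morphisms are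
the commutative squares of `C`. -/
abbrev Pairs : Type w := ObjectProperty.FullSubcategory (fun f : Arrow C => M.arrows f.hom)

variable {M} {X Y Z : C}

def pair (f : Y ⟶ X) (hf : M.arrows f) : M.Pairs := ⟨Arrow.mk f, hf⟩

variable {f : Z ⟶ Y} {g : Y ⟶ X} (hf : M.arrows f) (hg : M.arrows g)

/-- The morphism `∂ : (Y, Z) ⟶ (X, Y)` attached to `Z ⟶ Y ⟶ X`. -/
def bd : pair f hf ⟶ pair g hg := ObjectProperty.homMk (Arrow.homMk f g rfl)

/-- The morphism `(Y, Z) ⟶ (X, Z)` attached to `Z ⟶ Y ⟶ X`. -/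
def incl : pair f hf ⟶ pair (f ≫ g) (M.comp_mem f g hf hg) :=
  ObjectProperty.homMk (Arrow.homMk (𝟙 Z) g (by simp [pair]))

/-- The morphism `(X, Z) ⟶ (X, Y)` attached to `Z ⟶ Y ⟶ X`. -/
def proj : pair (f ≫ g) (M.comp_mem f g hf hg) ⟶ pair g hg :=
  ObjectProperty.homMk (Arrow.homMk f (𝟙 X) (by simp [pair]))

end Subcat

/-! ## Homology and cohomology theories -/

/-- The function symbols `+`, `-`, `0` on each sort. -/
inductive GroupOp {S : Type w} : List S → S → Type w
  | add (s : S) : GroupOp [s, s] s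
  | neg (s : S) : GroupOp [s] s
  | zero (s : S) : GroupOp [] s

section Axioms

/-- Application of a unary function symbol. -/
def Term.app₁ {L : Sig.{w}} {Γ : List L.Sorts} {s t : L.Sorts} (f : L.Ops [s] t)
    (x : Term L Γ s) : Term L Γ t := .app f (Subst.cons x (Subst.nil Γ))

variable {L : Sig.{w}} (grp : ∀ {Δ : List L.Sorts} {s : L.Sorts}, GroupOp Δ s → L.Ops Δ s)

def tAdd {Γ : List L.Sorts} {s : L.Sorts} (x y : Term L Γ s) : Term L Γ s :=
  .app (grp (.add s)) (Subst.cons x (Subst.cons y (Subst.nil Γ)))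

def tNeg {Γ : List L.Sorts} {s : L.Sorts} (x : Term L Γ s) : Term L Γ s :=
  .app (grp (.neg s)) (Subst.cons x (Subst.nil Γ))

def tZero {Γ : List L.Sorts} (s : L.Sorts) : Term L Γ s :=
  .app (grp (.zero s)) (Subst.nil Γ)

/-- Every sort is an abelian group. -/
inductive AbGroupAx : ∀ {Γ : List L.Sorts}, Formula L Γ → Formula L Γ → Prop
  | assoc (s : L.Sorts) : AbGroupAx (Γ := [s, s, s]) .top
      (.eq (tAdd grp (tAdd grp (.var .zero) (.var (.succ .zero))) (.var (.succ (.succ .zero))))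
        (tAdd grp (.var .zero) (tAdd grp (.var (.succ .zero)) (.var (.succ (.succ .zero))))))
  | unit (s : L.Sorts) : AbGroupAx (Γ := [s]) .top
      (.and (.eq (tAdd grp (tZero grp s) (.var .zero)) (.var .zero))
        (.eq (tAdd grp (.var .zero) (tZero grp s)) (.var .zero)))
  | inv (s : L.Sorts) : AbGroupAx (Γ := [s]) .top
      (.and (.eq (tAdd grp (.var .zero) (tNeg grp (.var .zero))) (tZero grp s))
        (.eq (tAdd grp (tNeg grp (.var .zero)) (.var .zero)) (tZero grp s)))
  | comm (s : L.Sorts) : AbGroupAx (Γ := [s, s]) .top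
      (.eq (tAdd grp (.var .zero) (.var (.succ .zero)))
        (tAdd grp (.var (.succ .zero)) (.var .zero)))

/-- The unary function symbol `f` is a homomorphism. -/
inductive HomAx {s t : L.Sorts} (f : L.Ops [s] t) :
    ∀ {Γ : List L.Sorts}, Formula L Γ → Formula L Γ → Prop
  | mk : HomAx f (Γ := [s, s]) .top
      (.eq (.app₁ f (tAdd grp (.var .zero) (.var (.succ .zero))))
        (tAdd grp (.app₁ f (.var .zero)) (.app₁ f (.var (.succ .zero)))))

/-- The sequence `r → s → t` given by the unary function symbols `f` and `g` is exact. -/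
inductive ExactAx {r s t : L.Sorts} (f : L.Ops [r] s) (g : L.Ops [s] t) :
    ∀ {Γ : List L.Sorts}, Formula L Γ → Formula L Γ → Prop
  | complex : ExactAx f g (Γ := [r]) .top (.eq (.app₁ g (.app₁ f (.var .zero))) (tZero grp t))
  | exact : ExactAx f g (Γ := [s]) (.eq (.app₁ g (.var .zero)) (tZero grp t))
      (.ex r (.eq (.app₁ f (.var .zero)) (.var (.succ .zero))))

end Axioms

section Theories

variable {C : Type w} [SmallCategory C] (M : Subcat C)

/-- Function symbols of homology theories; the sort `(n, P)` is `hₙ(P)`. -/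
inductive HomologyOp : List (ℤ × M.Pairs) → ℤ × M.Pairs → Type w
  | grp {Δ : List (ℤ × M.Pairs)} {s : ℤ × M.Pairs} (o : GroupOp Δ s) : HomologyOp Δ s
  /-- `hₙ(P) → hₙ(Q)` for a morphism `P ⟶ Q` of pairs -/
  | map (n : ℤ) {P Q : M.Pairs} (a : P ⟶ Q) : HomologyOp [(n, P)] (n, Q)
  /-- `∂ₙ : hₙ(X, Y) → hₙ₋₁(Y, Z)` for `Z ⟶ Y ⟶ X` in `M` -/
  | bd (n : ℤ) {X Y Z : C} {f : Z ⟶ Y} {g : Y ⟶ X} (hf : M.arrows f) (hg : M.arrows g) :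
      HomologyOp [(n, Subcat.pair g hg)] (n - 1, Subcat.pair f hf)

/-- The signature of homology theories. -/
def homologySig : Sig.{w} := ⟨ℤ × M.Pairs, HomologyOp M⟩

/-- Function symbols of cohomology theories; the sort `(n, P)` is `hⁿ(P)`. -/
inductive CohomologyOp : List (ℤ × M.Pairs) → ℤ × M.Pairs → Type w
  | grp {Δ : List (ℤ × M.Pairs)} {s : ℤ × M.Pairs} (o : GroupOp Δ s) : CohomologyOp Δ s
  /-- `hⁿ(Q) → hⁿ(P)` for a morphism `P ⟶ Q` of pairs -/
  | map (n : ℤ) {P Q : M.Pairs} (a : P ⟶ Q) : CohomologyOp [(n, Q)] (n, P)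
  /-- `∂ⁿ : hⁿ(Y, Z) → hⁿ⁺¹(X, Y)` for `Z ⟶ Y ⟶ X` in `M` -/
  | bd (n : ℤ) {X Y Z : C} {f : Z ⟶ Y} {g : Y ⟶ X} (hf : M.arrows f) (hg : M.arrows g) :
      CohomologyOp [(n, Subcat.pair f hf)] (n + 1, Subcat.pair g hg)

/-- The signature of cohomology theories. -/
def cohomologySig : Sig.{w} := ⟨ℤ × M.Pairs, CohomologyOp M⟩

namespace HomologyOp

variable {M}

def grp' {Δ : List (homologySig M).Sorts} {s : (homologySig M).Sorts} (o : GroupOp Δ s) :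
    (homologySig M).Ops Δ s := HomologyOp.grp o

def map' (n : ℤ) {P Q : M.Pairs} (a : P ⟶ Q) :
    (homologySig M).Ops [((n, P) : ℤ × M.Pairs)] ((n, Q) : ℤ × M.Pairs) := HomologyOp.map n a

def bd' (n : ℤ) {X Y Z : C} {f : Z ⟶ Y} {g : Y ⟶ X} (hf : M.arrows f) (hg : M.arrows g) :
    (homologySig M).Ops [((n, Subcat.pair g hg) : ℤ × M.Pairs)]
      ((n - 1, Subcat.pair f hf) : ℤ × M.Pairs) := HomologyOp.bd n hf hg

end HomologyOp

namespace CohomologyOp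

variable {M}

def grp' {Δ : List (cohomologySig M).Sorts} {s : (cohomologySig M).Sorts} (o : GroupOp Δ s) :
    (cohomologySig M).Ops Δ s := CohomologyOp.grp o

def map' (n : ℤ) {P Q : M.Pairs} (a : P ⟶ Q) :
    (cohomologySig M).Ops [((n, Q) : ℤ × M.Pairs)] ((n, P) : ℤ × M.Pairs) := CohomologyOp.map n a

def bd' (n : ℤ) {X Y Z : C} {f : Z ⟶ Y} {g : Y ⟶ X} (hf : M.arrows f) (hg : M.arrows g) :
    (cohomologySig M).Ops [((n, Subcat.pair f hf) : ℤ × M.Pairs)]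
      ((n + 1, Subcat.pair g hg) : ℤ × M.Pairs) := CohomologyOp.bd n hf hg

end CohomologyOp

open HomologyOp in
/-- The axioms of homology theories. -/
inductive HomologyAx : ∀ {Γ : List (homologySig M).Sorts},
    Formula (homologySig M) Γ → Formula (homologySig M) Γ → Prop
  | grp {Γ : List (homologySig M).Sorts} {φ ψ : Formula (homologySig M) Γ}
      (h : AbGroupAx grp' φ ψ) : HomologyAx φ ψ
  | hom_map (n : ℤ) {P Q : M.Pairs} (a : P ⟶ Q) {Γ : List (homologySig M).Sorts}
      {φ ψ : Formula (homologySig M) Γ} (h : HomAx grp' (map' n a) φ ψ) : HomologyAx φ ψ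
  | hom_bd (n : ℤ) {X Y Z : C} {f : Z ⟶ Y} {g : Y ⟶ X} (hf : M.arrows f) (hg : M.arrows g)
      {Γ : List (homologySig M).Sorts} {φ ψ : Formula (homologySig M) Γ}
      (h : HomAx grp' (bd' n hf hg) φ ψ) : HomologyAx φ ψ
  | map_comp (n : ℤ) {P Q R : M.Pairs} (a : P ⟶ Q) (b : Q ⟶ R) :
      HomologyAx (Γ := [((n, P) : ℤ × M.Pairs)]) .top
        (.eq (.app₁ (map' n b) (.app₁ (map' n a) (.var .zero))) (.app₁ (map' n (a ≫ b)) (.var .zero)))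
  | map_id (n : ℤ) (P : M.Pairs) :
      HomologyAx (Γ := [((n, P) : ℤ × M.Pairs)]) .top
        (.eq (.app₁ (map' n (𝟙 P)) (.var .zero)) (.var .zero))
  /-- naturality of `∂` with respect to `∂`-cubes -/
  | natural (n : ℤ) {X Y Z X' Y' Z' : C} {f : Z ⟶ Y} {g : Y ⟶ X} {f' : Z' ⟶ Y'} {g' : Y' ⟶ X'}
      (hf : M.arrows f) (hg : M.arrows g) (hf' : M.arrows f') (hg' : M.arrows g')
      (a : Subcat.pair f hf ⟶ Subcat.pair f' hf') (b : Subcat.pair g hg ⟶ Subcat.pair g' hg')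
      (hab : Subcat.bd hf hg ≫ b = a ≫ Subcat.bd hf' hg') :
      HomologyAx (Γ := [((n, Subcat.pair g hg) : ℤ × M.Pairs)]) .top
        (.eq (.app₁ (map' (n - 1) a) (.app₁ (bd' n hf hg) (.var .zero)))
          (.app₁ (bd' n hf' hg') (.app₁ (map' n b) (.var .zero))))
  /-- exactness of `hₙ(Y, Z) → hₙ(X, Z) → hₙ(X, Y)` -/
  | exact₁ (n : ℤ) {X Y Z : C} {f : Z ⟶ Y} {g : Y ⟶ X} (hf : M.arrows f) (hg : M.arrows g)
      {Γ : List (homologySig M).Sorts} {φ ψ : Formula (homologySig M) Γ}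
      (h : ExactAx grp' (map' n (Subcat.incl hf hg)) (map' n (Subcat.proj hf hg)) φ ψ) :
      HomologyAx φ ψ
  /-- exactness of `hₙ(X, Z) → hₙ(X, Y) → hₙ₋₁(Y, Z)` -/
  | exact₂ (n : ℤ) {X Y Z : C} {f : Z ⟶ Y} {g : Y ⟶ X} (hf : M.arrows f) (hg : M.arrows g)
      {Γ : List (homologySig M).Sorts} {φ ψ : Formula (homologySig M) Γ}
      (h : ExactAx grp' (map' n (Subcat.proj hf hg)) (bd' n hf hg) φ ψ) : HomologyAx φ ψ
  /-- exactness of `hₙ(X, Y) → hₙ₋₁(Y, Z) → hₙ₋₁(X, Z)` -/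
  | exact₃ (n : ℤ) {X Y Z : C} {f : Z ⟶ Y} {g : Y ⟶ X} (hf : M.arrows f) (hg : M.arrows g)
      {Γ : List (homologySig M).Sorts} {φ ψ : Formula (homologySig M) Γ}
      (h : ExactAx grp' (bd' n hf hg) (map' (n - 1) (Subcat.incl hf hg)) φ ψ) : HomologyAx φ ψ

open CohomologyOp in
/-- The axioms of cohomology theories. -/
inductive CohomologyAx : ∀ {Γ : List (cohomologySig M).Sorts},
    Formula (cohomologySig M) Γ → Formula (cohomologySig M) Γ → Prop
  | grp {Γ : List (cohomologySig M).Sorts} {φ ψ : Formula (cohomologySig M) Γ}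
      (h : AbGroupAx grp' φ ψ) : CohomologyAx φ ψ
  | hom_map (n : ℤ) {P Q : M.Pairs} (a : P ⟶ Q) {Γ : List (cohomologySig M).Sorts}
      {φ ψ : Formula (cohomologySig M) Γ} (h : HomAx grp' (map' n a) φ ψ) : CohomologyAx φ ψ
  | hom_bd (n : ℤ) {X Y Z : C} {f : Z ⟶ Y} {g : Y ⟶ X} (hf : M.arrows f) (hg : M.arrows g)
      {Γ : List (cohomologySig M).Sorts} {φ ψ : Formula (cohomologySig M) Γ}
      (h : HomAx grp' (bd' n hf hg) φ ψ) : CohomologyAx φ ψ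
  | map_comp (n : ℤ) {P Q R : M.Pairs} (a : P ⟶ Q) (b : Q ⟶ R) :
      CohomologyAx (Γ := [((n, R) : ℤ × M.Pairs)]) .top
        (.eq (.app₁ (map' n a) (.app₁ (map' n b) (.var .zero))) (.app₁ (map' n (a ≫ b)) (.var .zero)))
  | map_id (n : ℤ) (P : M.Pairs) :
      CohomologyAx (Γ := [((n, P) : ℤ × M.Pairs)]) .top
        (.eq (.app₁ (map' n (𝟙 P)) (.var .zero)) (.var .zero))
  /-- naturality of `∂` with respect to `∂`-cubes -/
  | natural (n : ℤ) {X Y Z X' Y' Z' : C} {f : Z ⟶ Y} {g : Y ⟶ X} {f' : Z' ⟶ Y'} {g' : Y' ⟶ X'}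
      (hf : M.arrows f) (hg : M.arrows g) (hf' : M.arrows f') (hg' : M.arrows g')
      (a : Subcat.pair f hf ⟶ Subcat.pair f' hf') (b : Subcat.pair g hg ⟶ Subcat.pair g' hg')
      (hab : Subcat.bd hf hg ≫ b = a ≫ Subcat.bd hf' hg') :
      CohomologyAx (Γ := [((n, Subcat.pair f' hf') : ℤ × M.Pairs)]) .top
        (.eq (.app₁ (bd' n hf hg) (.app₁ (map' n a) (.var .zero)))
          (.app₁ (map' (n + 1) b) (.app₁ (bd' n hf' hg') (.var .zero))))
  /-- exactness of `hⁿ(X, Y) → hⁿ(X, Z) → hⁿ(Y, Z)` -/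
  | exact₁ (n : ℤ) {X Y Z : C} {f : Z ⟶ Y} {g : Y ⟶ X} (hf : M.arrows f) (hg : M.arrows g)
      {Γ : List (cohomologySig M).Sorts} {φ ψ : Formula (cohomologySig M) Γ}
      (h : ExactAx grp' (map' n (Subcat.proj hf hg)) (map' n (Subcat.incl hf hg)) φ ψ) :
      CohomologyAx φ ψ
  /-- exactness of `hⁿ(X, Z) → hⁿ(Y, Z) → hⁿ⁺¹(X, Y)` -/
  | exact₂ (n : ℤ) {X Y Z : C} {f : Z ⟶ Y} {g : Y ⟶ X} (hf : M.arrows f) (hg : M.arrows g)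
      {Γ : List (cohomologySig M).Sorts} {φ ψ : Formula (cohomologySig M) Γ}
      (h : ExactAx grp' (map' n (Subcat.incl hf hg)) (bd' n hf hg) φ ψ) : CohomologyAx φ ψ
  /-- exactness of `hⁿ(Y, Z) → hⁿ⁺¹(X, Y) → hⁿ⁺¹(X, Z)` -/
  | exact₃ (n : ℤ) {X Y Z : C} {f : Z ⟶ Y} {g : Y ⟶ X} (hf : M.arrows f) (hg : M.arrows g)
      {Γ : List (cohomologySig M).Sorts} {φ ψ : Formula (cohomologySig M) Γ}
      (h : ExactAx grp' (bd' n hf hg) (map' (n + 1) (Subcat.proj hf hg)) φ ψ) : CohomologyAx φ ψ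

/-- The regular theory of (mixed) homology theories on the category of pairs of `M`. -/
def homologyTheory : RegularTheory.{w} := ⟨homologySig M, HomologyAx M⟩

/-- The regular theory of (mixed) cohomology theories on the category of pairs of `M`. -/
def cohomologyTheory : RegularTheory.{w} := ⟨cohomologySig M, CohomologyAx M⟩

end Theories

end TMotives

namespace TMotives

/-! ## Calculus of generic elements in the syntactic category -/

/-! Only one consequence of the axioms matters: every sort is an abelian group and every function
symbol is a homomorphism (`AdditiveTheory`). Then every regular formula defines a subgroup
(`Formula.provable_subst_add`, `Formula.provable_subst_neg`, `Formula.provable_subst_zero`), because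
equalizers of homomorphisms, intersections and projections of subgroups are subgroups. Provably
functional formulas are therefore homomorphisms, and the category R = `Syn T`, which is regular for
every regular theory, is preadditive.

For such an R the exact completion is abelian. The Yoneda functor embeds R fully faithfully in the
abelian sheaves for the regular topology, and sections lift along epimorphisms of sheaves after
pulling back along a single regular epimorphism of R. It follows that the cokernels of morphisms
between representables are closed under kernels, cokernels and finite products
(`IsLocalEmbedding.abelian`). Forgetting addition identifies these cokernels with the quotients of
representables by equivalence relations. On objects, an equivalence relation in an additive category
amounts to the subobject of the elements equivalent to 0. On morphisms, a map of the underlying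
sheaves of sets is locally induced by a morphism of R, hence is additive. So the exact completion is
abelian, and Ind of a small abelian category is Grothendieck abelian.

The universal property is a composite of three equivalences. Along `Ind.yoneda`
(`isEquivalence_indRestriction`): a functor that preserves filtered colimits is the left Kan
extension of its restriction, and an exact functor extends exactly because filtered colimits in the
target are exact. Along R → 𝒜[T] (`IsEnvelope.isEquivalence_restriction`): each object Z has a
presentation K → X → Z by objects of R, and a regular functor F extends by Z ↦ coker (F K → F X).
From regular functors to models (`Syn.toModel`): the values of a regular functor N at the
one-variable contexts form a structure that interprets φ by N{x⃗ . φ} (`Syn.sat_toStr_iff`).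
Conversely, soundness for generalized elements makes a model interpret each functional formula by an
actual morphism (`Str.exists_graph`). The composite takes the values of a functor at the universal
model by construction. -/

theorem Subst.append_eta {L : Sig.{w}} {Δ Γ Ξ : List L.Sorts} (p : Subst L (Δ ++ Γ) Ξ) :
    append ((inl Δ Γ).comp p) ((inr Δ Γ).comp p) = p := by
  rw [← append_comp, append_inl_inr, id_comp]

theorem Provable.eqs_append {T : RegularTheory.{w}} {Δ Γ Ξ : List T.sig.Sorts}
    {χ : Formula T.sig Ξ} {a a' : Subst T.sig Δ Ξ} {b b' : Subst T.sig Γ Ξ}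
    (h : Provable T χ (.eqs a a')) (h' : Provable T χ (.eqs b b')) :
    Provable T χ (.eqs (.append a b) (.append a' b')) := by
  induction Δ with
  | nil => exact h'
  | cons s Δ ih => exact and_intro (cut h (and_left _ _)) (ih (cut h (and_right _ _)))

theorem Provable.eqs_of_eq {T : RegularTheory.{w}} {Γ Ξ : List T.sig.Sorts}
    {χ : Formula T.sig Ξ} {a b : Subst T.sig Γ Ξ} (h : a = b) : Provable T χ (.eqs a b) :=
  h ▸ .eqs_refl _ _

/-- `Cov χ K`: the extensions of the hypothesis `χ` that satisfy `K` cover it, in the sense that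
what is provable from all of them is provable from `χ`. -/
def Cov {T : RegularTheory.{w}} {Ξ : List T.sig.Sorts} (χ : Formula T.sig Ξ)
    (K : ∀ {Ξ' : List T.sig.Sorts}, Formula T.sig Ξ' → Subst T.sig Ξ Ξ' → Prop) : Prop :=
  ∀ G : Formula T.sig Ξ, (∀ {Ξ' : List T.sig.Sorts} (χ' : Formula T.sig Ξ') (ρ : Subst T.sig Ξ Ξ'),
    Provable T χ' (χ.subst ρ) → K χ' ρ → Provable T χ' (G.subst ρ)) → Provable T χ G

theorem Cov.provable {T : RegularTheory.{w}} {Ξ Γ : List T.sig.Sorts} {χ : Formula T.sig Ξ}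
    {K : ∀ {Ξ' : List T.sig.Sorts}, Formula T.sig Ξ' → Subst T.sig Ξ Ξ' → Prop}
    (h : Cov χ K) {φ : Formula T.sig Γ} {σ : Subst T.sig Γ Ξ}
    (k : ∀ {Ξ' : List T.sig.Sorts} (χ' : Formula T.sig Ξ') (ρ : Subst T.sig Ξ Ξ'),
      Provable T χ' (χ.subst ρ) → K χ' ρ → Provable T χ' (φ.subst (σ.comp ρ))) :
    Provable T χ (φ.subst σ) :=
  h _ fun χ' ρ h1 h2 => by rw [Formula.subst_subst]; exact k χ' ρ h1 h2

theorem Cov.eqs {T : RegularTheory.{w}} {Ξ Γ : List T.sig.Sorts} {χ : Formula T.sig Ξ}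
    {K : ∀ {Ξ' : List T.sig.Sorts}, Formula T.sig Ξ' → Subst T.sig Ξ Ξ' → Prop}
    (h : Cov χ K) {σ τ : Subst T.sig Γ Ξ}
    (k : ∀ {Ξ' : List T.sig.Sorts} (χ' : Formula T.sig Ξ') (ρ : Subst T.sig Ξ Ξ'),
      Provable T χ' (χ.subst ρ) → K χ' ρ → Provable T χ' (.eqs (σ.comp ρ) (τ.comp ρ))) :
    Provable T χ (.eqs σ τ) :=
  h _ fun χ' ρ h1 h2 => by rw [Formula.eqs_subst]; exact k χ' ρ h1 h2

theorem Provable.weaken {T : RegularTheory.{w}} {Γ Ξ Ξ' : List T.sig.Sorts}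
    {χ : Formula T.sig Ξ} {χ' : Formula T.sig Ξ'} {ρ : Subst T.sig Ξ Ξ'}
    (hρ : Provable T χ' (χ.subst ρ)) {φ : Formula T.sig Γ} {σ : Subst T.sig Γ Ξ}
    (h : Provable T χ (φ.subst σ)) : Provable T χ' (φ.subst (σ.comp ρ)) := by
  rw [← Formula.subst_subst]; exact hρ.cut (.subst ρ h)

/-- Covers can be refined successively. With `Cov.pure` this gives covers a monadic calculus, in
which existential eliminations are chained without mentioning the goal. -/
theorem Cov.bind {T : RegularTheory.{w}} {Ξ : List T.sig.Sorts} {χ : Formula T.sig Ξ}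
    {K K' : ∀ {Ξ' : List T.sig.Sorts}, Formula T.sig Ξ' → Subst T.sig Ξ Ξ' → Prop}
    (h : Cov χ K) (k : ∀ {Ξ' : List T.sig.Sorts} (χ' : Formula T.sig Ξ') (ρ : Subst T.sig Ξ Ξ'),
      Provable T χ' (χ.subst ρ) → K χ' ρ → Cov χ' fun χ'' ρ' => K' χ'' (ρ.comp ρ')) :
    Cov χ K' := by
  intro G hG
  refine h G fun χ' ρ h1 h2 => k χ' ρ h1 h2 _ fun χ'' ρ' h3 h4 => ?_
  rw [Formula.subst_subst]
  exact hG χ'' _ (.weaken h3 h1) h4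

theorem Cov.pure {T : RegularTheory.{w}} {Ξ : List T.sig.Sorts} {χ : Formula T.sig Ξ}
    {K : ∀ {Ξ' : List T.sig.Sorts}, Formula T.sig Ξ' → Subst T.sig Ξ Ξ' → Prop}
    (h : K χ (.id Ξ)) : Cov χ K := by
  intro G hG
  have := hG χ (.id Ξ) (by rw [Formula.subst_id]; exact .refl _) h
  rwa [Formula.subst_id] at this

theorem Provable.cov_exs {T : RegularTheory.{w}} {Δ Γ Ξ : List T.sig.Sorts} {χ : Formula T.sig Ξ}
    {φ : Formula T.sig (Δ ++ Γ)} {σ : Subst T.sig Γ Ξ}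
    (h : Provable T χ ((Formula.exs Δ φ).subst σ)) :
    Cov χ fun χ' ρ => ∃ τ, Provable T χ' (φ.subst (.append τ (σ.comp ρ))) :=
  fun _ hG => .exs_cases h fun χ' ρ τ h1 h2 => hG χ' ρ h1 ⟨τ, h2⟩

namespace Syn

variable {T : RegularTheory.{w}} {X Y Z W : Syn T} {Ξ Ξ' : List T.sig.Sorts}
  {χ : Formula T.sig Ξ} {χ' : Formula T.sig Ξ'}

/-- `Rel f χ y x`: the hypothesis `χ` proves `f x = y`. -/
def Rel (f : X ⟶ Y) (χ : Formula T.sig Ξ) (y : Subst T.sig Y.ctx Ξ) (x : Subst T.sig X.ctx Ξ) :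
    Prop :=
  Provable T χ ((Quotient.out (s := FunctionalFormula.setoid X Y) f).graph.subst (.append y x))

/-- The morphism given by a functional formula. -/
def homMk (θ : FunctionalFormula X Y) : X ⟶ Y := Quotient.mk (FunctionalFormula.setoid X Y) θ

theorem homMk_surjective (f : X ⟶ Y) : ∃ θ, f = homMk θ :=
  ⟨Quotient.out (s := FunctionalFormula.setoid X Y) f, (Quotient.out_eq _).symm⟩

/-- The representative chosen by `Quotient.out` is provably equivalent to any other, so it may be
replaced by the functional formula at hand. -/
theorem rel_homMk {θ : FunctionalFormula X Y} {y : Subst T.sig Y.ctx Ξ}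
    {x : Subst T.sig X.ctx Ξ} :
    Rel (homMk θ) χ y x ↔ Provable T χ (θ.graph.subst (.append y x)) := by
  have h : Provable T _ _ ∧ Provable T _ _ :=
    Quotient.mk_out (s := FunctionalFormula.setoid X Y) θ
  exact ⟨fun k => k.cut (.subst _ h.1), fun k => k.cut (.subst _ h.2)⟩

section Rel

variable {f : X ⟶ Y} {g : Y ⟶ Z} {y y' : Subst T.sig Y.ctx Ξ} {x x' : Subst T.sig X.ctx Ξ}

theorem Rel.dom (h : Rel f χ y x) : Provable T χ (X.formula.subst x) :=
  FunctionalFormula.dom' _ h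

theorem Rel.cod (h : Rel f χ y x) : Provable T χ (Y.formula.subst y) :=
  FunctionalFormula.cod' _ h

theorem Rel.unique (h : Rel f χ y x) (h' : Rel f χ y' x) : Provable T χ (.eqs y y') :=
  FunctionalFormula.unique' _ h h'

theorem Rel.weaken {ρ : Subst T.sig Ξ Ξ'} (hρ : Provable T χ' (χ.subst ρ)) (h : Rel f χ y x) :
    Rel f χ' (y.comp ρ) (x.comp ρ) := by
  have := Provable.weaken hρ h
  rwa [Subst.append_comp] at this

theorem Rel.congr (h : Rel f χ y x) (hy : Provable T χ (.eqs y y'))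
    (hx : Provable T χ (.eqs x x')) : Rel f χ y' x' :=
  Provable.leibniz (.eqs_append hy hx) _ h

theorem Rel.congr_left (h : Rel f χ y x) (hy : Provable T χ (.eqs y y')) : Rel f χ y' x :=
  h.congr hy (.eqs_refl _ _)

theorem _root_.TMotives.Cov.rel
    {K : ∀ {Ξ' : List T.sig.Sorts}, Formula T.sig Ξ' → Subst T.sig Ξ Ξ' → Prop}
    (h : Cov χ K)
    (k : ∀ {Ξ' : List T.sig.Sorts} (χ' : Formula T.sig Ξ') (ρ : Subst T.sig Ξ Ξ'),
      Provable T χ' (χ.subst ρ) → K χ' ρ → Rel f χ' (y.comp ρ) (x.comp ρ)) :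
    Rel f χ y x :=
  h.provable fun χ' ρ h1 h2 => by rw [Subst.append_comp]; exact k χ' ρ h1 h2

theorem cov_total (f : X ⟶ Y) (h : Provable T χ (X.formula.subst x)) :
    Cov χ fun χ' ρ => ∃ y, Rel f χ' y (x.comp ρ) :=
  (h.cut (.subst x (Quotient.out (s := FunctionalFormula.setoid X Y) f).total)).cov_exs

theorem Rel.comp {z : Subst T.sig Z.ctx Ξ} (h : Rel f χ y x) (h' : Rel g χ z y) :
    Rel (f ≫ g) χ z x := by
  obtain ⟨θ, rfl⟩ := homMk_surjective f
  obtain ⟨η, rfl⟩ := homMk_surjective g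
  exact (rel_homMk (θ := θ.comp η)).2 (FunctionalFormula.compGraph_mk _ _ y (rel_homMk.1 h)
    (rel_homMk.1 h'))

theorem Rel.cov_comp {z : Subst T.sig Z.ctx Ξ} (h : Rel (f ≫ g) χ z x) :
    Cov χ fun χ' ρ => ∃ y, Rel f χ' y (x.comp ρ) ∧ Rel g χ' (z.comp ρ) y := by
  obtain ⟨θ, rfl⟩ := homMk_surjective f
  obtain ⟨η, rfl⟩ := homMk_surjective g
  intro G hG
  exact FunctionalFormula.compGraph_cases θ η (rel_homMk (θ := θ.comp η) |>.1 h)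
    fun χ' ρ y h1 h2 h3 => hG χ' ρ h1 ⟨y, rel_homMk.2 h2, rel_homMk.2 h3⟩

/-- The composite passes locally through some value of `f` at `x`, and uniqueness identifies that
value with `y`. -/
theorem Rel.of_comp {z : Subst T.sig Z.ctx Ξ} (h : Rel (f ≫ g) χ z x) (h' : Rel f χ y x) :
    Rel g χ z y :=
  h.cov_comp.rel fun _ _ h1 ⟨_, h2, h3⟩ =>
    h3.congr (.eqs_refl _ _) (h2.unique (h'.weaken h1))

/-- One inclusion between total functional graphs forces the other: if g x = y and, locally, f x =
y', then g x = y' as well, so y' = y. -/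
theorem hom_ext {f g : X ⟶ Y} (h : ∀ {Ξ : List T.sig.Sorts} (χ : Formula T.sig Ξ)
    (y : Subst T.sig Y.ctx Ξ) (x : Subst T.sig X.ctx Ξ), Rel f χ y x → Rel g χ y x) : f = g := by
  have h' : ∀ {Ξ : List T.sig.Sorts} (χ : Formula T.sig Ξ) (y : Subst T.sig Y.ctx Ξ)
      (x : Subst T.sig X.ctx Ξ), Rel g χ y x → Rel f χ y x := fun χ y x k =>
    (cov_total f k.dom).rel fun χ' ρ h1 ⟨y', h2⟩ =>
      h2.congr_left ((h _ _ _ h2).unique (k.weaken h1))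
  obtain ⟨θ, rfl⟩ := homMk_surjective f
  obtain ⟨η, rfl⟩ := homMk_surjective g
  exact Quotient.sound ⟨FunctionalFormula.graph_le fun χ y x k => rel_homMk.1 (h _ _ _
    (rel_homMk.2 k)), FunctionalFormula.graph_le fun χ y x k => rel_homMk.1 (h' _ _ _
    (rel_homMk.2 k))⟩

end Rel

/-- Construction of a morphism from its graph. -/
theorem exists_hom (G : Formula T.sig (Y.ctx ++ X.ctx))
    (dom : ∀ {Ξ : List T.sig.Sorts} (χ : Formula T.sig Ξ) (y : Subst T.sig Y.ctx Ξ)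
      (x : Subst T.sig X.ctx Ξ), Provable T χ (G.subst (.append y x)) →
      Provable T χ (X.formula.subst x))
    (cod : ∀ {Ξ : List T.sig.Sorts} (χ : Formula T.sig Ξ) (y : Subst T.sig Y.ctx Ξ)
      (x : Subst T.sig X.ctx Ξ), Provable T χ (G.subst (.append y x)) →
      Provable T χ (Y.formula.subst y))
    (total : ∀ {Ξ : List T.sig.Sorts} (χ : Formula T.sig Ξ) (x : Subst T.sig X.ctx Ξ),
      Provable T χ (X.formula.subst x) →
      Cov χ fun χ' ρ => ∃ y, Provable T χ' (G.subst (.append y (x.comp ρ))))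
    (unique : ∀ {Ξ : List T.sig.Sorts} (χ : Formula T.sig Ξ) (y y' : Subst T.sig Y.ctx Ξ)
      (x : Subst T.sig X.ctx Ξ), Provable T χ (G.subst (.append y x)) →
      Provable T χ (G.subst (.append y' x)) → Provable T χ (.eqs y y')) :
    ∃ f : X ⟶ Y, ∀ {Ξ : List T.sig.Sorts} (χ : Formula T.sig Ξ) (y : Subst T.sig Y.ctx Ξ)
      (x : Subst T.sig X.ctx Ξ), Rel f χ y x ↔ Provable T χ (G.subst (.append y x)) :=
  ⟨homMk {
    graph := G
    dom := dom _ (.inl _ _) _ (by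
      rw [Subst.append_inl_inr, Formula.subst_id]; exact .refl _)
    cod := cod _ _ (.inr _ _) (by
      rw [Subst.append_inl_inr, Formula.subst_id]; exact .refl _)
    total := by
      have : Provable T X.formula ((Formula.exs Y.ctx G).subst (.id _)) :=
        (total X.formula (.id _) (by rw [Formula.subst_id]; exact .refl _)).provable
          fun χ' ρ _ ⟨y, h⟩ => .exs_mk y _ h
      rwa [Formula.subst_id] at this
    unique := unique _ _ _ _ (.and_left _ _) (.and_right _ _) }, fun _ _ _ => rel_homMk⟩

/-- The morphism given by a string of terms. -/
def ofTerms (t : Subst T.sig Y.ctx X.ctx) (ht : Provable T X.formula (Y.formula.subst t)) :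
    X ⟶ Y := homMk (FunctionalFormula.ofTerms X Y t ht)

theorem rel_ofTerms {t : Subst T.sig Y.ctx X.ctx} {ht : Provable T X.formula (Y.formula.subst t)}
    {y : Subst T.sig Y.ctx Ξ} {x : Subst T.sig X.ctx Ξ} :
    Rel (ofTerms t ht) χ y x ↔
      Provable T χ (X.formula.subst x) ∧ Provable T χ (.eqs (t.comp x) y) :=
  rel_homMk.trans FunctionalFormula.ofTerms_iff

theorem rel_ofTerms_self {t : Subst T.sig Y.ctx X.ctx}
    {ht : Provable T X.formula (Y.formula.subst t)} {x : Subst T.sig X.ctx Ξ}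
    (hx : Provable T χ (X.formula.subst x)) : Rel (ofTerms t ht) χ (t.comp x) x :=
  rel_ofTerms.2 ⟨hx, .eqs_refl _ _⟩

theorem id_eq_ofTerms (X : Syn T) :
    𝟙 X = ofTerms (.id _) (by rw [Formula.subst_id]; exact .refl _) := rfl

/-- To compare two morphisms it suffices to compare their values at all elements. -/
theorem hom_ext_cov {f g : X ⟶ Y} (h : ∀ {Ξ : List T.sig.Sorts} (χ : Formula T.sig Ξ)
    (x : Subst T.sig X.ctx Ξ), Provable T χ (X.formula.subst x) →
      Cov χ fun χ' ρ => ∃ y, Rel f χ' y (x.comp ρ) ∧ Rel g χ' y (x.comp ρ)) : f = g :=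
  hom_ext fun χ _ x k => (h χ x k.dom).rel fun _ _ h1 ⟨_, h2, h3⟩ =>
    h3.congr_left (h2.unique (k.weaken h1))

theorem hom_ext_ofTerms {t : Subst T.sig Y.ctx X.ctx}
    {ht : Provable T X.formula (Y.formula.subst t)} {g : X ⟶ Y}
    (h : ∀ {Ξ : List T.sig.Sorts} (χ : Formula T.sig Ξ)
    (x : Subst T.sig X.ctx Ξ), Provable T χ (X.formula.subst x) → Rel g χ (t.comp x) x) :
    ofTerms t ht = g :=
  hom_ext fun χ _ x k => (h χ x k.dom).congr_left (rel_ofTerms.1 k).2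

/-! ### Finite limits -/

/-- The inclusion of `{x⃗ . φ}` in `{x⃗ . ψ}`. -/
def incl {Γ : List T.sig.Sorts} {φ ψ : Formula T.sig Γ} (h : Provable T φ ψ) :
    Syn.mk Γ φ ⟶ Syn.mk Γ ψ :=
  ofTerms (.id _) (by rw [Formula.subst_id]; exact h)

theorem rel_incl {Γ : List T.sig.Sorts} {φ ψ : Formula T.sig Γ} {h : Provable T φ ψ}
    {x y : Subst T.sig Γ Ξ} : Rel (incl h) χ y x ↔
      Provable T χ (φ.subst x) ∧ Provable T χ (.eqs x y) := rel_ofTerms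

/-- A morphism whose values satisfy `φ` factors through `{x⃗ . φ}`. -/
theorem exists_lift_incl {Γ : List T.sig.Sorts} {φ ψ : Formula T.sig Γ} (h : Provable T φ ψ)
    (f : X ⟶ Syn.mk Γ ψ) (hf : ∀ {Ξ : List T.sig.Sorts} (χ : Formula T.sig Ξ)
      (y : Subst T.sig Γ Ξ) (x : Subst T.sig X.ctx Ξ), Rel f χ y x → Provable T χ (φ.subst y)) :
    ∃ g : X ⟶ Syn.mk Γ φ, g ≫ incl h = f := by
  obtain ⟨g, hg⟩ := exists_hom (X := X) (Y := ⟨Γ, φ⟩)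
    (Quotient.out (s := FunctionalFormula.setoid X _) f).graph
    (fun _ _ _ k => Rel.dom (f := f) k) (fun _ _ _ k => hf _ _ _ k)
    (fun _ _ k => cov_total f k) (fun _ _ _ _ k k' => Rel.unique (f := f) k k')
  refine ⟨g, (hom_ext fun χ y x k => ?_).symm⟩
  exact Rel.comp ((hg _ _ _).2 k) (rel_incl.2 ⟨hf _ _ _ k, .eqs_refl _ _⟩)

instance mono_incl {Γ : List T.sig.Sorts} {φ ψ : Formula T.sig Γ} (h : Provable T φ ψ) :
    Mono (incl h) where
  right_cancellation {Z} f g e := hom_ext fun χ y x k => by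
    have : Rel (f ≫ incl h) χ y x := k.comp (rel_incl.2 ⟨k.cod, .eqs_refl _ _⟩)
    rw [e] at this
    exact this.cov_comp.rel fun _ _ h1 ⟨_, h2, h3⟩ => h2.congr_left (rel_incl.1 h3).2

/-- `{[] . ⊤}` is terminal. -/
def isTerminalFreeNil (T : RegularTheory.{w}) : IsTerminal (free T []) :=
  IsTerminal.ofUniqueHom (fun _ => ofTerms (.nil _) (.top_intro _))
    (fun _ f => (hom_ext_ofTerms fun _ _ hx => (cov_total f hx).rel fun _ _ _ ⟨_, hy⟩ =>
      hy.congr_left (.top_intro _)).symm)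

section Pair

variable {ζ : Formula T.sig (X.ctx ++ Y.ctx)}

/-- The morphism with given components to a subobject of a product. -/
theorem exists_pair (ζ : Formula T.sig (X.ctx ++ Y.ctx)) (a : W ⟶ X) (b : W ⟶ Y)
    (h : ∀ {Ξ : List T.sig.Sorts} (χ : Formula T.sig Ξ) (x : Subst T.sig X.ctx Ξ)
      (y : Subst T.sig Y.ctx Ξ) (w : Subst T.sig W.ctx Ξ), Rel a χ x w → Rel b χ y w →
      Provable T χ (ζ.subst (.append x y))) :
    ∃ f : W ⟶ Syn.mk (X.ctx ++ Y.ctx) ζ, ∀ {Ξ : List T.sig.Sorts} (χ : Formula T.sig Ξ)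
      (x : Subst T.sig X.ctx Ξ) (y : Subst T.sig Y.ctx Ξ) (w : Subst T.sig W.ctx Ξ),
      Rel f χ (.append x y) w ↔ Rel a χ x w ∧ Rel b χ y w := by
  have key : ∀ {Ξ : List T.sig.Sorts} (χ : Formula T.sig Ξ) (p : Subst T.sig (X.ctx ++ Y.ctx) Ξ)
      (w : Subst T.sig W.ctx Ξ), Provable T χ ((Formula.and
        ((Quotient.out (s := FunctionalFormula.setoid W X) a).graph.subst
          (.append ((Subst.inl X.ctx Y.ctx).comp (.inl _ W.ctx)) (.inr _ _)))
        ((Quotient.out (s := FunctionalFormula.setoid W Y) b).graph.subst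
          (.append ((Subst.inr X.ctx Y.ctx).comp (.inl _ W.ctx)) (.inr _ _)))).subst
        (.append p w)) ↔
        Rel a χ ((Subst.inl _ _).comp p) w ∧ Rel b χ ((Subst.inr _ _).comp p) w := by
    intro Ξ χ p w
    simp only [Formula.subst, Formula.subst_subst, Subst.append_comp, Subst.comp_assoc,
      Subst.inl_append, Subst.inr_append]
    exact ⟨fun h => ⟨h.cut (.and_left _ _), h.cut (.and_right _ _)⟩, fun h => .and_intro h.1 h.2⟩
  obtain ⟨f, hf⟩ := exists_hom (X := W) (Y := ⟨X.ctx ++ Y.ctx, ζ⟩) _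
    (fun χ p w k => ((key χ p w).1 k).1.dom)
    (fun χ p w k => by
      have := h _ _ _ _ ((key χ p w).1 k).1 ((key χ p w).1 k).2
      rwa [Subst.append_eta] at this)
    (fun χ w k => (cov_total a k).bind fun χ' ρ h1 ⟨x, h2⟩ =>
      (cov_total b (.weaken h1 k)).bind fun χ'' ρ' h3 ⟨y, h4⟩ =>
        .pure ⟨.append (x.comp ρ') y, (key _ _ _).2 (by
          simp only [Subst.inl_append, Subst.inr_append, Subst.comp_id, ← Subst.comp_assoc]
          exact ⟨h2.weaken h3, h4⟩)⟩)
    (fun χ p p' w k k' => by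
      have := Provable.eqs_append (((key _ _ _).1 k).1.unique ((key _ _ _).1 k').1)
        (((key _ _ _).1 k).2.unique ((key _ _ _).1 k').2)
      rwa [Subst.append_eta, Subst.append_eta] at this)
  refine ⟨f, fun χ x y w => (hf _ _ _).trans ((key _ _ _).trans ?_)⟩
  simp only [Subst.inl_append, Subst.inr_append]

/-- The first projection. -/
def fst (h : Provable T ζ (X.formula.subst (.inl _ _))) : Syn.mk (X.ctx ++ Y.ctx) ζ ⟶ X :=
  ofTerms (.inl _ _) h

/-- The second projection. -/
def snd (h : Provable T ζ (Y.formula.subst (.inr _ _))) : Syn.mk (X.ctx ++ Y.ctx) ζ ⟶ Y :=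
  ofTerms (.inr _ _) h

variable {h₁ : Provable T ζ (X.formula.subst (.inl _ _))}
  {h₂ : Provable T ζ (Y.formula.subst (.inr _ _))}

theorem rel_fst {x x' : Subst T.sig X.ctx Ξ} {y : Subst T.sig Y.ctx Ξ} :
    Rel (fst h₁) χ x' (.append x y) ↔
      Provable T χ (ζ.subst (.append x y)) ∧ Provable T χ (.eqs x x') := by
  refine rel_ofTerms.trans ?_
  rw [Subst.inl_append]

theorem rel_snd {x : Subst T.sig X.ctx Ξ} {y y' : Subst T.sig Y.ctx Ξ} :
    Rel (snd h₂) χ y' (.append x y) ↔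
      Provable T χ (ζ.subst (.append x y)) ∧ Provable T χ (.eqs y y') := by
  refine rel_ofTerms.trans ?_
  rw [Subst.inr_append]

theorem pair_hom_ext (h₁ : Provable T ζ (X.formula.subst (.inl _ _)))
    (h₂ : Provable T ζ (Y.formula.subst (.inr _ _))) {f g : W ⟶ Syn.mk (X.ctx ++ Y.ctx) ζ}
    (e₁ : f ≫ fst h₁ = g ≫ fst h₁) (e₂ : f ≫ snd h₂ = g ≫ snd h₂) : f = g := by
  refine hom_ext fun χ p w k => ?_
  rw [← Subst.append_eta p] at k ⊢
  have k1 := k.comp (rel_fst (h₁ := h₁).2 ⟨k.cod, .eqs_refl _ _⟩)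
  have k2 := k.comp (rel_snd (h₂ := h₂).2 ⟨k.cod, .eqs_refl _ _⟩)
  rw [e₁] at k1
  rw [e₂] at k2
  refine (cov_total g k.dom).rel fun χ' ρ h1 ⟨q, hq⟩ => ?_
  rw [← Subst.append_eta q] at hq
  rw [Subst.append_comp]
  exact hq.congr_left (.eqs_append (rel_fst.1 ((k1.weaken h1).of_comp hq)).2
    (rel_snd.1 ((k2.weaken h1).of_comp hq)).2)

theorem exists_lift_pair (h₁ : Provable T ζ (X.formula.subst (.inl _ _)))
    (h₂ : Provable T ζ (Y.formula.subst (.inr _ _))) (a : W ⟶ X) (b : W ⟶ Y)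
    (h : ∀ {Ξ : List T.sig.Sorts} (χ : Formula T.sig Ξ) (x : Subst T.sig X.ctx Ξ)
      (y : Subst T.sig Y.ctx Ξ) (w : Subst T.sig W.ctx Ξ), Rel a χ x w → Rel b χ y w →
      Provable T χ (ζ.subst (.append x y))) :
    ∃ f : W ⟶ Syn.mk (X.ctx ++ Y.ctx) ζ, f ≫ fst h₁ = a ∧ f ≫ snd h₂ = b := by
  obtain ⟨f, hf⟩ := exists_pair ζ a b h
  refine ⟨f, hom_ext fun χ x w k => k.cov_comp.rel fun χ' ρ h1 ⟨p, h2, h3⟩ => ?_,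
    hom_ext fun χ x w k => k.cov_comp.rel fun χ' ρ h1 ⟨p, h2, h3⟩ => ?_⟩ <;>
  · rw [← Subst.append_eta p] at h2 h3
    first
    | exact ((hf _ _ _ _).1 h2).1.congr_left (rel_fst.1 h3).2
    | exact ((hf _ _ _ _).1 h2).2.congr_left (rel_snd.1 h3).2

/-- The projections are already jointly monic on any subobject `ζ` of the product, so only the
existence of lifts is at stake; for this `ζ` must contain all pairs with a common value. -/
theorem isPullback_of_rel {f : X ⟶ Z} {g : Y ⟶ Z}
    (h₁ : Provable T ζ (X.formula.subst (.inl _ _)))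
    (h₂ : Provable T ζ (Y.formula.subst (.inr _ _)))
    (w : fst h₁ ≫ f = snd h₂ ≫ g)
    (h : ∀ {Ξ : List T.sig.Sorts} (χ : Formula T.sig Ξ) (x : Subst T.sig X.ctx Ξ)
      (y : Subst T.sig Y.ctx Ξ) (z : Subst T.sig Z.ctx Ξ), Rel f χ z x → Rel g χ z y →
      Provable T χ (ζ.subst (.append x y))) : IsPullback (fst h₁) (snd h₂) f g := by
  suffices key : ∀ s : PullbackCone f g, ∃ l : s.pt ⟶ Syn.mk (X.ctx ++ Y.ctx) ζ,
      l ≫ fst h₁ = s.fst ∧ l ≫ snd h₂ = s.snd from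
    ⟨⟨w⟩, ⟨PullbackCone.IsLimit.mk _ (fun s => (key s).choose)
      (fun s => (key s).choose_spec.1) (fun s => (key s).choose_spec.2)
      (fun s m e₁ e₂ => pair_hom_ext h₁ h₂ (e₁.trans (key s).choose_spec.1.symm)
        (e₂.trans (key s).choose_spec.2.symm))⟩⟩
  intro s
  refine exists_lift_pair h₁ h₂ s.fst s.snd fun χ x y w k k' => ?_
  refine (cov_total f k.cod).provable fun χ' ρ h1 ⟨z, hz⟩ => ?_
  rw [Subst.append_comp]
  have := (k.weaken h1).comp hz
  rw [s.condition] at this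
  exact h _ _ _ _ hz (this.of_comp (k'.weaken h1))

/-- The formula `∃ z (f x = z ∧ g y = z)`. -/
noncomputable def pullbackFormula (f : X ⟶ Z) (g : Y ⟶ Z) : Formula T.sig (X.ctx ++ Y.ctx) :=
  .exs Z.ctx (.and
    ((Quotient.out (s := FunctionalFormula.setoid X Z) f).graph.subst
      (.append (.inl _ _) ((Subst.inl X.ctx Y.ctx).comp (.inr _ _))))
    ((Quotient.out (s := FunctionalFormula.setoid Y Z) g).graph.subst
      (.append (.inl _ _) ((Subst.inr X.ctx Y.ctx).comp (.inr _ _)))))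

theorem pullbackFormula_mk {f : X ⟶ Z} {g : Y ⟶ Z} {x : Subst T.sig X.ctx Ξ}
    {y : Subst T.sig Y.ctx Ξ} {z : Subst T.sig Z.ctx Ξ} (h : Rel f χ z x) (h' : Rel g χ z y) :
    Provable T χ ((pullbackFormula f g).subst (.append x y)) := by
  refine .exs_mk z _ ?_
  simp only [Formula.subst, Formula.subst_subst, Subst.append_comp, Subst.comp_assoc,
      Subst.inl_append, Subst.inr_append]
  exact .and_intro h h'

theorem cov_pullbackFormula {f : X ⟶ Z} {g : Y ⟶ Z} {x : Subst T.sig X.ctx Ξ}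
    {y : Subst T.sig Y.ctx Ξ} (h : Provable T χ ((pullbackFormula f g).subst (.append x y))) :
    Cov χ fun χ' ρ => ∃ z, Rel f χ' z (x.comp ρ) ∧ Rel g χ' z (y.comp ρ) := by
  refine h.cov_exs.bind fun χ' ρ h1 ⟨z, hz⟩ => .pure ⟨z, ?_⟩
  simp only [Formula.subst, Formula.subst_subst, Subst.append_comp, Subst.comp_assoc,
      Subst.inl_append, Subst.inr_append] at hz
  rw [Subst.comp_id]
  exact ⟨hz.cut (.and_left _ _), hz.cut (.and_right _ _)⟩

theorem provable_of_forall_append {Γ Δ : List T.sig.Sorts} {φ ψ : Formula T.sig (Γ ++ Δ)}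
    (h : ∀ {Ξ : List T.sig.Sorts} (χ : Formula T.sig Ξ) (x : Subst T.sig Γ Ξ)
      (y : Subst T.sig Δ Ξ), Provable T χ (φ.subst (.append x y)) →
      Provable T χ (ψ.subst (.append x y))) : Provable T φ ψ :=
  FunctionalFormula.provable_of_forall fun χ p k => by
    rw [← Subst.append_eta p] at k ⊢
    exact h _ _ _ k

theorem pullbackFormula_left (f : X ⟶ Z) (g : Y ⟶ Z) :
    Provable T (pullbackFormula f g) (X.formula.subst (.inl _ _)) :=
  provable_of_forall_append fun χ x y k => by
    rw [Formula.subst_subst, Subst.inl_append]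
    exact (cov_pullbackFormula k).provable fun _ _ _ ⟨z, h, _⟩ => h.dom

theorem pullbackFormula_right (f : X ⟶ Z) (g : Y ⟶ Z) :
    Provable T (pullbackFormula f g) (Y.formula.subst (.inr _ _)) :=
  provable_of_forall_append fun χ x y k => by
    rw [Formula.subst_subst, Subst.inr_append]
    exact (cov_pullbackFormula k).provable fun _ _ _ ⟨z, _, h⟩ => h.dom

theorem isPullback_pullbackFormula (f : X ⟶ Z) (g : Y ⟶ Z) :
    IsPullback (fst (pullbackFormula_left f g)) (snd (pullbackFormula_right f g)) f g := by
  refine isPullback_of_rel _ _ (hom_ext_cov fun χ p k => ?_) fun _ _ _ _ => pullbackFormula_mk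
  rw [← Subst.append_eta p] at k ⊢
  refine (cov_pullbackFormula k).bind fun χ' ρ h1 ⟨z, h2, h3⟩ => .pure ⟨z, ?_⟩
  rw [Subst.comp_id, Subst.append_comp]
  have k' := Provable.weaken h1 k
  rw [Subst.append_comp] at k'
  exact ⟨Rel.comp (rel_fst.2 ⟨k', .eqs_refl _ _⟩) h2, Rel.comp (rel_snd.2 ⟨k', .eqs_refl _ _⟩) h3⟩

end Pair

instance : HasFiniteLimits (Syn T) :=
  have : HasTerminal (Syn T) := (isTerminalFreeNil T).hasTerminal
  have : HasPullbacks (Syn T) :=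
    have : ∀ {X Y Z : Syn T} {f : X ⟶ Z} {g : Y ⟶ Z}, HasLimit (cospan f g) :=
      fun {_ _ _ f g} => (isPullback_pullbackFormula f g).hasPullback
    hasPullbacks_of_hasLimit_cospan _
  hasFiniteLimits_of_hasTerminal_and_pullbacks

/-! ### Regular epimorphisms -/

/-- Every element of `Y` is locally the value of `f` at an element of `X`. -/
structure Surj (f : X ⟶ Y) : Prop where
  cov : ∀ {Ξ : List T.sig.Sorts} (χ : Formula T.sig Ξ) (y : Subst T.sig Y.ctx Ξ),
    Provable T χ (Y.formula.subst y) → Cov χ fun χ' ρ => ∃ x, Rel f χ' (y.comp ρ) x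

theorem Surj.of_comp {f : X ⟶ Y} {g : Y ⟶ Z} (h : Surj (f ≫ g)) : Surj g :=
  ⟨fun χ z k => (h.cov χ z k).bind fun χ' ρ _ ⟨_, h2⟩ => h2.cov_comp.bind fun _ ρ' _ ⟨y, _, h3⟩ =>
    .pure ⟨y, by rw [Subst.comp_id, ← Subst.comp_assoc]; exact h3⟩⟩

theorem surj_id (X : Syn T) : Surj (𝟙 X) :=
  ⟨fun χ x k => .pure ⟨x, rel_ofTerms.2 ⟨k, by rw [Subst.comp_id]; exact .eqs_refl _ _⟩⟩⟩

theorem Surj.comp {f : X ⟶ Y} {g : Y ⟶ Z} (hf : Surj f) (hg : Surj g) : Surj (f ≫ g) :=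
  ⟨fun χ z k => (hg.cov χ z k).bind fun χ' ρ _ ⟨y, h2⟩ =>
    (hf.cov χ' y h2.dom).bind fun χ'' ρ' h3 ⟨x, h4⟩ =>
    .pure ⟨x, by rw [Subst.comp_id, ← Subst.comp_assoc]; exact h4.comp (h2.weaken h3)⟩⟩

theorem surj_of_isIso (f : X ⟶ Y) [IsIso f] : Surj f :=
  Surj.of_comp (f := inv f) (by rw [IsIso.inv_hom_id]; exact surj_id _)

/-- The formula `∃ x (f x = y)`. -/
noncomputable def imageFormula (f : X ⟶ Y) : Formula T.sig Y.ctx :=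
  .exs X.ctx ((Quotient.out (s := FunctionalFormula.setoid X Y) f).graph.subst
      (.append (.inr _ _) (.inl _ _)))

theorem imageFormula_mk {f : X ⟶ Y} {x : Subst T.sig X.ctx Ξ} {y : Subst T.sig Y.ctx Ξ}
    (h : Rel f χ y x) : Provable T χ ((imageFormula f).subst y) := by
  refine .exs_mk x _ ?_
  simp only [Formula.subst_subst, Subst.append_comp, Subst.inl_append, Subst.inr_append]
  exact h

theorem cov_imageFormula {f : X ⟶ Y} {y : Subst T.sig Y.ctx Ξ}
    (h : Provable T χ ((imageFormula f).subst y)) :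
    Cov χ fun χ' ρ => ∃ x, Rel f χ' (y.comp ρ) x := by
  refine h.cov_exs.bind fun χ' ρ h1 ⟨x, hx⟩ => .pure ⟨x, ?_⟩
  simp only [Formula.subst_subst, Subst.append_comp, Subst.inl_append, Subst.inr_append] at hx
  rw [Subst.comp_id]
  exact hx

theorem imageFormula_le (f : X ⟶ Y) : Provable T (imageFormula f) Y.formula :=
  FunctionalFormula.provable_of_forall fun _ _ k =>
    (cov_imageFormula k).provable fun _ _ _ ⟨_, h⟩ => h.cod

/-- The image factorization: the image of `f` is {y . ∃ x, f x = y}. -/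
theorem exists_surj_comp_incl (f : X ⟶ Y) :
    ∃ e : X ⟶ Syn.mk Y.ctx (imageFormula f), Surj e ∧ e ≫ incl (imageFormula_le f) = f := by
  obtain ⟨e, he⟩ := exists_lift_incl (imageFormula_le f) f fun _ _ _ k => imageFormula_mk k
  refine ⟨e, ⟨fun χ y k => (cov_imageFormula (f := f) (y := y) k).bind fun χ' ρ h1 ⟨x, hx⟩ => ?_⟩,
    he⟩
  rw [← he] at hx
  exact hx.cov_comp.bind fun χ'' ρ' h2 ⟨y', h3, h4⟩ => .pure ⟨x.comp ρ', by
    rw [Subst.comp_id, ← Subst.comp_assoc]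
    exact h3.congr_left (rel_incl.1 h4).2⟩

/-- The induced morphism has the graph ∃ x (k x = w ∧ f x = y). Local surjectivity of `f` makes it
total, and constancy of `k` on the fibres makes it single-valued. -/
theorem Surj.exists_desc {f : X ⟶ Y} (hf : Surj f) (k : X ⟶ W)
    (hk : ∀ {Ξ : List T.sig.Sorts} (χ : Formula T.sig Ξ) (y : Subst T.sig Y.ctx Ξ)
      (x x' : Subst T.sig X.ctx Ξ) (w : Subst T.sig W.ctx Ξ), Rel f χ y x → Rel f χ y x' →
      Rel k χ w x → Rel k χ w x') : ∃ d : Y ⟶ W, f ≫ d = k := by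
  have key : ∀ {Ξ : List T.sig.Sorts} (χ : Formula T.sig Ξ) (w : Subst T.sig W.ctx Ξ)
      (y : Subst T.sig Y.ctx Ξ), Provable T χ ((Formula.exs X.ctx (.and
      ((Quotient.out (s := FunctionalFormula.setoid X W) k).graph.subst
        (.append ((Subst.inl W.ctx Y.ctx).comp (.inr _ _)) (.inl _ _)))
      ((Quotient.out (s := FunctionalFormula.setoid X Y) f).graph.subst
        (.append ((Subst.inr W.ctx Y.ctx).comp (.inr _ _)) (.inl _ _))))).subst
      (.append w y)) ↔ Cov χ fun χ' ρ => ∃ x, Rel k χ' (w.comp ρ) x ∧ Rel f χ' (y.comp ρ) x := by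
    intro Ξ χ w y
    refine ⟨fun h => h.cov_exs.bind fun χ' ρ h1 ⟨x, hx⟩ => .pure ⟨x, ?_⟩, fun h =>
      h.provable fun χ' ρ h1 ⟨x, h2, h3⟩ => .exs_mk x _ ?_⟩
    · simp only [Formula.subst, Formula.subst_subst, Subst.append_comp, Subst.comp_assoc,
        Subst.inl_append, Subst.inr_append] at hx
      rw [Subst.comp_id]
      exact ⟨hx.cut (.and_left _ _), hx.cut (.and_right _ _)⟩
    · simp only [Formula.subst, Formula.subst_subst, Subst.append_comp, Subst.comp_assoc,
        Subst.inl_append, Subst.inr_append]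
      exact .and_intro h2 h3
  obtain ⟨d, hd⟩ := exists_hom (X := Y) (Y := W) _
    (fun χ w y h => ((key _ _ _).1 h).provable fun χ' ρ h1 ⟨x, h2, h3⟩ => h3.cod)
    (fun χ w y h => ((key _ _ _).1 h).provable fun χ' ρ h1 ⟨x, h2, h3⟩ => h2.cod)
    (fun χ y h => (hf.cov χ y h).bind fun χ' ρ h1 ⟨x, h2⟩ => (cov_total k h2.dom).bind
      fun χ'' ρ' h3 ⟨w, h4⟩ => .pure ⟨w, (key _ _ _).2 (.pure ⟨x.comp ρ', by
        rw [Subst.comp_id, Subst.comp_id, Subst.comp_id, ← Subst.comp_assoc]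
        exact ⟨h4, h2.weaken h3⟩⟩)⟩)
    (fun χ w w' y h h' => ((key _ _ _).1 h).eqs fun χ' ρ h1 ⟨x, h2, h3⟩ =>
      (Cov.eqs ((key _ _ _).1 (by
        have := Provable.weaken h1 h'
        rwa [Subst.append_comp] at this)) fun χ'' ρ' h4 ⟨x', h5, h6⟩ =>
        (hk _ _ _ _ _ (h3.weaken h4) h6 (h2.weaken h4)).unique h5))
  refine ⟨d, hom_ext fun χ w x h => h.cov_comp.rel fun χ' ρ h1 ⟨y, h2, h3⟩ =>
    ((key _ _ _).1 ((hd _ _ _).1 h3)).rel fun χ'' ρ' h4 ⟨x', h5, h6⟩ => ?_⟩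
  exact hk _ _ _ _ _ h6 (h2.weaken h4) h5

theorem Surj.epi {f : X ⟶ Y} (hf : Surj f) : Epi f where
  left_cancellation {Z} a b e := hom_ext fun χ z y k =>
    (hf.cov χ y k.dom).rel fun χ' ρ h1 ⟨x, hx⟩ => by
      have := hx.comp (k.weaken h1)
      rw [e] at this
      exact this.of_comp hx

/-- Two elements with the same value under `f` form an element of the syntactic pullback of `f` with
itself. That pullback maps to `Z` compatibly with the projections, so the equation satisfied by `p`
and `q` applies to the two elements. -/
theorem Surj.exists_desc_of_isKernelPair {f : X ⟶ Y} (hf : Surj f) {p q : Z ⟶ X}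
    (h : IsKernelPair f p q) (k : X ⟶ W) (e : p ≫ k = q ≫ k) : ∃ d : Y ⟶ W, f ≫ d = k := by
  refine hf.exists_desc k fun χ y x x' w h1 h2 h3 => ?_
  have e' : fst (pullbackFormula_left f f) ≫ k = snd (pullbackFormula_right f f) ≫ k := by
    have hp := isPullback_pullbackFormula f f
    rw [← h.lift_fst _ _ hp.w, Category.assoc, e, ← Category.assoc, h.lift_snd]
  have hp := pullbackFormula_mk h1 h2
  have := Rel.comp (rel_fst (h₁ := pullbackFormula_left f f).2 ⟨hp, .eqs_refl _ _⟩) h3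
  rw [e'] at this
  exact this.of_comp (rel_snd.2 ⟨hp, .eqs_refl _ _⟩)

noncomputable def Surj.isColimit {f : X ⟶ Y} (hf : Surj f) {p q : Z ⟶ X} (h : IsKernelPair f p q) :
    IsColimit (Cofork.ofπ f h.w) :=
  Cofork.IsColimit.mk _ (fun s => (hf.exists_desc_of_isKernelPair h s.π s.condition).choose)
    (fun s => (hf.exists_desc_of_isKernelPair h s.π s.condition).choose_spec)
    (fun s m e => by
      have := hf.epi
      rw [← cancel_epi f]
      exact e.trans (hf.exists_desc_of_isKernelPair h s.π s.condition).choose_spec.symm)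

theorem Surj.isRegularEpi {f : X ⟶ Y} (hf : Surj f) : IsRegularEpi f :=
  ⟨⟨{ W := _, left := _, right := _, w := _,
      isColimit := hf.isColimit (isPullback_pullbackFormula f f) }⟩⟩

/-- The inclusion of the image of a regular epimorphism is both monic and strongly epic, hence
invertible. -/
theorem surj_of_isRegularEpi (f : X ⟶ Y) [IsRegularEpi f] : Surj f := by
  obtain ⟨e, he, hm⟩ := exists_surj_comp_incl f
  have : StrongEpi (e ≫ incl (imageFormula_le f)) := by rw [hm]; infer_instance
  have : StrongEpi (incl (imageFormula_le f)) := strongEpi_of_strongEpi e _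
  have : IsIso (incl (imageFormula_le f)) := isIso_of_mono_of_strongEpi _
  rw [← hm]
  exact he.comp (surj_of_isIso (incl (imageFormula_le f)))

theorem Surj.of_isPullback {P : Syn T} {p : P ⟶ X} {q : P ⟶ Y} {f : X ⟶ Z} {g : Y ⟶ Z}
    (h : IsPullback p q f g) (hf : Surj f) : Surj q := by
  refine Surj.of_comp (f := h.lift _ _ (isPullback_pullbackFormula f g).w) ?_
  rw [h.lift_snd]
  refine ⟨fun χ y k => (cov_total g k).bind fun χ' ρ h1 ⟨z, hz⟩ => (hf.cov χ' z hz.cod).bind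
    fun χ'' ρ' h2 ⟨x, hx⟩ => .pure ⟨.append x (y.comp (ρ.comp ρ')), ?_⟩⟩
  rw [Subst.comp_id]
  exact rel_snd.2 ⟨pullbackFormula_mk hx (by
    have := hz.weaken h2
    rwa [Subst.comp_assoc] at this), .eqs_refl _ _⟩

/-- Regular epimorphisms are exactly the morphisms satisfying `Surj`, and these are visibly stable
under pullback. A kernel pair of `f` is also one of the surjective part of `f`, whose target is then
the coequalizer. -/
instance : Regular (Syn T) where
  hasCoequalizer_of_isKernelPair {X Y Z f g₁ g₂} h := by
    obtain ⟨e, he, hm⟩ := exists_surj_comp_incl f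
    have : IsKernelPair e g₁ g₂ := by
      rw [← hm] at h
      exact h.cancel_right_of_mono
    exact ⟨⟨_, he.isColimit this⟩⟩
  regularEpiIsStableUnderBaseChange := ⟨fun h hf =>
    (Surj.of_isPullback h (@surj_of_isRegularEpi _ _ _ _ hf)).isRegularEpi⟩

end Syn

end TMotives

namespace TMotives

/-! ## Additive theories -/

/-! ### Provable equality is a congruence. -/

section Equality

variable {T : RegularTheory.{w}} {Γ Δ Ξ : List T.sig.Sorts} {χ : Formula T.sig Ξ} {s : T.sig.Sorts}

theorem Provable.eqs_iff {σ τ : Subst T.sig Γ Ξ} :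
    Provable T χ (.eqs σ τ) ↔ ∀ s x, Provable T χ (.eq (σ s x) (τ s x)) := by
  induction Γ with
  | nil => exact ⟨fun _ _ x => (nomatch x), fun _ => .top_intro _⟩
  | cons s Γ ih =>
    refine ⟨fun h t x => ?_, fun h => .and_intro (h _ _) (ih.2 fun _ x => h _ x.succ)⟩
    cases x with
    | zero => exact h.cut (.and_left _ _)
    | succ x => exact ih.1 (h.cut (.and_right _ _)) t x

theorem Provable.eq_congr {σ τ : Subst T.sig Γ Ξ} (h : Provable T χ (.eqs σ τ))
    (t : Term T.sig Γ s) : Provable T χ (.eq (t.subst σ) (t.subst τ)) := by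
  have := Provable.leibniz (Provable.eqs_append (.eqs_refl χ σ) h)
    (.eq (t.subst (.inl Γ Γ)) (t.subst (.inr Γ Γ)))
  simp only [Formula.subst, Term.subst_subst, Subst.inl_append, Subst.inr_append] at this
  exact this ((Provable.top_intro _).cut (.eq_refl _))

theorem Provable.app_congr {f : T.sig.Ops Δ s} {a b : Subst T.sig Δ Ξ}
    (h : Provable T χ (.eqs a b)) : Provable T χ (.eq (.app f a) (.app f b)) :=
  eq_congr h (.app f fun _ x => .var x)

theorem Provable.eq_rfl {t : Term T.sig Ξ s} : Provable T χ (.eq t t) :=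
  (Provable.top_intro _).cut (.eq_refl _)

theorem Provable.eqs_single {t t' : Term T.sig Ξ s} (h : Provable T χ (.eq t t')) :
    Provable T χ (.eqs (.cons t (.nil Ξ)) (.cons t' (.nil Ξ))) :=
  .and_intro h (.top_intro _)

theorem Provable.eq_symm {t t' : Term T.sig Ξ s} (h : Provable T χ (.eq t t')) :
    Provable T χ (.eq t' t) :=
  (eqs_symm (eqs_single h)).cut (.and_left _ _)

theorem Provable.eq_trans {t t' t'' : Term T.sig Ξ s} (h : Provable T χ (.eq t t'))
    (h' : Provable T χ (.eq t' t'')) : Provable T χ (.eq t t'') :=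
  (eqs_trans (eqs_single h) (eqs_single h')).cut (.and_left _ _)

end Equality

/-! ### Substitution in group terms. -/

section Subst

variable {L : Sig.{w}} (grp : ∀ {Δ : List L.Sorts} {s : L.Sorts}, GroupOp Δ s → L.Ops Δ s)
  {Γ Δ : List L.Sorts} {s t : L.Sorts} (σ : Subst L Γ Δ)

theorem Subst.nil_comp {Δ Θ : List L.Sorts} (τ : Subst L Δ Θ) : (nil Δ).comp τ = nil Θ :=
  funext fun _ => funext fun x => nomatch x

theorem tAdd_subst (x y : Term L Γ s) :
    (tAdd grp x y).subst σ = tAdd grp (x.subst σ) (y.subst σ) :=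
  congrArg (Term.app _) (by
    change Subst.comp _ σ = _
    rw [Subst.cons_comp, Subst.cons_comp, Subst.nil_comp])

theorem tNeg_subst (x : Term L Γ s) : (tNeg grp x).subst σ = tNeg grp (x.subst σ) :=
  congrArg (Term.app _) (by
    change Subst.comp _ σ = _
    rw [Subst.cons_comp, Subst.nil_comp])

theorem tZero_subst : (tZero grp s : Term L Γ s).subst σ = tZero grp s :=
  congrArg (Term.app _) (Subst.nil_comp σ)

theorem Term.app₁_subst (f : L.Ops [s] t) (x : Term L Γ s) :
    (Term.app₁ f x).subst σ = Term.app₁ f (x.subst σ) :=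
  congrArg (Term.app _) (by
    change Subst.comp _ σ = _
    rw [Subst.cons_comp, Subst.nil_comp])

theorem Subst.cons_eta (a : Subst L (s :: Γ) Δ) :
    cons (a _ .zero) (fun _ x => a _ x.succ) = a := by
  funext _ x; cases x <;> rfl

theorem Subst.eq_nil (a : Subst L [] Δ) : a = nil Δ := funext fun _ => funext fun x => nomatch x

theorem Term.app_single (f : L.Ops [s] t) (a : Subst L [s] Δ) :
    Term.app f a = Term.app₁ f (a _ .zero) := by
  conv_lhs => rw [← Subst.cons_eta a, Subst.eq_nil (fun _ x => a _ (.succ x))]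
  rfl

end Subst

/-- A theory whose sorts are provably abelian groups. -/
class GroupTheory (T : RegularTheory.{w}) where
  grp : ∀ {Δ : List T.sig.Sorts} {s : T.sig.Sorts}, GroupOp Δ s → T.sig.Ops Δ s
  provable : ∀ {Γ : List T.sig.Sorts} {φ ψ : Formula T.sig Γ}, AbGroupAx grp φ ψ → Provable T φ ψ

open GroupTheory

/-! ### Groups of terms modulo provable equality. -/

section Group

variable {T : RegularTheory.{w}} [GroupTheory T] {Γ Δ Ξ Ξ' : List T.sig.Sorts}
  {χ : Formula T.sig Ξ} {s : T.sig.Sorts}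

/-- Provable equality of terms under the hypothesis `χ`. -/
def eltSetoid (χ : Formula T.sig Ξ) (s : T.sig.Sorts) : Setoid (Term T.sig Ξ s) where
  r t t' := Provable T χ (.eq t t')
  iseqv := ⟨fun _ => .eq_rfl, .eq_symm, .eq_trans⟩

/-- Terms modulo provable equality under the hypothesis `χ`. -/
def Elt (χ : Formula T.sig Ξ) (s : T.sig.Sorts) : Type w := Quotient (eltSetoid χ s)

/-- The class of a term. -/
def Elt.mk (χ : Formula T.sig Ξ) (t : Term T.sig Ξ s) : Elt χ s := Quotient.mk (eltSetoid χ s) t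

omit [GroupTheory T] in
theorem Elt.mk_eq_mk {t t' : Term T.sig Ξ s} :
    Elt.mk χ t = Elt.mk χ t' ↔ Provable T χ (.eq t t') :=
  ⟨fun h => Quotient.exact (s := eltSetoid χ s) h, fun h => Quotient.sound (s := eltSetoid χ s) h⟩

theorem provable_assoc (a b c : Term T.sig Ξ s) :
    Provable T χ (.eq (tAdd grp (tAdd grp a b) c) (tAdd grp a (tAdd grp b c))) := by
  have := (Provable.top_intro χ).cut (.subst (.cons a (.cons b (.cons c (.nil Ξ))))
    (provable (.assoc s)))
  simp only [Formula.subst, tAdd_subst] at this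
  exact this

theorem provable_comm (a b : Term T.sig Ξ s) :
    Provable T χ (.eq (tAdd grp a b) (tAdd grp b a)) := by
  have := (Provable.top_intro χ).cut (.subst (.cons a (.cons b (.nil Ξ))) (provable (.comm s)))
  simp only [Formula.subst, tAdd_subst] at this
  exact this

theorem provable_zero_add (a : Term T.sig Ξ s) :
    Provable T χ (.eq (tAdd grp (tZero grp s) a) a) := by
  have := (Provable.top_intro χ).cut (.subst (.cons a (.nil Ξ)) (provable (.unit s)))
  simp only [Formula.subst, tAdd_subst, tZero_subst] at this
  exact this.cut (.and_left _ _)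

theorem provable_neg_add (a : Term T.sig Ξ s) :
    Provable T χ (.eq (tAdd grp (tNeg grp a) a) (tZero grp s)) := by
  have := (Provable.top_intro χ).cut (.subst (.cons a (.nil Ξ)) (provable (.inv s)))
  simp only [Formula.subst, tAdd_subst, tZero_subst, tNeg_subst] at this
  exact this.cut (.and_right _ _)

theorem tAdd_congr {a a' b b' : Term T.sig Ξ s} (h : Provable T χ (.eq a a'))
    (h' : Provable T χ (.eq b b')) : Provable T χ (.eq (tAdd grp a b) (tAdd grp a' b')) :=
  .app_congr (.and_intro h (.and_intro h' (.top_intro _)))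

theorem tNeg_congr {a a' : Term T.sig Ξ s} (h : Provable T χ (.eq a a')) :
    Provable T χ (.eq (tNeg grp a) (tNeg grp a')) :=
  .app_congr (.eqs_single h)

instance : Add (Elt χ s) where
  add := Quotient.map₂ (sa := eltSetoid χ s) (sb := eltSetoid χ s) (sc := eltSetoid χ s)
    (tAdd grp) fun _ _ h _ _ h' => tAdd_congr h h'

instance : Zero (Elt χ s) where
  zero := Elt.mk χ (tZero grp s)

instance : Neg (Elt χ s) where
  neg := Quotient.map (sa := eltSetoid χ s) (sb := eltSetoid χ s) (tNeg grp)
    fun _ _ h => tNeg_congr h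

/-- This turns provable equations into equations in an actual abelian group, so that group
identities are imported instead of being derived in the sequent calculus. -/
instance : AddCommGroup (Elt χ s) where
  add_assoc := by rintro ⟨a⟩ ⟨b⟩ ⟨c⟩; exact Elt.mk_eq_mk.2 (provable_assoc a b c)
  add_comm := by rintro ⟨a⟩ ⟨b⟩; exact Elt.mk_eq_mk.2 (provable_comm a b)
  zero_add := by rintro ⟨a⟩; exact Elt.mk_eq_mk.2 (provable_zero_add a)
  add_zero := by
    rintro ⟨a⟩; exact Elt.mk_eq_mk.2 ((provable_comm _ _).eq_trans (provable_zero_add a))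
  neg_add_cancel := by rintro ⟨a⟩; exact Elt.mk_eq_mk.2 (provable_neg_add a)
  nsmul := nsmulRec
  zsmul := zsmulRec

namespace Subst

/-- Componentwise sum. -/
def add (σ τ : Subst T.sig Γ Ξ) : Subst T.sig Γ Ξ := fun _ x => tAdd grp (σ _ x) (τ _ x)

/-- Componentwise negative. -/
def neg (σ : Subst T.sig Γ Ξ) : Subst T.sig Γ Ξ := fun _ x => tNeg grp (σ _ x)

/-- The zero substitution. -/
def zero (Γ Ξ : List T.sig.Sorts) : Subst T.sig Γ Ξ := fun _ _ => tZero grp _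

theorem add_comp (σ τ : Subst T.sig Γ Ξ) (ρ : Subst T.sig Ξ Ξ') :
    (σ.add τ).comp ρ = (σ.comp ρ).add (τ.comp ρ) := by
  funext _ x; exact tAdd_subst _ _ _ _

theorem neg_comp (σ : Subst T.sig Γ Ξ) (ρ : Subst T.sig Ξ Ξ') :
    σ.neg.comp ρ = (σ.comp ρ).neg := by
  funext _ x; exact tNeg_subst _ _ _

theorem zero_comp (ρ : Subst T.sig Ξ Ξ') : (zero Γ Ξ).comp ρ = zero Γ Ξ' := by
  funext _ x; exact tZero_subst _ _

theorem add_cons (a b : Term T.sig Ξ s) (σ τ : Subst T.sig Γ Ξ) :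
    (cons a σ).add (cons b τ) = cons (tAdd grp a b) (σ.add τ) := by
  funext _ x; cases x <;> rfl

theorem neg_cons (a : Term T.sig Ξ s) (σ : Subst T.sig Γ Ξ) :
    (cons a σ).neg = cons (tNeg grp a) σ.neg := by
  funext _ x; cases x <;> rfl

theorem zero_cons : zero (s :: Γ) Ξ = cons (tZero grp s) (zero Γ Ξ) := by
  funext _ x; cases x <;> rfl

end Subst

end Group

/-- A theory whose sorts are provably abelian groups and whose function symbols are provably
additive. -/
class AdditiveTheory (T : RegularTheory.{w}) extends GroupTheory T where
  map_add : ∀ {Δ : List T.sig.Sorts} {s : T.sig.Sorts} (f : T.sig.Ops Δ s)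
    {Ξ : List T.sig.Sorts} (χ : Formula T.sig Ξ) (a b : Subst T.sig Δ Ξ),
    Provable T χ (.eq (.app f (a.add b)) (tAdd grp (.app f a) (.app f b)))

/-- Commutativity makes the group operations homomorphisms: for `+` this is (a + b) + (a' + b') = (a
+ a') + (b + b'). -/
theorem GroupTheory.map_add_grp {T : RegularTheory.{w}} [GroupTheory T]
    {Δ : List T.sig.Sorts} {s : T.sig.Sorts} (o : GroupOp Δ s)
    {Ξ : List T.sig.Sorts} (χ : Formula T.sig Ξ) (a b : Subst T.sig Δ Ξ) :
    Provable T χ (.eq (.app (grp o) (a.add b)) (tAdd grp (.app (grp o) a) (.app (grp o) b))) := by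
  have two : ∀ {s t : T.sig.Sorts} (c : Subst T.sig [s, t] Ξ),
      c = .cons (c _ .zero) (.cons (c _ (.succ .zero)) (.nil _)) := fun c => by
    conv_lhs => rw [← Subst.cons_eta c, ← Subst.cons_eta (fun _ x => c _ (.succ x)), Subst.eq_nil
      (fun _ x => c _ (.succ (.succ x)))]
  have one : ∀ {s : T.sig.Sorts} (c : Subst T.sig [s] Ξ), c = .cons (c _ .zero) (.nil _) :=
    fun c => by
      conv_lhs => rw [← Subst.cons_eta c, Subst.eq_nil (fun _ x => c _ (.succ x))]
  rw [← Elt.mk_eq_mk]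
  cases o with
  | add s =>
    rw [two (a.add b), two a, two b]
    exact add_add_add_comm (Elt.mk χ (a s .zero)) (.mk χ (b s .zero))
      (.mk χ (a s (.succ .zero))) (.mk χ (b s (.succ .zero)))
  | neg s =>
    rw [one (a.add b), one a, one b]
    exact neg_add (Elt.mk χ (a s .zero)) (.mk χ (b s .zero))
  | zero s =>
    rw [Subst.eq_nil (a.add b), Subst.eq_nil a, Subst.eq_nil b]
    exact (add_zero (0 : Elt χ s)).symm

theorem GroupTheory.map_add_of_homAx {T : RegularTheory.{w}} [GroupTheory T]
    {s t : T.sig.Sorts} (f : T.sig.Ops [s] t)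
    (h : ∀ {Γ : List T.sig.Sorts} {φ ψ : Formula T.sig Γ}, HomAx grp f φ ψ → Provable T φ ψ)
    {Ξ : List T.sig.Sorts} (χ : Formula T.sig Ξ) (a b : Subst T.sig [s] Ξ) :
    Provable T χ (.eq (.app f (a.add b)) (tAdd grp (.app f a) (.app f b))) := by
  have := (Provable.top_intro χ).cut (.subst (.cons (a _ .zero) (.cons (b _ .zero) (.nil Ξ)))
    (h .mk))
  simp only [Formula.subst, tAdd_subst, Term.app₁_subst] at this
  rw [Term.app_single, Term.app_single, Term.app_single]
  exact this

/-! ### Homology and cohomology theories are additive. -/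

section

variable {C : Type w} [SmallCategory C] (M : Subcat C)

/-- A function symbol is either a group operation or unary with its own homomorphism axiom.
Functoriality, naturality and exactness play no role. -/
instance : AdditiveTheory (homologyTheory M) where
  grp := HomologyOp.grp'
  provable h := .ax (HomologyAx.grp h)
  map_add {Δ s} f {Ξ} χ a b := by
    let : GroupTheory (homologyTheory M) := ⟨HomologyOp.grp', fun h => .ax (HomologyAx.grp h)⟩
    cases f with
    | grp o => exact GroupTheory.map_add_grp o χ a b
    | map n c =>
      exact GroupTheory.map_add_of_homAx (T := homologyTheory M)
        (HomologyOp.map n c) (fun h => .ax (.hom_map n c h)) χ a b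
    | bd n hf hg =>
      exact GroupTheory.map_add_of_homAx (T := homologyTheory M)
        (HomologyOp.bd n hf hg) (fun h => .ax (.hom_bd n hf hg h)) χ a b

instance : AdditiveTheory (cohomologyTheory M) where
  grp := CohomologyOp.grp'
  provable h := .ax (CohomologyAx.grp h)
  map_add {Δ s} f {Ξ} χ a b := by
    let : GroupTheory (cohomologyTheory M) :=
      ⟨CohomologyOp.grp', fun h => .ax (CohomologyAx.grp h)⟩
    cases f with
    | grp o => exact GroupTheory.map_add_grp o χ a b
    | map n c =>
      exact GroupTheory.map_add_of_homAx (T := cohomologyTheory M)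
        (CohomologyOp.map n c) (fun h => .ax (.hom_map n c h)) χ a b
    | bd n hf hg =>
      exact GroupTheory.map_add_of_homAx (T := cohomologyTheory M)
        (CohomologyOp.bd n hf hg) (fun h => .ax (.hom_bd n hf hg h)) χ a b

end

/-! ### Formulas define subgroups, and the syntactic category is preadditive. -/

section Additive

variable {T : RegularTheory.{w}} [AdditiveTheory T] {Γ Δ Ξ Ξ' : List T.sig.Sorts}
  {χ : Formula T.sig Ξ} {s : T.sig.Sorts}

theorem Term.mk_subst_add (t : Term T.sig Γ s) (σ τ : Subst T.sig Γ Ξ) :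
    Elt.mk χ (t.subst (σ.add τ)) = .mk χ (t.subst σ) + .mk χ (t.subst τ) := by
  induction t with
  | var x => rfl
  | app f a ih =>
    refine Eq.trans (Elt.mk_eq_mk.2 ?_) (Elt.mk_eq_mk.2 (AdditiveTheory.map_add f χ
      (fun t x => (a t x).subst σ) (fun t x => (a t x).subst τ)))
    exact .app_congr (Provable.eqs_iff.2 fun t x => Elt.mk_eq_mk.1 (ih t x))

/-- Additivity gives t(0) + t(0) = t(0), and one summand is cancelled. -/
theorem Term.mk_subst_zero (t : Term T.sig Γ s) : Elt.mk χ (t.subst (.zero Γ Ξ)) = 0 := by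
  have h1 := t.mk_subst_add (χ := χ) (.zero Γ Ξ) (.zero Γ Ξ)
  have h2 : Elt.mk χ (t.subst ((Subst.zero Γ Ξ).add (.zero Γ Ξ))) =
      .mk χ (t.subst (.zero Γ Ξ)) := Elt.mk_eq_mk.2 (.eq_congr (Provable.eqs_iff.2 fun s x =>
        Elt.mk_eq_mk.1 (add_zero (0 : Elt χ s))) t)
  rw [h2] at h1
  exact left_eq_add.1 h1

theorem Term.mk_subst_neg (t : Term T.sig Γ s) (σ : Subst T.sig Γ Ξ) :
    Elt.mk χ (t.subst σ.neg) = - .mk χ (t.subst σ) := by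
  have h1 := t.mk_subst_add (χ := χ) σ.neg σ
  have h2 : Elt.mk χ (t.subst (σ.neg.add σ)) = .mk χ (t.subst (.zero Γ Ξ)) :=
    Elt.mk_eq_mk.2 (.eq_congr (Provable.eqs_iff.2 fun s x =>
        Elt.mk_eq_mk.1 (neg_add_cancel (Elt.mk χ (σ s x)))) t)
  rw [h2, mk_subst_zero] at h1
  exact eq_neg_of_add_eq_zero_left h1.symm

/-- Terms are additive, so equations are stable under sums of solutions. Under an existential
quantifier the two witnesses, brought to a common extension of the hypothesis, are added. -/
theorem Formula.provable_subst_add (φ : Formula T.sig Γ) {Ξ : List T.sig.Sorts}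
    {χ : Formula T.sig Ξ} {σ τ : Subst T.sig Γ Ξ} (h : Provable T χ (φ.subst σ))
    (h' : Provable T χ (φ.subst τ)) : Provable T χ (φ.subst (σ.add τ)) := by
  induction φ generalizing Ξ with
  | top => exact .top_intro _
  | eq t t' =>
    refine Elt.mk_eq_mk.1 ?_
    rw [Term.mk_subst_add, Term.mk_subst_add]
    exact congrArg₂ _ (Elt.mk_eq_mk.2 h) (Elt.mk_eq_mk.2 h')
  | and φ ψ ih1 ih2 =>
    exact .and_intro (ih1 (h.cut (.and_left _ _)) (h'.cut (.and_left _ _)))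
      (ih2 (h.cut (.and_right _ _)) (h'.cut (.and_right _ _)))
  | ex s φ ih =>
    refine .ex_cases h fun χ' ρ a h1 h2 => .ex_cases (.weaken h1 h') fun χ'' ρ' b h3 h4 => ?_
    rw [Formula.subst_subst, Formula.subst_subst]
    refine Provable.ex_mk (tAdd GroupTheory.grp (a.subst ρ') b) _ ?_
    have := Provable.weaken h3 h2
    rw [Subst.cons_comp, Subst.comp_assoc] at this
    rw [Subst.add_comp, ← Subst.add_cons]
    rw [Subst.comp_assoc] at h4
    exact ih this h4

theorem Formula.provable_subst_neg (φ : Formula T.sig Γ) {Ξ : List T.sig.Sorts}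
    {χ : Formula T.sig Ξ} {σ : Subst T.sig Γ Ξ} (h : Provable T χ (φ.subst σ)) :
    Provable T χ (φ.subst σ.neg) := by
  induction φ generalizing Ξ with
  | top => exact .top_intro _
  | eq t t' =>
    refine Elt.mk_eq_mk.1 ?_
    rw [Term.mk_subst_neg, Term.mk_subst_neg]
    exact congrArg _ (Elt.mk_eq_mk.2 h)
  | and φ ψ ih1 ih2 =>
    exact .and_intro (ih1 (h.cut (.and_left _ _))) (ih2 (h.cut (.and_right _ _)))
  | ex s φ ih =>
    refine .ex_cases h fun χ' ρ a h1 h2 => ?_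
    rw [Formula.subst_subst]
    refine Provable.ex_mk (tNeg GroupTheory.grp a) _ ?_
    rw [Subst.neg_comp, ← Subst.neg_cons]
    exact ih h2

theorem Formula.provable_subst_zero (φ : Formula T.sig Γ) (χ : Formula T.sig Ξ) :
    Provable T χ (φ.subst (.zero Γ Ξ)) := by
  induction φ generalizing Ξ with
  | top => exact .top_intro _
  | eq t t' =>
    refine Elt.mk_eq_mk.1 ?_
    rw [Term.mk_subst_zero, Term.mk_subst_zero]
  | and φ ψ ih1 ih2 => exact .and_intro (ih1 _) (ih2 _)
  | ex s φ ih =>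
    refine Provable.ex_mk (tZero GroupTheory.grp s) _ ?_
    rw [← Subst.zero_cons]
    exact ih _

namespace Syn

variable {X Y Z : Syn T}

/-- The graph of a morphism is itself given by a regular formula, hence is a subgroup: every
morphism of `Syn T` is automatically a homomorphism. -/
theorem Rel.add {f : X ⟶ Y} {y y' : Subst T.sig Y.ctx Ξ} {x x' : Subst T.sig X.ctx Ξ}
    (h : Rel f χ y x) (h' : Rel f χ y' x') : Rel f χ (y.add y') (x.add x') := by
  have := Formula.provable_subst_add _ h h'
  have e : (Subst.append y x).add (.append y' x') = .append (y.add y') (x.add x') := by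
    have := Subst.append_eta ((Subst.append y x).add (.append y' x'))
    have e₁ : (Subst.inl Y.ctx X.ctx).comp ((Subst.append y x).add (.append y' x')) =
      ((Subst.inl Y.ctx X.ctx).comp (Subst.append y x)).add
        ((Subst.inl Y.ctx X.ctx).comp (Subst.append y' x')) := rfl
    have e₂ : (Subst.inr Y.ctx X.ctx).comp ((Subst.append y x).add (.append y' x')) =
      ((Subst.inr Y.ctx X.ctx).comp (Subst.append y x)).add
        ((Subst.inr Y.ctx X.ctx).comp (Subst.append y' x')) := rfl
    rw [e₁, e₂] at this
    rw [Subst.inl_append, Subst.inl_append, Subst.inr_append, Subst.inr_append] at this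
    exact this.symm
  rwa [e] at this

/-- The sum is the pairing of `f` and `g` followed by componentwise addition on {y, y' . Y(y) ∧
Y(y')}. -/
theorem exists_add (f g : X ⟶ Y) : ∃ h : X ⟶ Y, ∀ {Ξ : List T.sig.Sorts} (χ : Formula T.sig Ξ)
    (y y' : Subst T.sig Y.ctx Ξ) (x : Subst T.sig X.ctx Ξ), Rel f χ y x → Rel g χ y' x →
    Rel h χ (y.add y') x := by
  obtain ⟨p, hp⟩ := exists_pair (.and (Y.formula.subst (.inl _ _)) (Y.formula.subst (.inr _ _))) f g
    fun χ x y w h h' => by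
      simp only [Formula.subst, Formula.subst_subst, Subst.inl_append, Subst.inr_append]
      exact .and_intro h.cod h'.cod
  refine ⟨p ≫ ofTerms ((Subst.inl _ _).add (.inr _ _)) (Formula.provable_subst_add _
    (.and_left _ _) (.and_right _ _)), fun χ y y' x h h' => ?_⟩
  have h1 := (hp χ y y' x).2 ⟨h, h'⟩
  refine h1.comp (rel_ofTerms.2 ⟨h1.cod, ?_⟩)
  rw [Subst.add_comp, Subst.inl_append, Subst.inr_append]
  exact .eqs_refl _ _

/-- The zero morphism. -/
def zeroHom (X Y : Syn T) : X ⟶ Y := ofTerms (.zero _ _) (Formula.provable_subst_zero _ _)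

theorem rel_zeroHom {x : Subst T.sig X.ctx Ξ} (h : Provable T χ (X.formula.subst x)) :
    Rel (zeroHom X Y) χ (.zero _ _) x := by
  have := rel_ofTerms_self (t := Subst.zero Y.ctx X.ctx)
    (ht := Formula.provable_subst_zero Y.formula X.formula) h
  rwa [Subst.zero_comp] at this

/-- The morphism `- : Y ⟶ Y`. -/
def negHom (Y : Syn T) : Y ⟶ Y := ofTerms (Subst.neg (.id _)) (Formula.provable_subst_neg _ (by
  rw [Formula.subst_id]; exact .refl _))

theorem Rel.comp_negHom {f : X ⟶ Y} {y : Subst T.sig Y.ctx Ξ} {x : Subst T.sig X.ctx Ξ}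
    (h : Rel f χ y x) : Rel (f ≫ negHom Y) χ y.neg x := by
  refine h.comp (rel_ofTerms.2 ⟨h.cod, ?_⟩)
  rw [Subst.neg_comp]
  exact .eqs_refl _ _

/-- The sum of two morphisms. -/
noncomputable def addHom (f g : X ⟶ Y) : X ⟶ Y := (exists_add f g).choose

theorem rel_addHom {f g : X ⟶ Y} {y y' : Subst T.sig Y.ctx Ξ} {x : Subst T.sig X.ctx Ξ}
    (h : Rel f χ y x) (h' : Rel g χ y' x) : Rel (addHom f g) χ (y.add y') x :=
  (exists_add f g).choose_spec _ _ _ _ h h'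

omit [AdditiveTheory T] in
-- The list `n` collects the morphisms that occur in an identity. After a refinement of the
-- hypothesis all of them have values at `x` simultaneously, and the identity becomes one between
-- elements of `Elt`.
theorem hom_ext_of_rel {f g : X ⟶ Y} (n : List (X ⟶ Y))
    (h : ∀ {Ξ : List T.sig.Sorts} (χ : Formula T.sig Ξ)
      (x : Subst T.sig X.ctx Ξ), Provable T χ (X.formula.subst x) →
      (∀ k ∈ n, ∃ y, Rel k χ y x) → ∃ y y', Rel f χ y x ∧ Rel g χ y' x ∧
        Provable T χ (.eqs y y')) : f = g := by
  suffices key : ∀ {Ξ : List T.sig.Sorts} (χ : Formula T.sig Ξ)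
      (x : Subst T.sig X.ctx Ξ), Provable T χ (X.formula.subst x) →
      Cov χ fun χ' ρ => ∀ k ∈ n, ∃ y, Rel k χ' y (x.comp ρ) by
    refine hom_ext_cov fun χ x k => (key χ x k).bind fun χ' ρ h1 h2 => ?_
    obtain ⟨y, y', h3, h4, h5⟩ := h χ' _ (.weaken h1 k) h2
    exact .pure ⟨y', by rw [Subst.comp_id]; exact ⟨h3.congr_left h5, h4⟩⟩
  clear h
  intro Ξ χ x k
  induction n generalizing Ξ with
  | nil => exact .pure fun _ h => by simp at h
  | cons l n ih =>
    refine (ih χ x k).bind fun χ' ρ h1 h2 => (cov_total l (.weaken h1 k)).bind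
      fun χ'' ρ' h3 ⟨y, hy⟩ => .pure ?_
    simp only [List.forall_mem_cons, Subst.comp_id, ← Subst.comp_assoc]
    exact ⟨⟨y, hy⟩, fun k hk => (h2 k hk).imp' (fun y => y.comp ρ') fun y h => h.weaken h3⟩

omit [AdditiveTheory T] in
theorem eqs_of_mk {σ τ : Subst T.sig Γ Ξ} (h : ∀ s x, Elt.mk χ (σ s x) = .mk χ (τ s x)) :
    Provable T χ (.eqs σ τ) := Provable.eqs_iff.2 fun s x => Elt.mk_eq_mk.1 (h s x)

noncomputable instance (X Y : Syn T) : Add (X ⟶ Y) where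
  add := addHom

instance (X Y : Syn T) : Zero (X ⟶ Y) where
  zero := zeroHom X Y

instance (X Y : Syn T) : Neg (X ⟶ Y) where
  neg f := f ≫ negHom Y

noncomputable instance (X Y : Syn T) : AddCommGroup (X ⟶ Y) where
  add_assoc f g h := hom_ext_of_rel [f, g, h] fun χ x hx k => by
    simp only [List.forall_mem_cons] at k
    obtain ⟨⟨a, ha⟩, ⟨b, hb⟩, ⟨c, hc⟩, -⟩ := k
    exact ⟨_, _, rel_addHom (rel_addHom ha hb) hc, rel_addHom ha (rel_addHom hb hc),
      eqs_of_mk fun s x => add_assoc (Elt.mk χ (a s x)) (.mk χ (b s x)) (.mk χ (c s x))⟩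
  add_comm f g := hom_ext_of_rel [f, g] fun χ x hx k => by
    simp only [List.forall_mem_cons] at k
    obtain ⟨⟨a, ha⟩, ⟨b, hb⟩, -⟩ := k
    exact ⟨_, _, rel_addHom ha hb, rel_addHom hb ha,
      eqs_of_mk fun s x => add_comm (Elt.mk χ (a s x)) (.mk χ (b s x))⟩
  zero_add f := hom_ext_of_rel [f] fun χ x hx k => by
    simp only [List.forall_mem_cons] at k
    obtain ⟨⟨a, ha⟩, -⟩ := k
    exact ⟨_, _, rel_addHom (rel_zeroHom hx) ha, ha,
      eqs_of_mk fun s x => zero_add (Elt.mk χ (a s x))⟩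
  add_zero f := hom_ext_of_rel [f] fun χ x hx k => by
    simp only [List.forall_mem_cons] at k
    obtain ⟨⟨a, ha⟩, -⟩ := k
    exact ⟨_, _, rel_addHom ha (rel_zeroHom hx), ha,
      eqs_of_mk fun s x => add_zero (Elt.mk χ (a s x))⟩
  neg_add_cancel f := hom_ext_of_rel [f] fun χ x hx k => by
    simp only [List.forall_mem_cons] at k
    obtain ⟨⟨a, ha⟩, -⟩ := k
    exact ⟨_, _, rel_addHom ha.comp_negHom ha, rel_zeroHom hx,
      eqs_of_mk fun s x => neg_add_cancel (Elt.mk χ (a s x))⟩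
  nsmul := nsmulRec
  zsmul := zsmulRec

/-- Precomposition is additive by the pointwise definition of sums; for postcomposition with `h` the
additivity of `h` is needed, which is `Rel.add`. -/
noncomputable instance : Preadditive (Syn T) where
  add_comp X Y Z f g h := hom_ext_cov fun χ x hx => (cov_total f hx).bind
    fun χ₁ ρ₁ k₁ ⟨a, ha⟩ => (cov_total g (.weaken k₁ hx)).bind
    fun χ₂ ρ₂ k₂ ⟨b, hb⟩ => (cov_total h (ha.weaken k₂).cod).bind
    fun χ₃ ρ₃ k₃ ⟨c, hc⟩ => (cov_total h (hb.weaken k₃).cod).bind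
    fun χ₄ ρ₄ k₄ ⟨d, hd⟩ => .pure ⟨(c.comp ρ₄).add d, by
      have ha' := (((ha.weaken k₂).weaken k₃).weaken k₄)
      have hb' := ((hb.weaken k₃).weaken k₄)
      have hc' := hc.weaken k₄
      simp only [Subst.comp_assoc, Subst.comp_id] at *
      exact ⟨(rel_addHom ha' hb').comp (hc'.add hd), rel_addHom (ha'.comp hc') (hb'.comp hd)⟩⟩
  comp_add X Y Z f g h := hom_ext_cov fun χ x hx => (cov_total f hx).bind
    fun χ₁ ρ₁ k₁ ⟨a, ha⟩ => (cov_total g ha.cod).bind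
    fun χ₂ ρ₂ k₂ ⟨b, hb⟩ => (cov_total h (ha.weaken k₂).cod).bind
    fun χ₃ ρ₃ k₃ ⟨c, hc⟩ => .pure ⟨(b.comp ρ₃).add c, by
      have ha' := ((ha.weaken k₂).weaken k₃)
      have hb' := hb.weaken k₃
      simp only [Subst.comp_assoc, Subst.comp_id] at *
      exact ⟨ha'.comp (rel_addHom hb' hc), rel_addHom (ha'.comp hb') (ha'.comp hc)⟩⟩

end Syn

end Additive

end TMotives

namespace TMotives

open scoped ZeroObject

/-! ## Abelian envelopes of additive regular categories -/

section Envelope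

/-- Functors from a regular category to an abelian category that preserve finite limits and send
regular epimorphisms to epimorphisms. -/
structure IsRegularFunctor {R : Type*} [Category* R] {D : Type*} [Category* D] (F : R ⥤ D) :
    Prop where
  preservesFiniteLimits : PreservesFiniteLimits F
  epi_map : ∀ {X Y : R} (f : X ⟶ Y), IsRegularEpi f → Epi (F.map f)

/-- Fully faithful regular functors such that every object of the target is a quotient of an object
of the source. -/
structure IsEnvelope {R : Type*} [Category* R] {D : Type*} [Category* D] (F : R ⥤ D) :
    Prop where
  full : F.Full
  faithful : F.Faithful
  isRegularFunctor : IsRegularFunctor F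
  exists_epi : ∀ Z : D, ∃ (X : R) (p : F.obj X ⟶ Z), Epi p

variable {R : Type*} [Category* R] [Preadditive R] [Regular R]
  {G : Type*} [Category* G] [Abelian G]

/-- Fully faithful regular functors along which coverings can be lifted. -/
structure IsLocalEmbedding (F : R ⥤ G) : Prop where
  full : F.Full
  faithful : F.Faithful
  isRegularFunctor : IsRegularFunctor F
  exists_lift : ∀ {X X' : R} {Z : G} (p : F.obj X' ⟶ Z) (h : F.obj X ⟶ Z), Epi p →
    ∃ (Y : R) (e : Y ⟶ X) (g : Y ⟶ X'), IsRegularEpi e ∧ F.map e ≫ h = F.map g ≫ p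

omit [Regular R] in
theorem additive_of_preservesFiniteLimits [HasFiniteLimits R] (F : R ⥤ G)
    [PreservesFiniteLimits F] : F.Additive :=
  have : HasFiniteBiproducts R := .of_hasFiniteProducts
  have : HasBinaryBiproducts R := hasBinaryBiproducts_of_finite_biproducts R
  have : HasZeroObject R := hasZeroObject_of_hasTerminal_object
  have : F.PreservesZeroMorphisms := F.preservesZeroMorphisms_of_map_zero_object
    (IsZero.isoZero ((IsZero.iff_id_eq_zero _).2
      ((IsTerminal.isTerminalObj F _ (HasZeroObject.zeroIsTerminal)).hom_ext _ _)))
  F.additive_of_preserves_binary_products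

/-- The objects that are cokernels of morphisms between objects in the image of `F`. -/
def isQuotient (F : R ⥤ G) : ObjectProperty G := fun Z =>
  ∃ (X K : R) (k : K ⟶ X) (p : F.obj X ⟶ Z) (w : F.map k ≫ p = 0),
    (ShortComplex.mk _ _ w).Exact ∧ Epi p

/-! ### Cokernels of representables form an abelian category. -/

namespace IsLocalEmbedding

variable {F : R ⥤ G} (hF : IsLocalEmbedding F)
include hF

omit [Preadditive R] in
-- The kernel of a morphism from an object of `R` to a cokernel lies again in `R`. On a cover `Y₁`
-- of `Y` the morphism lifts to `g : Y₁ ⟶ X'`, and it vanishes at an element exactly when `g`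
-- locally takes it into the relations `K'`. The image in `Y` of the pullback of `g` and `k'` is the
-- kernel.
theorem exists_exact {Y : R} {Z : G} (hZ : isQuotient F Z) (h : F.obj Y ⟶ Z) :
    ∃ (W : R) (i : W ⟶ Y) (w : F.map i ≫ h = 0), (ShortComplex.mk _ _ w).Exact ∧ Mono i := by
  have := hF.isRegularFunctor.preservesFiniteLimits
  obtain ⟨X', K', k', p', w', hex, hp'⟩ := hZ
  obtain ⟨Y₁, e, g, he, heg⟩ := hF.exists_lift p' h inferInstance
  let m := Regular.strongEpiMonoFactorisation (pullback.fst g k' ≫ e)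
  have hm : m.e ≫ m.m = pullback.fst g k' ≫ e := m.fac
  have := hF.isRegularFunctor.epi_map e he
  have := hF.isRegularFunctor.epi_map m.e inferInstance
  have w : F.map m.m ≫ h = 0 := by
    rw [← cancel_epi (F.map m.e), ← Category.assoc, ← F.map_comp, hm, F.map_comp, Category.assoc,
      heg, ← Category.assoc, ← F.map_comp, pullback.condition, F.map_comp, Category.assoc, w']
    simp
  refine ⟨m.I, m.m, w, ?_, m.m_mono⟩
  rw [ShortComplex.exact_iff_exact_up_to_refinements]
  intro A y hy
  dsimp at y hy
  obtain ⟨A₁, q₁, _, y₁, h₁⟩ := surjective_up_to_refinements_of_epi (F.map e) y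
  obtain ⟨A₂, q₂, _, c, h₂⟩ := hex.exact_up_to_refinements (y₁ ≫ F.map g) (by
    dsimp
    rw [Category.assoc, ← heg, ← Category.assoc, ← h₁, Category.assoc, hy, comp_zero])
  dsimp at c h₂
  let sq := (IsPullback.of_hasPullback g k').map F
  refine ⟨A₂, q₂ ≫ q₁, epi_comp _ _, sq.lift (q₂ ≫ y₁) c (by rw [Category.assoc, h₂]) ≫
    F.map m.e, ?_⟩
  dsimp
  rw [Category.assoc, Category.assoc, ← F.map_comp, hm, F.map_comp, sq.lift_fst_assoc, h₁,
    Category.assoc]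

omit [Preadditive R] in
-- The kernel `W` of F X → Z → Z' lies in `R` and covers the kernel of Z → Z'; the kernel of that
-- covering lies in `R` as well. Both come from `exists_exact`.
theorem isClosedUnderKernels : (isQuotient F).IsClosedUnderKernels where
  kernels_le := by
    rintro _ ⟨f, c, hc, hZ, hZ'⟩
    rename_i Z Z'
    obtain ⟨X, K, k, p, w, hex, hp⟩ := id hZ
    obtain ⟨W, i, wi, hi, _⟩ := hF.exists_exact hZ' (p ≫ f)
    have := Fork.IsLimit.mono hc
    let q : F.obj W ⟶ c.pt := hc.lift (KernelFork.ofι (F.map i ≫ p) (by simpa using wi))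
    have hq : q ≫ c.ι = F.map i ≫ p := Fork.IsLimit.lift_ι hc
    have : Epi q := by
      rw [epi_iff_surjective_up_to_refinements]
      intro A y
      obtain ⟨A₁, q₁, _, x, h₁⟩ := surjective_up_to_refinements_of_epi p (y ≫ c.ι)
      obtain ⟨A₂, q₂, _, t, h₂⟩ := hi.exact_up_to_refinements x (by
        dsimp
        rw [← Category.assoc, ← h₁, Category.assoc, Category.assoc, c.condition, comp_zero,
          comp_zero])
      dsimp at h₂
      refine ⟨A₂, q₂ ≫ q₁, epi_comp _ _, t, ?_⟩
      rw [← cancel_mono c.ι, Category.assoc, Category.assoc, Category.assoc, hq, h₁,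
        ← Category.assoc, h₂, Category.assoc]
    obtain ⟨V, j, wj, hj, _⟩ := hF.exists_exact hZ (F.map i ≫ p)
    have wq : F.map j ≫ q = 0 := by rw [← cancel_mono c.ι, Category.assoc, hq, wj, zero_comp]
    refine ⟨W, V, j, q, wq, ?_, this⟩
    rw [ShortComplex.exact_iff_exact_up_to_refinements]
    intro A y hy
    dsimp at y hy
    exact hj.exact_up_to_refinements y (by
      have := hy =≫ c.ι
      rwa [Category.assoc, hq, zero_comp] at this)

/-- The cokernel of Z → Z' is presented by the generators `X'` of Z', subject to the old relations
`K'` and to the lifts to `X'` of the images of the generators of Z. Those lifts exist only on a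
cover `Y` of `X`, which is why `Y` and not `X` enters the relations. -/
theorem isClosedUnderCokernels : (isQuotient F).IsClosedUnderCokernels where
  cokernels_le := by
    rintro _ ⟨f, c, hc, hZ, hZ'⟩
    rename_i Z Z'
    have := hF.isRegularFunctor.preservesFiniteLimits
    have := additive_of_preservesFiniteLimits F
    have : HasFiniteBiproducts R := .of_hasFiniteProducts
    have := hasBinaryBiproducts_of_finite_biproducts R
    obtain ⟨X, K, k, p, w, hex, hp⟩ := hZ
    obtain ⟨X', K', k', p', w', hex', hp'⟩ := hZ'
    obtain ⟨Y, e, g, he, heg⟩ := hF.exists_lift p' (p ≫ f) inferInstance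
    have := hF.isRegularFunctor.epi_map e he
    have : Epi c.π := Cofork.IsColimit.epi hc
    have hfc : (ShortComplex.mk f c.π c.condition).Exact :=
      ShortComplex.exact_of_g_is_cokernel _
        (IsColimit.ofIsoColimit hc (Cofork.ext (Iso.refl _) (by simp)))
    have hw : F.map (biprod.desc k' g) ≫ p' ≫ c.π = 0 := by
      have : F.map (biprod.desc k' g) =
          F.map biprod.fst ≫ F.map k' + F.map biprod.snd ≫ F.map g := by
        rw [biprod.desc_eq, F.map_add, F.map_comp, F.map_comp]
      rw [this, Preadditive.add_comp, Category.assoc, Category.assoc, reassoc_of% w',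
        ← reassoc_of% heg, c.condition]
      simp
    refine ⟨X', K' ⊞ Y, biprod.desc k' g, p' ≫ c.π, hw, ?_, epi_comp _ _⟩
    rw [ShortComplex.exact_iff_exact_up_to_refinements]
    intro A a ha
    dsimp at a ha
    obtain ⟨A₁, q₁, _, z, h₁⟩ := hfc.exact_up_to_refinements (a ≫ p') (by simpa using ha)
    obtain ⟨A₂, q₂, _, x, h₂⟩ := surjective_up_to_refinements_of_epi p z
    obtain ⟨A₃, q₃, _, y, h₃⟩ := surjective_up_to_refinements_of_epi (F.map e) x
    dsimp at h₁
    -- The element `a` and its correction `y ≫ F.map g` have the same image in Z', so their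
    -- difference comes from the relations `K'`.
    obtain ⟨A₄, q₄, _, b, h₄⟩ := hex'.exact_up_to_refinements
      (q₃ ≫ q₂ ≫ q₁ ≫ a - y ≫ F.map g) (by
        dsimp
        simp only [Preadditive.sub_comp, Category.assoc, h₁, ← heg]
        rw [reassoc_of% h₂, reassoc_of% h₃, sub_self])
    dsimp at b h₄
    refine ⟨A₄, q₄ ≫ q₃ ≫ q₂ ≫ q₁, inferInstance, b ≫ F.map biprod.inl + q₄ ≫ y ≫ F.map biprod.inr,
      ?_⟩
    dsimp
    simp only [Preadditive.add_comp, Category.assoc, ← F.map_comp, biprod.inl_desc, biprod.inr_desc,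
      ← h₄, Preadditive.comp_sub, sub_add_cancel]

theorem isClosedUnderFiniteProducts : (isQuotient F).IsClosedUnderFiniteProducts := by
  have := hF.isRegularFunctor.preservesFiniteLimits
  have := additive_of_preservesFiniteLimits F
  have : HasFiniteBiproducts R := .of_hasFiniteProducts
  have := hasBinaryBiproducts_of_finite_biproducts R
  have hiso : ∀ {Z Z' : G}, (Z ≅ Z') → isQuotient F Z → isQuotient F Z' := by
    rintro Z Z' i ⟨X, K, k, p, w, hex, hp⟩
    have w' : F.map k ≫ p ≫ i.hom = 0 := by rw [← Category.assoc, w, zero_comp]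
    refine ⟨X, K, k, p ≫ i.hom, w', ?_, epi_comp _ _⟩
    rw [ShortComplex.exact_iff_exact_up_to_refinements]
    intro A y hy
    dsimp at y hy
    exact hex.exact_up_to_refinements y (by
      dsimp; rw [← cancel_mono i.hom, Category.assoc, hy, zero_comp])
  have : (isQuotient F).IsClosedUnderIsomorphisms := ⟨hiso⟩
  have : HasZeroObject R := hasZeroObject_of_hasTerminal_object
  have h₀ : (isQuotient F).IsClosedUnderLimitsOfShape (Discrete.{0} PEmpty) := .mk' (by
    rintro Z ⟨D, hD⟩
    have hz : IsZero (limit D) := by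
      rw [IsZero.iff_id_eq_zero]
      exact (limit.isLimit D).hom_ext (fun ⟨j⟩ => j.elim)
    refine ⟨0, 0, 0, 0, by simp, ?_, ⟨fun _ _ _ => hz.eq_of_src _ _⟩⟩
    exact ShortComplex.exact_of_isZero_X₂ _ (F.map_isZero (isZero_zero R)))
  have h₂ : (isQuotient F).IsClosedUnderBinaryProducts := .mk' (by
    rintro Z ⟨D, hD⟩
    refine hiso (Z := D.obj ⟨.left⟩ ⊞ D.obj ⟨.right⟩)
      ((BinaryBiproduct.isLimit _ _).conePointUniqueUpToIso
      ((IsLimit.postcomposeHomEquiv (diagramIsoPair D) _).symm (limit.isLimit D))) ?_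
    obtain ⟨X, K, k, p, w, hex, hp⟩ := hD ⟨.left⟩
    obtain ⟨X', K', k', p', w', hex', hp'⟩ := hD ⟨.right⟩
    refine ⟨X ⊞ X', K ⊞ K', biprod.map k k',
      biprod.lift (F.map biprod.fst ≫ p) (F.map biprod.snd ≫ p'), ?_, ?_, ?_⟩
    · ext
      · simp only [Category.assoc, biprod.lift_fst, zero_comp]
        rw [← Category.assoc, ← F.map_comp, biprod.map_fst, F.map_comp, Category.assoc, w,
          comp_zero]
      · simp only [Category.assoc, biprod.lift_snd, zero_comp]
        rw [← Category.assoc, ← F.map_comp, biprod.map_snd, F.map_comp, Category.assoc, w',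
          comp_zero]
    · rw [ShortComplex.exact_iff_exact_up_to_refinements]
      intro A a ha
      dsimp at a ha
      obtain ⟨A₁, q₁, _, b, h₁⟩ := hex.exact_up_to_refinements (a ≫ F.map biprod.fst) (by
        simpa using ha =≫ biprod.fst)
      obtain ⟨A₂, q₂, _, b', h₂⟩ := hex'.exact_up_to_refinements (q₁ ≫ a ≫ F.map biprod.snd) (by
        simpa using q₁ ≫= ha =≫ biprod.snd)
      dsimp at b b' h₁ h₂
      refine ⟨A₂, q₂ ≫ q₁, epi_comp _ _, q₂ ≫ b ≫ F.map biprod.inl + b' ≫ F.map biprod.inr, ?_⟩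
      dsimp
      simp only [Preadditive.add_comp, Category.assoc, ← F.map_comp, biprod.inl_map, biprod.inr_map]
      rw [F.map_comp, F.map_comp, ← reassoc_of% h₁, ← reassoc_of% h₂, ← Preadditive.comp_add,
        ← Preadditive.comp_add, ← Preadditive.comp_add, ← F.map_comp, ← F.map_comp, ← F.map_add,
        biprod.total, F.map_id, Category.comp_id]
    · rw [epi_iff_surjective_up_to_refinements]
      intro A a
      obtain ⟨A₁, q₁, _, b, h₁⟩ := surjective_up_to_refinements_of_epi p (a ≫ biprod.fst)
      obtain ⟨A₂, q₂, _, b', h₂⟩ := surjective_up_to_refinements_of_epi p' (q₁ ≫ a ≫ biprod.snd)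
      refine ⟨A₂, q₂ ≫ q₁, epi_comp _ _, q₂ ≫ b ≫ F.map biprod.inl + b' ≫ F.map biprod.inr, ?_⟩
      ext
      · simp only [Category.assoc, Preadditive.add_comp, biprod.lift_fst, h₁]
        rw [← F.map_comp_assoc, ← F.map_comp_assoc, biprod.inl_fst, biprod.inr_fst]
        simp
      · simp only [Category.assoc, Preadditive.add_comp, biprod.lift_snd, h₂]
        rw [← F.map_comp_assoc, ← F.map_comp_assoc, biprod.inl_snd, biprod.inr_snd]
        simp)
  exact .mk'

theorem isQuotient_obj (X : R) : isQuotient F (F.obj X) := by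
  have := hF.isRegularFunctor.preservesFiniteLimits
  have := additive_of_preservesFiniteLimits F
  refine ⟨X, X, 0, 𝟙 _, by simp, ?_, inferInstance⟩
  rw [ShortComplex.exact_iff_mono _ (by simp)]
  dsimp; infer_instance

/-- The cokernels of morphisms in the image of `F` form an abelian category. -/
@[reducible]
noncomputable def abelian : Abelian (isQuotient F).FullSubcategory :=
  have := hF.isClosedUnderKernels
  have := hF.isClosedUnderCokernels
  have := hF.isClosedUnderFiniteProducts
  have : (isQuotient F).ContainsZero := ⟨⟨_, isZero_zero G, (isQuotient F).prop_of_isTerminal _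
    (isZero_zero G).isTerminal⟩⟩
  inferInstance

theorem isEnvelope_lift : IsEnvelope ((isQuotient F).lift F hF.isQuotient_obj) where
  full := have := hF.full; inferInstance
  faithful := have := hF.faithful; inferInstance
  isRegularFunctor := {
    preservesFiniteLimits := by
      have := hF.isRegularFunctor.preservesFiniteLimits
      refine ⟨fun J _ _ => ?_⟩
      have : PreservesLimitsOfShape J
          ((isQuotient F).lift F hF.isQuotient_obj ⋙ (isQuotient F).ι) :=
        inferInstanceAs (PreservesLimitsOfShape J F)
      exact preservesLimitsOfShape_of_reflects_of_preserves _ (isQuotient F).ι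
    epi_map := fun f hf => by
      have : Epi ((isQuotient F).ι.map (((isQuotient F).lift F hF.isQuotient_obj).map f)) :=
        hF.isRegularFunctor.epi_map f hf
      exact (isQuotient F).ι.epi_of_epi_map this }
  exists_epi Z := by
    obtain ⟨X, K, k, p, w, hex, hp⟩ := Z.property
    exact ⟨X, ObjectProperty.homMk p, (isQuotient F).ι.epi_of_epi_map hp⟩

end IsLocalEmbedding

omit [Preadditive R] [Regular R] [Abelian G] in
theorem IsEnvelope.of_equivalence {G' : Type*} [Category* G'] {F : R ⥤ G} {F' : R ⥤ G'}
    (hF : IsEnvelope F) (E : G' ⥤ G) [E.IsEquivalence] (i : F' ⋙ E ≅ F) : IsEnvelope F' where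
  full := have := hF.full; have := Functor.Full.of_iso i.symm; Functor.Full.of_comp_faithful F' E
  faithful := have := hF.faithful; have := Functor.Faithful.of_iso i.symm; .of_comp F' E
  isRegularFunctor := {
    preservesFiniteLimits := by
      have := hF.isRegularFunctor.preservesFiniteLimits
      refine ⟨fun J _ _ => ?_⟩
      have : PreservesLimitsOfShape J (F' ⋙ E) := preservesLimitsOfShape_of_natIso i.symm
      exact preservesLimitsOfShape_of_reflects_of_preserves _ E
    epi_map := fun f hf => by
      have := hF.isRegularFunctor.epi_map f hf
      have : Epi (E.map (F'.map f)) := by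
        have h := NatIso.naturality_2 i f
        dsimp at h
        rw [← h]
        infer_instance
      exact E.epi_of_epi_map this }
  exists_epi Z := by
    obtain ⟨X, p, hp⟩ := hF.exists_epi (E.obj Z)
    refine ⟨X, E.preimage (i.hom.app X ≫ p), E.epi_of_epi_map ?_⟩
    rw [E.map_preimage]
    exact epi_comp _ _

end Envelope

end TMotives

namespace TMotives

open scoped ZeroObject

/-! ## Extension of regular functors to exact functors -/

section Extension

variable {R : Type*} [Category* R] [Preadditive R] [Regular R]
  {B : Type*} [Category* B] [Abelian B] {A : Type*} [Category* A] [Abelian A]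

omit [Regular R] in
theorem additive_of_preservesFiniteColimits (F : B ⥤ A) [PreservesFiniteColimits F] :
    F.Additive := by
  have : PreservesFiniteColimits F := inferInstance
  have : F.PreservesZeroMorphisms := F.preservesZeroMorphisms_of_map_zero_object
    (IsZero.isoZero ((IsZero.iff_id_eq_zero _).2
      ((IsInitial.isInitialObj F _ (HasZeroObject.zeroIsInitial)).hom_ext _ _)))
  have : PreservesBinaryBiproducts F := preservesBinaryBiproducts_of_preservesBinaryCoproducts F
  exact Functor.additive_of_preservesBinaryBiproducts F

/-! ### Presentations, and the exact extension of a regular functor. -/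

namespace IsEnvelope

variable {ι : R ⥤ B} (hι : IsEnvelope ι)
include hι

omit [Preadditive R] in
-- The image inclusion of `f` becomes monic and epic in the abelian category, hence invertible
-- there, and a fully faithful functor reflects this.
theorem isRegularEpi_of_epi_map {X Y : R} (f : X ⟶ Y) [Epi (ι.map f)] : IsRegularEpi f := by
  have := hι.full
  have := hι.faithful
  have := hι.isRegularFunctor.preservesFiniteLimits
  let m := Regular.strongEpiMonoFactorisation f
  have hm : m.e ≫ m.m = f := m.fac
  have : Mono m.m := m.m_mono
  have : Epi (ι.map m.m) := by
    have : Epi (ι.map m.e ≫ ι.map m.m) := by rw [← ι.map_comp, hm]; infer_instance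
    exact epi_of_epi (ι.map m.e) _
  have : IsIso (ι.map m.m) := isIso_of_mono_of_epi _
  have : IsIso m.m := isIso_of_reflects_iso m.m ι
  rw [← hm]
  infer_instance

omit [Preadditive R] [Regular R] in
theorem isQuotient [HasZeroMorphisms R] (Z : B) : isQuotient ι Z := by
  have := hι.full
  obtain ⟨X, p, _⟩ := hι.exists_epi Z
  obtain ⟨K, k, _⟩ := hι.exists_epi (kernel p)
  obtain ⟨k', hk⟩ := ι.map_surjective (k ≫ kernel.ι p)
  have w : ι.map k' ≫ p = 0 := by simp [hk]
  refine ⟨X, K, k', p, w, ?_, inferInstance⟩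
  rw [ShortComplex.exact_iff_exact_up_to_refinements]
  intro A x hx
  obtain ⟨A₁, q, _, y, h⟩ := surjective_up_to_refinements_of_epi k (kernel.lift p x hx)
  refine ⟨A₁, q, inferInstance, y, ?_⟩
  dsimp
  rw [hk, ← Category.assoc, ← h]
  simp

omit [Preadditive R] in
-- Cover the pullback of `p` and `h` by an object of `R`; fullness turns the two projections into
-- morphisms of `R`.
theorem isLocalEmbedding : IsLocalEmbedding ι where
  full := hι.full
  faithful := hι.faithful
  isRegularFunctor := hι.isRegularFunctor
  exists_lift {X X' Z} p h _ := by
    have := hι.full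
    obtain ⟨Y, q, _⟩ := hι.exists_epi (pullback p h)
    obtain ⟨e, he⟩ := ι.map_surjective (q ≫ pullback.snd p h)
    obtain ⟨g, hg⟩ := ι.map_surjective (q ≫ pullback.fst p h)
    have : Epi (ι.map e) := by rw [he]; infer_instance
    exact ⟨Y, e, g, hι.isRegularEpi_of_epi_map e, by
      rw [he, hg, Category.assoc, Category.assoc, pullback.condition]⟩

/-- Having `k` monic makes ι K the kernel of `p` itself and not merely a cover of it, so lifts
through the relations exist without refinement (`exists_factor`). -/
theorem exists_presentation (Z : B) : ∃ (X K : R) (k : K ⟶ X) (p : ι.obj X ⟶ Z)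
    (w : ι.map k ≫ p = 0), (ShortComplex.mk _ _ w).Exact ∧ Epi p ∧ Mono k := by
  obtain ⟨X, p, hp⟩ := hι.exists_epi Z
  obtain ⟨K, k, w, h, hk⟩ := hι.isLocalEmbedding.exists_exact (hι.isQuotient Z) p
  exact ⟨X, K, k, p, w, h, hp, hk⟩

omit [Preadditive R] [Regular R] in
theorem exists_factor {W X Y : R} {Z : B} {i : W ⟶ Y} {h : ι.obj Y ⟶ Z} {w : ι.map i ≫ h = 0}
    (hi : (ShortComplex.mk _ _ w).Exact) [Mono i] (x : X ⟶ Y) (hx : ι.map x ≫ h = 0) :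
    ∃ l, l ≫ i = x := by
  have := hι.full
  have := hι.faithful
  have := hι.isRegularFunctor.preservesFiniteLimits
  have : Mono (ShortComplex.mk _ _ w).f := inferInstanceAs (Mono (ι.map i))
  obtain ⟨l, hl⟩ := ι.map_surjective (hi.lift (ι.map x) hx)
  exact ⟨l, ι.map_injective (by rw [ι.map_comp, hl]; exact hi.lift_f _ _)⟩

/-- An object of `R` that covers `Z`. -/
noncomputable def cover (Z : B) : R := (hι.exists_presentation Z).choose

/-- The relations in the chosen presentation of `Z`; the image under `ι` of `relsHom Z` is the
kernel of `coverHom Z`. -/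
noncomputable def rels (Z : B) : R := (hι.exists_presentation Z).choose_spec.choose

noncomputable def relsHom (Z : B) : hι.rels Z ⟶ hι.cover Z :=
  (hι.exists_presentation Z).choose_spec.choose_spec.choose

noncomputable def coverHom (Z : B) : ι.obj (hι.cover Z) ⟶ Z :=
  (hι.exists_presentation Z).choose_spec.choose_spec.choose_spec.choose

theorem relsHom_coverHom (Z : B) : ι.map (hι.relsHom Z) ≫ hι.coverHom Z = 0 :=
  (hι.exists_presentation Z).choose_spec.choose_spec.choose_spec.choose_spec.choose

theorem exact_relsHom_coverHom (Z : B) :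
    (ShortComplex.mk _ _ (hι.relsHom_coverHom Z)).Exact :=
  (hι.exists_presentation Z).choose_spec.choose_spec.choose_spec.choose_spec.choose_spec.1

instance epi_coverHom (Z : B) : Epi (hι.coverHom Z) :=
  (hι.exists_presentation Z).choose_spec.choose_spec.choose_spec.choose_spec.choose_spec.2.1

instance mono_relsHom (Z : B) : Mono (hι.relsHom Z) :=
  (hι.exists_presentation Z).choose_spec.choose_spec.choose_spec.choose_spec.choose_spec.2.2

theorem exists_lift_coverHom {Y : R} {Z : B} (h : ι.obj Y ⟶ Z) :
    ∃ (Y₁ : R) (e : Y₁ ⟶ Y) (g : Y₁ ⟶ hι.cover Z), IsRegularEpi e ∧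
      ι.map e ≫ h = ι.map g ≫ hι.coverHom Z :=
  hι.isLocalEmbedding.exists_lift _ h inferInstance

variable {F : R ⥤ A} (hF : IsRegularFunctor F)

variable (F) in
/-- The value at `Z` of the exact extension of `F`. -/
noncomputable def extObj (Z : B) : A := cokernel (F.map (hι.relsHom Z))

variable (F) in
noncomputable def extπ (Z : B) : F.obj (hι.cover Z) ⟶ hι.extObj F Z := cokernel.π _

omit hι in
instance epi_extπ (hι : IsEnvelope ι) (Z : B) : Epi (hι.extπ F Z) :=
  inferInstanceAs (Epi (cokernel.π _))

theorem map_relsHom_extπ (Z : B) : F.map (hι.relsHom Z) ≫ hι.extπ F Z = 0 :=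
  cokernel.condition _

theorem exact_map_relsHom_extπ (Z : B) :
    (ShortComplex.mk _ _ (hι.map_relsHom_extπ (F := F) Z)).Exact :=
  ShortComplex.exact_of_g_is_cokernel _ (cokernelIsCokernel _)

include hF

/-- The difference of `g` and `g'` factors through the relations, and `F` is additive. -/
theorem map_extπ_eq {Y : R} {Z : B} (g g' : Y ⟶ hι.cover Z)
    (h : ι.map g ≫ hι.coverHom Z = ι.map g' ≫ hι.coverHom Z) :
    F.map g ≫ hι.extπ F Z = F.map g' ≫ hι.extπ F Z := by
  have := hι.isRegularFunctor.preservesFiniteLimits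
  have := hF.preservesFiniteLimits
  have := additive_of_preservesFiniteLimits F
  have := additive_of_preservesFiniteLimits ι
  obtain ⟨l, hl⟩ := hι.exists_factor (hι.exact_relsHom_coverHom Z) (g - g')
    (by rw [ι.map_sub, Preadditive.sub_comp, h, sub_self])
  rw [← sub_eq_zero, ← Preadditive.sub_comp, ← F.map_sub, ← hl, F.map_comp, Category.assoc,
    map_relsHom_extπ, comp_zero]

/-- On a regular cover `e₀` of `Y` the morphism `h` lifts to the generators of `Z`. The resulting
morphism on F Y₀ kills the kernel of the epimorphism F e₀, so it descends to F Y. The quantification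
over all `e` and `g` records independence of the chosen cover and lift. -/
theorem exists_ext {Y : R} {Z : B} (h : ι.obj Y ⟶ Z) :
    ∃ φ : F.obj Y ⟶ hι.extObj F Z, ∀ {Y₁ : R} (e : Y₁ ⟶ Y) (g : Y₁ ⟶ hι.cover Z),
      ι.map e ≫ h = ι.map g ≫ hι.coverHom Z → F.map e ≫ φ = F.map g ≫ hι.extπ F Z := by
  have := hι.isRegularFunctor.preservesFiniteLimits
  have := hF.preservesFiniteLimits
  have := additive_of_preservesFiniteLimits F
  have := additive_of_preservesFiniteLimits ι
  obtain ⟨Y₀, e₀, g₀, he₀, h₀⟩ := hι.exists_lift_coverHom h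
  have := hF.epi_map e₀ he₀
  have w : F.map (kernel.ι e₀) ≫ F.map e₀ = 0 := by
    rw [← F.map_comp, kernel.condition, F.map_zero]
  have hex : (ShortComplex.mk _ _ w).Exact :=
    ShortComplex.exact_of_f_is_kernel _ (isLimitOfHasKernelOfPreservesLimit F e₀)
  have : Epi (ShortComplex.mk _ _ w).g := inferInstanceAs (Epi (F.map e₀))
  have hw : F.map (kernel.ι e₀) ≫ F.map g₀ ≫ hι.extπ F Z = 0 := by
    have := hι.map_extπ_eq hF (kernel.ι e₀ ≫ g₀) 0 (by
      rw [ι.map_comp, Category.assoc, ← h₀, ← Category.assoc, ← ι.map_comp, kernel.condition]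
      simp)
    simpa using this
  refine ⟨hex.desc (F.map g₀ ≫ hι.extπ F Z) hw, fun {Y₁} e g hg => ?_⟩
  have hd : F.map e₀ ≫ hex.desc (F.map g₀ ≫ hι.extπ F Z) hw = F.map g₀ ≫ hι.extπ F Z :=
    hex.g_desc _ _
  -- An arbitrary lift is compared with the chosen one on the common refinement of the two covers.
  have := hF.epi_map (pullback.fst e e₀) inferInstance
  rw [← cancel_epi (F.map (pullback.fst e e₀)), ← F.map_comp_assoc, pullback.condition,
    F.map_comp, Category.assoc, hd, ← F.map_comp_assoc, ← F.map_comp_assoc]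
  apply hι.map_extπ_eq hF
  rw [ι.map_comp, Category.assoc, ← h₀, ← ι.map_comp_assoc, ← pullback.condition, ι.map_comp,
    ι.map_comp, Category.assoc, Category.assoc, hg]

/-- The morphism `F Y ⟶ F' Z` attached to `ι Y ⟶ Z`, where `F'` is the exact extension of `F`. -/
noncomputable def ext {Y : R} {Z : B} (h : ι.obj Y ⟶ Z) : F.obj Y ⟶ hι.extObj F Z :=
  (hι.exists_ext hF h).choose

theorem map_ext {Y Y₁ : R} {Z : B} {h : ι.obj Y ⟶ Z} {e : Y₁ ⟶ Y} {g : Y₁ ⟶ hι.cover Z}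
    (H : ι.map e ≫ h = ι.map g ≫ hι.coverHom Z) :
    F.map e ≫ hι.ext hF h = F.map g ≫ hι.extπ F Z :=
  (hι.exists_ext hF h).choose_spec e g H

theorem map_comp_ext {Y Y' : R} {Z : B} (f : Y' ⟶ Y) (h : ι.obj Y ⟶ Z) :
    F.map f ≫ hι.ext hF h = hι.ext hF (ι.map f ≫ h) := by
  obtain ⟨Y₁, e, g, he, H⟩ := hι.exists_lift_coverHom (ι.map f ≫ h)
  have := hF.epi_map e he
  rw [← cancel_epi (F.map e), hι.map_ext hF H, ← F.map_comp_assoc]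
  exact hι.map_ext hF (by simpa using H)

theorem ext_coverHom (Z : B) : hι.ext hF (hι.coverHom Z) = hι.extπ F Z := by
  simpa using hι.map_ext hF (e := 𝟙 _) (g := 𝟙 _) (h := hι.coverHom Z) rfl

theorem ext_add {Y : R} {Z : B} (h h' : ι.obj Y ⟶ Z) :
    hι.ext hF (h + h') = hι.ext hF h + hι.ext hF h' := by
  have := hι.isRegularFunctor.preservesFiniteLimits
  have := hF.preservesFiniteLimits
  have := additive_of_preservesFiniteLimits F
  have := additive_of_preservesFiniteLimits ι
  obtain ⟨Y₁, e, g, he, H⟩ := hι.exists_lift_coverHom h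
  obtain ⟨Y₂, e', g', he', H'⟩ := hι.exists_lift_coverHom (ι.map e ≫ h')
  have := hF.epi_map e he
  have := hF.epi_map e' he'
  rw [← cancel_epi (F.map e), ← cancel_epi (F.map e'), Preadditive.comp_add, Preadditive.comp_add,
    hι.map_ext hF H, map_comp_ext, map_comp_ext _ _ e h', hι.map_ext hF H',
    hι.map_ext hF (g := e' ≫ g + g')]
  · simp
  · rw [ι.map_add, Preadditive.add_comp, Preadditive.comp_add, Preadditive.comp_add, H, H',
      ι.map_comp, Category.assoc]

theorem ext_zero {Y : R} {Z : B} : hι.ext hF (0 : ι.obj Y ⟶ Z) = 0 := by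
  have := hι.ext_add hF (0 : ι.obj Y ⟶ Z) 0
  simpa using this

/-- The covering of `Z` lifts locally along `h`, so the epimorphism from a cover onto `extObj F Z`
factors through `ext h`. -/
theorem epi_ext {Y : R} {Z : B} (h : ι.obj Y ⟶ Z) [Epi h] : Epi (hι.ext hF h) := by
  obtain ⟨Y₁, e, g, he, H⟩ := hι.isLocalEmbedding.exists_lift h (hι.coverHom Z) inferInstance
  have := hF.epi_map e he
  have h₁ : F.map g ≫ hι.ext hF h = F.map e ≫ hι.extπ F Z := by
    rw [map_comp_ext, ← H, ← map_comp_ext, ext_coverHom]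
  have : Epi (F.map g ≫ hι.ext hF h) := by rw [h₁]; infer_instance
  exact epi_of_epi (F.map g) _

/-- This is exactness of F W → F Y → `extObj F Z` whenever `W` is the kernel of ι Y → Z. An element
killed by the second map lifts to a cover `Y₁` and then comes from the pullback of `g` along the
relations, which `F` preserves; that pullback maps to `Y` through `W`. -/
theorem exists_lift_of_ext_eq_zero {W Y : R} {Z : B} {i : W ⟶ Y} {h : ι.obj Y ⟶ Z}
    {w : ι.map i ≫ h = 0} (hi : (ShortComplex.mk _ _ w).Exact) [Mono i] {D : A}
    (a : D ⟶ F.obj Y) (ha : a ≫ hι.ext hF h = 0) :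
    ∃ (D' : A) (q : D' ⟶ D) (_ : Epi q) (b : D' ⟶ F.obj W), q ≫ a = b ≫ F.map i := by
  have := hF.preservesFiniteLimits
  obtain ⟨Y₁, e, g, he, H⟩ := hι.exists_lift_coverHom h
  have := hF.epi_map e he
  obtain ⟨D₁, q₁, _, a₁, h₁⟩ := surjective_up_to_refinements_of_epi (F.map e) a
  obtain ⟨D₂, q₂, _, b, h₂⟩ := (hι.exact_map_relsHom_extπ Z).exact_up_to_refinements
    (a₁ ≫ F.map g) (by
      dsimp
      rw [Category.assoc, ← hι.map_ext hF H, ← Category.assoc, ← h₁, Category.assoc, ha,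
        comp_zero])
  dsimp at b h₂
  let sq := (IsPullback.of_hasPullback g (hι.relsHom Z)).map F
  obtain ⟨l, hl⟩ := hι.exists_factor hi (pullback.fst g (hι.relsHom Z) ≫ e) (by
    rw [ι.map_comp, Category.assoc, H, ← ι.map_comp_assoc, pullback.condition, ι.map_comp,
      Category.assoc, relsHom_coverHom, comp_zero])
  refine ⟨D₂, q₂ ≫ q₁, epi_comp _ _, sq.lift (q₂ ≫ a₁) b (by rw [Category.assoc, h₂]) ≫ F.map l, ?_⟩
  rw [Category.assoc, Category.assoc, ← F.map_comp, hl, F.map_comp, sq.lift_fst_assoc, h₁,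
    Category.assoc]

/-- The action on morphisms of the exact extension. -/
noncomputable def extMap {Z Z' : B} (f : Z ⟶ Z') : hι.extObj F Z ⟶ hι.extObj F Z' :=
  cokernel.desc _ (hι.ext hF (hι.coverHom Z ≫ f)) (by
    rw [map_comp_ext, ← Category.assoc, relsHom_coverHom, zero_comp, ext_zero])

theorem extπ_extMap {Z Z' : B} (f : Z ⟶ Z') :
    hι.extπ F Z ≫ hι.extMap hF f = hι.ext hF (hι.coverHom Z ≫ f) :=
  cokernel.π_desc _ _ _

theorem ext_extMap {Y : R} {Z Z' : B} (h : ι.obj Y ⟶ Z) (f : Z ⟶ Z') :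
    hι.ext hF h ≫ hι.extMap hF f = hι.ext hF (h ≫ f) := by
  obtain ⟨Y₁, e, g, he, H⟩ := hι.exists_lift_coverHom h
  have := hF.epi_map e he
  rw [← cancel_epi (F.map e), ← Category.assoc, hι.map_ext hF H, Category.assoc, extπ_extMap,
    map_comp_ext, map_comp_ext, ← Category.assoc, ← H, Category.assoc]

/-- The exact extension of a regular functor. -/
noncomputable def extension : B ⥤ A where
  obj := hι.extObj F
  map f := hι.extMap hF f
  map_id Z := by
    rw [← cancel_epi (hι.extπ F Z), extπ_extMap, Category.comp_id, Category.comp_id, ext_coverHom]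
  map_comp f g := by
    rw [← cancel_epi (hι.extπ F _), extπ_extMap, ← Category.assoc (hι.extπ F _), extπ_extMap,
      ext_extMap, Category.assoc]

instance additive_extension : (hι.extension hF).Additive where
  map_add {Z Z' f g} := by
    refine (cancel_epi (hι.extπ F Z)).1 ?_
    change _ ≫ hι.extMap hF (f + g) = _ ≫ (hι.extMap hF f + hι.extMap hF g)
    rw [Preadditive.comp_add, extπ_extMap, extπ_extMap, extπ_extMap, Preadditive.comp_add, ext_add]

theorem epi_extMap {Z Z' : B} (f : Z ⟶ Z') [Epi f] : Epi (hι.extMap hF f) := by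
  have := hι.epi_ext hF (hι.coverHom Z ≫ f)
  rw [← extπ_extMap] at this
  exact epi_of_epi (hι.extπ F Z) _

/-- Since `f` is monic, the relations of `Z` are also the kernel of ι (cover Z) → Z → Z', so
`exists_lift_of_ext_eq_zero` applies and puts the lifted element among the relations, where it dies.
-/
theorem mono_extMap {Z Z' : B} (f : Z ⟶ Z') [Mono f] : Mono (hι.extMap hF f) := by
  rw [Preadditive.mono_iff_cancel_zero]
  intro D a ha
  obtain ⟨D₁, q₁, _, b, h₁⟩ := surjective_up_to_refinements_of_epi (hι.extπ F Z) a
  have w : ι.map (hι.relsHom Z) ≫ hι.coverHom Z ≫ f = 0 := by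
    rw [← Category.assoc, relsHom_coverHom, zero_comp]
  have hex : (ShortComplex.mk _ _ w).Exact := by
    rw [ShortComplex.exact_iff_exact_up_to_refinements]
    intro C y hy
    dsimp at y hy
    exact (hι.exact_relsHom_coverHom Z).exact_up_to_refinements y (by
      dsimp; rw [← cancel_mono f, Category.assoc, hy, zero_comp])
  obtain ⟨D₂, q₂, _, c, h₂⟩ := hι.exists_lift_of_ext_eq_zero hF hex b (by
    rw [← extπ_extMap, ← Category.assoc, ← h₁, Category.assoc, ha, comp_zero])
  rw [← cancel_epi q₁, ← cancel_epi q₂, h₁, ← Category.assoc, h₂, Category.assoc,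
    map_relsHom_extπ]
  simp

/-- After lifting `a` to the generators of X₂, it comes from the kernel `W` of generators → X₃. By
exactness ι W → X₂ factors through X₁, which supplies the preimage. -/
theorem exists_lift_of_comp_extMap_eq_zero {S : ShortComplex B} (hS : S.ShortExact) {D : A}
    (a : D ⟶ hι.extObj F S.X₂) (ha : a ≫ hι.extMap hF S.g = 0) :
    ∃ (D' : A) (q : D' ⟶ D) (_ : Epi q) (b : D' ⟶ hι.extObj F S.X₁),
      q ≫ a = b ≫ hι.extMap hF S.f := by
  have := hS.mono_f
  obtain ⟨D₁, q₁, _, b, h₁⟩ := surjective_up_to_refinements_of_epi (hι.extπ F S.X₂) a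
  obtain ⟨W, i, w, hi, _⟩ := hι.isLocalEmbedding.exists_exact (hι.isQuotient _)
    (hι.coverHom S.X₂ ≫ S.g)
  obtain ⟨D₂, q₂, _, c, h₂⟩ := hι.exists_lift_of_ext_eq_zero hF hi b (by
    rw [← extπ_extMap, ← Category.assoc, ← h₁, Category.assoc, ha, comp_zero])
  have w' : (ι.map i ≫ hι.coverHom S.X₂) ≫ S.g = 0 := by rw [Category.assoc, w]
  refine ⟨D₂, q₂ ≫ q₁, epi_comp _ _, c ≫ hι.ext hF (hS.exact.lift _ w'), ?_⟩
  rw [Category.assoc, Category.assoc, ext_extMap, hS.exact.lift_f, h₁, ← map_comp_ext,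
    ext_coverHom, ← Category.assoc, h₂, Category.assoc]

theorem exact_extMap {S : ShortComplex B} (hS : S.ShortExact) :
    (S.map (hι.extension hF)).Exact := by
  rw [ShortComplex.exact_iff_exact_up_to_refinements]
  exact fun D a ha => hι.exists_lift_of_comp_extMap_eq_zero hF hS a ha

theorem preservesFiniteLimits_and_colimits_extension :
    PreservesFiniteLimits (hι.extension hF) ∧ PreservesFiniteColimits (hι.extension hF) := by
  refine ((hι.extension hF).exact_tfae.out 0 3).1 ?_
  intro S hS
  exact {
    exact := hι.exact_extMap hF hS
    mono_f := have := hS.mono_f; hι.mono_extMap hF S.f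
    epi_g := have := hS.epi_g; hι.epi_extMap hF S.g }

/-- The kernel of the identity is 0, so the exactness statement above gives injectivity; `epi_ext`
gives the rest. -/
theorem isIso_ext_id (X : R) : IsIso (hι.ext hF (𝟙 (ι.obj X))) := by
  have := hι.isRegularFunctor.preservesFiniteLimits
  have := hF.preservesFiniteLimits
  have := additive_of_preservesFiniteLimits F
  have := additive_of_preservesFiniteLimits ι
  have : HasZeroObject R := hasZeroObject_of_hasTerminal_object
  have := hι.epi_ext hF (𝟙 (ι.obj X))
  have : Mono (hι.ext hF (𝟙 (ι.obj X))) := by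
    rw [Preadditive.mono_iff_cancel_zero]
    intro D a ha
    have hex : (ShortComplex.mk (ι.map (0 : 0 ⟶ X)) (𝟙 (ι.obj X)) (by simp)).Exact := by
      rw [ShortComplex.exact_iff_mono _ (by simp)]
      dsimp; infer_instance
    have : Mono (0 : (0 : R) ⟶ X) := ⟨fun _ _ _ => (isZero_zero R).eq_of_tgt _ _⟩
    obtain ⟨D₁, q, _, b, h⟩ := hι.exists_lift_of_ext_eq_zero hF hex a ha
    rw [← cancel_epi q, h]
    simp
  exact isIso_of_mono_of_epi _

/-- The exact extension of `F` extends `F`. -/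
noncomputable def extensionIso : ι ⋙ hι.extension hF ≅ F :=
  (NatIso.ofComponents (F := F) (G := ι ⋙ hι.extension hF)
    (fun X => @asIso _ _ (F.obj X) (hι.extObj F (ι.obj X)) _ (hι.isIso_ext_id hF X))
    (fun {X Y} f => by
      change F.map f ≫ hι.ext hF _ = hι.ext hF _ ≫ hι.extMap hF _
      rw [map_comp_ext, ext_extMap, Category.id_comp, Category.comp_id])).symm

omit hF

/-! ### Natural transformations are determined by, and extend from, the generating objects. -/

section Restriction

variable {G H : B ⥤ A} (hG : PreservesFiniteColimits G)

include hG in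
theorem exists_exact_map (Z : B) : ∃ (X K : R) (k : K ⟶ X) (p : ι.obj X ⟶ Z)
    (w : G.map (ι.map k) ≫ G.map p = 0), (ShortComplex.mk _ _ w).Exact ∧ Epi (G.map p) ∧ Epi p ∧
      ι.map k ≫ p = 0 := by
  have := additive_of_preservesFiniteColimits G
  obtain ⟨X, K, k, p, w, hex, hp, _⟩ := hι.exists_presentation Z
  have hG' : ∀ S : ShortComplex B, S.Exact ∧ Epi S.g → (S.map G).Exact ∧ Epi (G.map S.g) :=
    (G.preservesFiniteColimits_tfae.out 3 1).1 hG
  have hGp := hG' _ ⟨hex, hp⟩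
  refine ⟨X, K, k, p, by rw [← G.map_comp, w, G.map_zero], ?_, inferInstance, hp, w⟩
  exact hGp.1

omit [Preadditive R] [Regular R] [Abelian B] [Abelian A] in
/-- Natural transformations on `B` are determined by their restriction to `R`. -/
theorem natTrans_ext (hG : ∀ {Z Z' : B} (p : Z ⟶ Z') [Epi p], Epi (G.map p)) {σ τ : G ⟶ H}
    (h : ∀ X, σ.app (ι.obj X) = τ.app (ι.obj X)) : σ = τ := by
  ext Z
  obtain ⟨X, p, _⟩ := hι.exists_epi Z
  have := hG p
  rw [← cancel_epi (G.map p), σ.naturality, τ.naturality, h]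

include hG in
-- The component at `Z` is induced on cokernels by the component of `τ` at a cover.
theorem exists_natTrans (hH : PreservesFiniteColimits H) (τ : ι ⋙ G ⟶ ι ⋙ H) :
    ∃ σ : G ⟶ H, Functor.whiskerLeft ι σ = τ := by
  -- Compatibility with every morphism from an object of `R`, not only with the chosen cover,
  -- removes the dependence on the presentation and makes naturality immediate.
  have key : ∀ Z, ∃ σ : G.obj Z ⟶ H.obj Z, ∀ {Y : R} (h : ι.obj Y ⟶ Z),
      G.map h ≫ σ = τ.app Y ≫ H.map h := by
    intro Z
    obtain ⟨X, K, k, p, w, hex, hp', hp, w'⟩ := hι.exists_exact_map hG Z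
    have := additive_of_preservesFiniteColimits H
    have : Epi (ShortComplex.mk _ _ w).g := hp'
    have hk : (ShortComplex.mk _ _ w).f ≫ τ.app X ≫ H.map p = 0 := by
      have := τ.naturality k
      dsimp at this ⊢
      rw [← Category.assoc, this, Category.assoc, ← H.map_comp, w', H.map_zero, comp_zero]
    have hd := hex.g_desc (τ.app X ≫ H.map p) hk
    refine ⟨hex.desc (τ.app X ≫ H.map p) hk, fun {Y} h => ?_⟩
    obtain ⟨Y₁, e, g, he, H₁⟩ := hι.isLocalEmbedding.exists_lift p h hp
    have := hι.isRegularFunctor.epi_map e he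
    have h₁ := τ.naturality e
    have h₂ := τ.naturality g
    dsimp at h₁ h₂ hd
    rw [← cancel_epi (G.map (ι.map e)), ← Category.assoc, ← G.map_comp, H₁, G.map_comp,
      Category.assoc, hd, reassoc_of% h₁, reassoc_of% h₂, ← H.map_comp, ← H.map_comp, H₁]
  choose σ hσ using key
  refine ⟨{ app := σ, naturality := fun Z Z' f => ?_ }, ?_⟩
  · obtain ⟨X, p, _⟩ := hι.exists_epi Z
    rw [← cancel_epi (G.map p), ← Category.assoc, ← G.map_comp, hσ, ← Category.assoc, hσ,
      Category.assoc, H.map_comp]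
  · ext X
    simpa using hσ _ (𝟙 (ι.obj X))

end Restriction

end IsEnvelope

/-- The property of being a regular functor. -/
def regularFunctors (R : Type*) [Category* R] (A : Type*) [Category* A] :
    ObjectProperty (R ⥤ A) := fun F => IsRegularFunctor F

/-- The property of being an exact functor. -/
def exactFunctors (B : Type*) [Category* B] (A : Type*) [Category* A] :
    ObjectProperty (B ⥤ A) := fun F => PreservesFiniteLimits F ∧ PreservesFiniteColimits F

omit [Preadditive R] [Regular R] [Abelian A] [Abelian B] in
theorem IsRegularFunctor.comp {ι : R ⥤ B} (hι : IsRegularFunctor ι) {F : B ⥤ A}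
    (hF : exactFunctors B A F) : IsRegularFunctor (ι ⋙ F) where
  preservesFiniteLimits :=
    have := hι.preservesFiniteLimits
    have := hF.1
    comp_preservesFiniteLimits _ _
  epi_map f hf := by
    have := hι.epi_map f hf
    have := hF.2
    exact inferInstanceAs (Epi (F.map (ι.map f)))

/-- Restriction of exact functors along an envelope. -/
def restriction (A : Type*) [Category* A] [Abelian A] {ι : R ⥤ B} (hι : IsRegularFunctor ι) :
    (exactFunctors B A).FullSubcategory ⥤ (regularFunctors R A).FullSubcategory :=
  (regularFunctors R A).lift ((exactFunctors B A).ι ⋙ (Functor.whiskeringLeft _ _ A).obj ι)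
    fun F => hι.comp F.property

theorem IsEnvelope.isEquivalence_restriction {ι : R ⥤ B} (hι : IsEnvelope ι) :
    (restriction A hι.isRegularFunctor).IsEquivalence where
  faithful := ⟨fun {F G σ τ} h => by
    apply ObjectProperty.hom_ext
    refine hι.natTrans_ext (fun p _ => have := F.property.2; inferInstance) fun X => ?_
    exact congrArg (fun t => t.hom.app X) h⟩
  full := ⟨fun {F G} τ => by
    obtain ⟨σ, hσ⟩ := hι.exists_natTrans F.property.2 G.property.2 τ.hom
    exact ⟨ObjectProperty.homMk σ, ObjectProperty.hom_ext _ hσ⟩⟩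
  essSurj := ⟨fun F => ⟨⟨hι.extension F.property,
    hι.preservesFiniteLimits_and_colimits_extension F.property⟩,
    ⟨(regularFunctors R A).isoMk (hι.extensionIso F.property)⟩⟩⟩

end Extension

end TMotives

namespace TMotives

open Opposite

/-! ## Sheaves for the regular topology -/

section RegTopology

variable {R : Type w} [SmallCategory R] [Regular R]

/-- In a regular category, stability of regular epimorphisms shows that the generated topology has
as covering sieves just those containing one regular epimorphism; subcanonicity comes with the
identification. -/
theorem regTopology_eq : regTopology R = regularTopology R := by
  ext X S
  constructor
  · intro h
    change Precoverage.Saturate _ X S at h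
    induction h with
    | of X S h =>
      obtain ⟨Y, f, hf, rfl⟩ := h
      exact (regularTopology.mem_sieves_iff_hasEffectiveEpi _).2
        ⟨Y, f, inferInstance, ⟨Y, 𝟙 _, f, Presieve.singleton_self f, Category.id_comp _⟩⟩
    | top X => exact (regularTopology R).top_mem X
    | pullback X S _ Y f ih => exact (regularTopology R).pullback_stable f ih
    | transitive X S S' _ _ ih ih' => exact (regularTopology R).transitive ih S' fun _ _ h => ih' h
  · intro h
    obtain ⟨Y, f, hf, hS⟩ := (regularTopology.mem_sieves_iff_hasEffectiveEpi _).1 h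
    refine (regTopology R).superset_covering (S := Sieve.generate (.singleton f)) ?_
      (Precoverage.Saturate.of _ _ ⟨Y, f, inferInstance, rfl⟩)
    rw [Sieve.generate_le_iff]
    rintro _ _ ⟨⟩
    exact hS

theorem mem_regTopology_iff {X : R} {S : Sieve X} :
    S ∈ regTopology R X ↔ ∃ (Y : R) (f : Y ⟶ X), IsRegularEpi f ∧ S.arrows f := by
  rw [regTopology_eq, regularTopology.mem_sieves_iff_hasEffectiveEpi]
  simp only [isRegularEpi_iff_effectiveEpi]

instance : (regTopology R).Subcanonical := by
  rw [regTopology_eq]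
  infer_instance

variable [Preadditive R]

variable (R) in
/-- The additive Yoneda embedding of a preadditive regular category. -/
noncomputable def additiveEmbedding : R ⥤ Sheaf (regTopology R) AddCommGrpCat.{w} :=
  ObjectProperty.lift _ preadditiveYoneda fun X =>
    (Presheaf.isSheaf_iff_isSheaf_forget _ _ (forget AddCommGrpCat.{w})).2
      ((regTopology R).yoneda.obj X).property

omit [Preadditive R] in
theorem exists_section {Z Z' : Sheaf (regTopology R) AddCommGrpCat.{w}} (p : Z ⟶ Z') [Epi p]
    {X : R} (z : Z'.obj.obj (op X)) :
    ∃ (Y : R) (e : Y ⟶ X) (y : Z.obj.obj (op Y)), IsRegularEpi e ∧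
      p.hom.app (op Y) y = Z'.obj.map e.op z := by
  have : Sheaf.IsLocallySurjective p := (Sheaf.isLocallySurjective_iff_epi' _ p).2 inferInstance
  obtain ⟨Y, e, he, y, hy⟩ := mem_regTopology_iff.1
    (Presheaf.imageSieve_mem (regTopology R) p.hom z)
  exact ⟨Y, e, y, he, hy⟩

omit [Preadditive R] in
theorem epi_of_exists_section {Z Z' : Sheaf (regTopology R) AddCommGrpCat.{w}} (p : Z ⟶ Z')
    (h : ∀ {X : R} (z : Z'.obj.obj (op X)), ∃ (Y : R) (e : Y ⟶ X) (y : Z.obj.obj (op Y)),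
      IsRegularEpi e ∧ p.hom.app (op Y) y = Z'.obj.map e.op z) : Epi p := by
  rw [← Sheaf.isLocallySurjective_iff_epi' AddCommGrpCat p]
  refine ⟨fun {U} z => mem_regTopology_iff.2 ?_⟩
  obtain ⟨Y, e, y, he, hy⟩ := h z
  exact ⟨Y, e, he, y, hy⟩

/-- Morphisms out of a representable are determined by an element. -/
theorem additiveEmbedding_app {X Y : R} {Z : Sheaf (regTopology R) AddCommGrpCat.{w}}
    (p : (additiveEmbedding R).obj X ⟶ Z) (v : Y ⟶ X) :
    p.hom.app (op Y) v = Z.obj.map v.op (p.hom.app (op X) (𝟙 X)) := by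
  have := ConcreteCategory.congr_hom (p.hom.naturality v.op) (𝟙 X)
  refine Eq.trans ?_ this
  exact congrArg (p.hom.app (op Y)) (Category.comp_id v).symm

/-- A morphism out of a representable is a section, and a section lifts along an epimorphism of
sheaves after restriction along one regular epimorphism; this gives `exists_lift`. Regular
epimorphisms become locally surjective because a section `z` of the target lifts on the pullback of
`f` along `z`. -/
theorem isLocalEmbedding_additiveEmbedding : IsLocalEmbedding (additiveEmbedding R) where
  full := by unfold additiveEmbedding; infer_instance
  faithful := by unfold additiveEmbedding; infer_instance
  isRegularFunctor := {
    preservesFiniteLimits := by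
      refine ⟨fun J _ _ => ?_⟩
      have : PreservesLimitsOfShape J (preadditiveYoneda (C := R)) :=
        preservesLimitsOfShape_of_evaluation _ _ fun X =>
          inferInstanceAs (PreservesLimitsOfShape J (preadditiveCoyoneda.obj X))
      have : PreservesLimitsOfShape J (additiveEmbedding R ⋙ sheafToPresheaf _ _) :=
        inferInstanceAs (PreservesLimitsOfShape J (preadditiveYoneda (C := R)))
      exact preservesLimitsOfShape_of_reflects_of_preserves _ (sheafToPresheaf _ _)
    epi_map := fun {X Y} f hf => epi_of_exists_section _ fun {V} z => by
      change V ⟶ Y at z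
      exact ⟨pullback z f, pullback.fst z f, pullback.snd z f, inferInstance,
        pullback.condition.symm⟩ }
  exists_lift {X X' Z} p h _ := by
    obtain ⟨Y, e, g, he, hg⟩ := exists_section p (h.hom.app (op X) (𝟙 X))
    change Y ⟶ X' at g
    refine ⟨Y, e, g, he, ?_⟩
    apply ObjectProperty.hom_ext
    ext V v
    change h.hom.app V (v ≫ e) = p.hom.app V (v ≫ g)
    obtain ⟨V⟩ := V
    change V ⟶ Y at v
    rw [additiveEmbedding_app, additiveEmbedding_app p, op_comp, op_comp, Functor.map_comp,
      Functor.map_comp]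
    change Z.obj.map v.op (Z.obj.map e.op _) = Z.obj.map v.op (Z.obj.map g.op _)
    rw [← hg, additiveEmbedding_app]

end RegTopology

end TMotives

namespace TMotives

open Opposite

/-! ## The exact completion of an additive regular category -/

section ExactCompletion

variable (R : Type w) [SmallCategory R] [Regular R] [Preadditive R]

/-- The underlying sheaf of sets. -/
noncomputable abbrev forgetSheaf :
    Sheaf (regTopology R) AddCommGrpCat.{w} ⥤ Sheaf (regTopology R) (Type w) :=
  sheafCompose _ (forget AddCommGrpCat.{w})

/-- The category of the cokernels of morphisms of `R` in abelian sheaves. -/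
abbrev AdditiveCompletion := (isQuotient (additiveEmbedding R)).FullSubcategory

noncomputable abbrev forgetCompletion : AdditiveCompletion R ⥤ Sheaf (regTopology R) (Type w) :=
  ObjectProperty.ι _ ⋙ forgetSheaf R

/-- The topology is subcanonical, so representables are sheaves and sheafification does not change
them. -/
noncomputable def toSheavesIso : toSheaves R ≅ additiveEmbedding R ⋙ forgetSheaf R :=
  Functor.isoWhiskerLeft (regTopology R).yoneda
    (asIso (sheafificationAdjunction (regTopology R) (Type w)).counit)

variable {R}

omit [Preadditive R] in
theorem map_injective_of_isRegularEpi (Z : Sheaf (regTopology R) AddCommGrpCat.{w}) {X Y : R}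
    (e : Y ⟶ X) [IsRegularEpi e] : Function.Injective (Z.obj.map e.op) := by
  intro a b h
  have hs := ((isSheaf_iff_isSheaf_of_type _ _).1 ((forgetSheaf R).obj Z).property).isSeparated
    (Sieve.generate (.singleton e))
    (mem_regTopology_iff.2 ⟨Y, e, inferInstance, Y, 𝟙 _, e, .mk, Category.id_comp _⟩)
  refine hs.ext ?_
  rintro W _ ⟨_, g, _, ⟨⟩, rfl⟩
  change Z.obj.map (g ≫ e).op a = Z.obj.map (g ≫ e).op b
  rw [op_comp, Functor.map_comp]
  change Z.obj.map g.op (Z.obj.map e.op a) = Z.obj.map g.op (Z.obj.map e.op b)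
  rw [h]

/-- Here `t` is only a map of sheaves of sets. Its composite with `p` is one section of `Z'`, which
locally lifts to a morphism `g` of `R` followed by `q`. Composition in `R` being additive, the map
is locally additive. -/
theorem exists_locally_hom {Z Z' : Sheaf (regTopology R) AddCommGrpCat.{w}}
    (hZ' : isQuotient (additiveEmbedding R) Z')
    (t : (forgetSheaf R).obj Z ⟶ (forgetSheaf R).obj Z') {X : R}
    (p : (additiveEmbedding R).obj X ⟶ Z) :
    ∃ (Y : R) (e : Y ⟶ X) (h : (additiveEmbedding R).obj Y ⟶ Z'), IsRegularEpi e ∧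
      (forgetSheaf R).map ((additiveEmbedding R).map e ≫ p) ≫ t = (forgetSheaf R).map h := by
  obtain ⟨X', K, k, q, w, hex, hq⟩ := hZ'
  let z : Z'.obj.obj (op X) := t.hom.app (op X) (p.hom.app (op X) (𝟙 X))
  obtain ⟨Y, e, g, he, hg⟩ := exists_section q z
  change Y ⟶ X' at g
  refine ⟨Y, e, (additiveEmbedding R).map g ≫ q, he, ?_⟩
  apply ObjectProperty.hom_ext
  ext V v
  obtain ⟨V⟩ := V
  change V ⟶ Y at v
  change t.hom.app (op V) (p.hom.app (op V) (v ≫ e)) = q.hom.app (op V) (v ≫ g)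
  have h₁ : (q.hom.app (op V) (v ≫ g) : Z'.obj.obj (op V)) =
      Z'.obj.map v.op (q.hom.app (op Y) g) := by
    rw [additiveEmbedding_app q, additiveEmbedding_app q g, op_comp, Functor.map_comp]
    rfl
  rw [h₁, hg, additiveEmbedding_app p]
  have h₂ := ConcreteCategory.congr_hom (t.hom.naturality (v ≫ e).op) (p.hom.app (op X) (𝟙 X))
  refine Eq.trans h₂ ?_
  change Z'.obj.map (v ≫ e).op z = _
  rw [op_comp, Functor.map_comp]
  rfl

instance : (forgetCompletion R).Faithful :=
  have : (forgetSheaf R).Faithful := inferInstance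
  inferInstance

/-- Every map of the underlying sheaves of sets is additive, as additivity may be tested on a
representable cover of the source. -/
instance : (forgetCompletion R).Full where
  map_surjective {Z Z'} t := by
    obtain ⟨X, K, k, p, w, hex, hp⟩ := Z.property
    obtain ⟨Y, e, h, he, H⟩ := exists_locally_hom Z'.property t p
    have hepi := isLocalEmbedding_additiveEmbedding.isRegularFunctor.epi_map e he
    let π := (additiveEmbedding R).map e ≫ p
    have hπ : Epi π := epi_comp _ _
    let f (V : R) (z : Z.obj.obj.obj (op V)) : Z'.obj.obj.obj (op V) := t.hom.app (op V) z
    have hnat {V W : R} (g : W ⟶ V) (z : Z.obj.obj.obj (op V)) :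
        f W (Z.obj.obj.map g.op z) = Z'.obj.obj.map g.op (f V z) :=
      ConcreteCategory.congr_hom (t.hom.naturality g.op) z
    have hH {V : R} (v : ((additiveEmbedding R).obj Y).obj.obj (op V)) :
        f V (π.hom.app (op V) v) = h.hom.app (op V) v := by
      have := congrArg (fun s => s.hom.app (op V)) H
      exact ConcreteCategory.congr_hom this v
    -- Both sections come from `Y` after restriction along two successive regular epimorphisms.
    -- There `t` agrees with the additive `h`, and restriction is injective on sections of the sheaf
    -- `Z'`.
    have hadd (V : R) (z z' : Z.obj.obj.obj (op V)) : f V (z + z') = f V z + f V z' := by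
      obtain ⟨V₁, e₁, y, he₁, hy⟩ := exists_section π z
      obtain ⟨V₂, e₂, y', he₂, hy'⟩ := exists_section π (Z.obj.obj.map e₁.op z')
      apply map_injective_of_isRegularEpi Z'.obj e₁
      apply map_injective_of_isRegularEpi Z'.obj e₂
      have hy₂ := ConcreteCategory.congr_hom (π.hom.naturality e₂.op) y
      have hy₂ : π.hom.app (op V₂) (((additiveEmbedding R).obj Y).obj.map e₂.op y) =
        Z.obj.obj.map e₂.op (π.hom.app (op V₁) y) := hy₂
      rw [map_add, map_add, ← hnat, ← hnat, ← hnat, ← hnat, ← hnat, ← hnat, map_add, map_add, ← hy,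
        ← hy', ← hy₂, ← map_add, hH, hH, hH, map_add]
    let s : Z.obj ⟶ Z'.obj := ⟨{
      app := fun V => AddCommGrpCat.ofHom (AddMonoidHom.mk' (f V.unop) (hadd V.unop))
      naturality := fun V W g => by
        ext z
        exact hnat g.unop z }⟩
    exact ⟨ObjectProperty.homMk s, rfl⟩

/-- The forgetful functor to sheaves of sets preserves the pullback and, by local surjectivity, the
epimorphism `π`. In a category of sheaves of sets an epimorphism is the coequalizer of its kernel
pair. -/
theorem nonempty_iso_quotient {Z : Sheaf (regTopology R) AddCommGrpCat.{w}} (S : EqRel R)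
    (π : (additiveEmbedding R).obj S.X ⟶ Z) [Epi π]
    (h : IsPullback ((additiveEmbedding R).map S.p₁) ((additiveEmbedding R).map S.p₂) π π) :
    Nonempty ((forgetSheaf R).obj Z ≅ S.quotient) := by
  have hloc : Sheaf.IsLocallySurjective π :=
    (Sheaf.isLocallySurjective_iff_epi' _ π).2 inferInstance
  have : Epi ((forgetSheaf R).map π) := by
    rw [← Sheaf.isLocallySurjective_iff_epi]
    exact ⟨fun {U} z => hloc.imageSieve_mem z⟩
  have : IsRegularEpi ((forgetSheaf R).map π) := IsRegularEpiCategory.regularEpiOfEpi _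
  have h' := h.map (forgetSheaf R)
  let c := isColimitCoforkOfEffectiveEpi ((forgetSheaf R).map π) _ h'.isLimit
  let i := toSheavesIso R
  let d : parallelPair ((toSheaves R).map S.p₁) ((toSheaves R).map S.p₂) ≅
      parallelPair ((forgetSheaf R).map ((additiveEmbedding R).map S.p₁))
        ((forgetSheaf R).map ((additiveEmbedding R).map S.p₂)) :=
    parallelPair.ext (i.app _) (i.app _) (i.hom.naturality _) (i.hom.naturality _)
  exact ⟨c.coconePointUniqueUpToIso
    ((IsColimit.precomposeInvEquiv d _).symm (coequalizerIsCoequalizer _ _))⟩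

/-- An additive criterion for a kernel pair: `r` is the diagonal, `j` sends c to the pair (0, c),
and `l` sends (a, b) to b - a. A pair with equal images under `π` is then a ≫ r + (b - a) ≫ j. -/
theorem isPullback_of_exact {K E X : R} {Z : Sheaf (regTopology R) AddCommGrpCat.{w}} {k : K ⟶ X}
    {π : (additiveEmbedding R).obj X ⟶ Z} {w : (additiveEmbedding R).map k ≫ π = 0}
    (hex : (ShortComplex.mk _ _ w).Exact) [Mono k] {p₁ p₂ : E ⟶ X} (hp : JointlyMono₂ p₁ p₂)
    (r : X ⟶ E) (j : K ⟶ E) (l : E ⟶ K) (h₁ : r ≫ p₁ = 𝟙 _) (h₂ : r ≫ p₂ = 𝟙 _)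
    (h₃ : j ≫ p₁ = 0) (h₄ : j ≫ p₂ = k) (h₅ : l ≫ k = p₂ - p₁) :
    IsPullback ((additiveEmbedding R).map p₁) ((additiveEmbedding R).map p₂) π π := by
  have hF := isLocalEmbedding_additiveEmbedding (R := R)
  have := hF.isRegularFunctor.preservesFiniteLimits
  have := additive_of_preservesFiniteLimits (additiveEmbedding R)
  have : Mono (ShortComplex.mk _ _ w).f := inferInstanceAs (Mono ((additiveEmbedding R).map k))
  have hc : (additiveEmbedding R).map p₁ ≫ π = (additiveEmbedding R).map p₂ ≫ π := by
    rw [← sub_eq_zero, ← Preadditive.sub_comp, ← neg_eq_zero, ← Preadditive.neg_comp, neg_sub,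
      ← Functor.map_sub, ← h₅, Functor.map_comp, Category.assoc, w, comp_zero]
  have hl (s : PullbackCone π π) :
      hex.lift (s.snd - s.fst) (by simp [Preadditive.sub_comp, s.condition]) ≫
        (additiveEmbedding R).map k = s.snd - s.fst := hex.lift_f _ _
  refine ⟨⟨hc⟩, ⟨PullbackCone.IsLimit.mk hc (fun s =>
      s.fst ≫ (additiveEmbedding R).map r + hex.lift (s.snd - s.fst) (by
        simp [Preadditive.sub_comp, s.condition]) ≫ (additiveEmbedding R).map j)
    (fun s => ?_) (fun s => ?_) (fun s m hm hm' => ?_)⟩⟩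
  · rw [Preadditive.add_comp, Category.assoc, Category.assoc, ← Functor.map_comp,
      ← Functor.map_comp, h₁, h₃]
    simp
  · rw [Preadditive.add_comp, Category.assoc, Category.assoc, ← Functor.map_comp,
      ← Functor.map_comp, h₂, h₄, hl]
    simp
  -- Every related pair decomposes as (a, b) = (a, a) + (0, b - a); this yields uniqueness of the
  -- lift.
  · have hE : 𝟙 E = p₁ ≫ r + l ≫ j := hp.right_cancellation _ _
      (by simp [Preadditive.add_comp, h₁, h₃]) (by simp [Preadditive.add_comp, h₂, h₄, h₅])
    have hm₁ : m ≫ (additiveEmbedding R).map l = hex.lift (s.snd - s.fst) (by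
        simp [Preadditive.sub_comp, s.condition]) := by
      rw [← cancel_mono ((additiveEmbedding R).map k), hl, Category.assoc, ← Functor.map_comp, h₅,
        Functor.map_sub, Preadditive.comp_sub, hm, hm']
    rw [← hm₁, ← hm, Category.assoc, Category.assoc, ← Functor.map_comp, ← Functor.map_comp,
      ← Preadditive.comp_add, ← Functor.map_add, ← hE, CategoryTheory.Functor.map_id,
      Category.comp_id]

/-- The kernel of `p₁` gives the cokernel presentation of the quotient by an equivalence
relation. -/
theorem exists_iso_quotient (S : EqRel R) :
    ∃ Z : AdditiveCompletion R, Nonempty ((forgetCompletion R).obj Z ≅ S.quotient) := by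
  have hF := isLocalEmbedding_additiveEmbedding (R := R)
  have := hF.isRegularFunctor.preservesFiniteLimits
  have := additive_of_preservesFiniteLimits (additiveEmbedding R)
  obtain ⟨e⟩ := S.isEquivalenceRelation.nonempty_equivalenceRelation
  -- The kernel of `p₁` consists of the pairs (0, b), and `k` embeds it in `S.X` as the class of 0.
  let k := kernel.ι S.p₁ ≫ S.p₂
  have : Mono k := Preadditive.mono_of_cancel_zero _ fun g hg => by
    rw [← cancel_mono (kernel.ι S.p₁)]
    exact e.right_cancellation _ _ (by simp) (by simpa [k] using hg)
  let π := cokernel.π ((additiveEmbedding R).map k)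
  have hex : (ShortComplex.mk _ _ (cokernel.condition ((additiveEmbedding R).map k))).Exact :=
    ShortComplex.exact_of_g_is_cokernel _ (cokernelIsCokernel _)
  refine ⟨⟨cokernel ((additiveEmbedding R).map k), S.X, _, k, π, _, hex, inferInstance⟩,
    nonempty_iso_quotient S π (isPullback_of_exact hex e.toJointlyMono₂ e.r (kernel.ι S.p₁)
      (kernel.lift S.p₁ (𝟙 _ - S.p₁ ≫ e.r) (by simp [Preadditive.sub_comp])) (by simp) (by simp)
      (by simp) rfl (by simp [k, Preadditive.sub_comp]))⟩

/-- With W the kernel of the covering of Z by X, congruence modulo W is the relation X ⊞ W ⇉ X given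
by (x, w) ↦ x and (x, w) ↦ x + w. Symmetry replaces (x, w) by (x + w, -w), and transitivity adds the
second components. -/
theorem exists_eqRel (Z : AdditiveCompletion R) :
    ∃ S : EqRel R, Nonempty ((forgetCompletion R).obj Z ≅ S.quotient) := by
  have hF := isLocalEmbedding_additiveEmbedding (R := R)
  have : HasFiniteBiproducts R := .of_hasFiniteProducts
  have := hasBinaryBiproducts_of_finite_biproducts R
  obtain ⟨X, K, k, p, w, hex, hp⟩ := Z.property
  obtain ⟨W, i, wi, hi, _⟩ := hF.exists_exact Z.property p
  let p₁ : X ⊞ W ⟶ X := biprod.fst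
  let p₂ : X ⊞ W ⟶ X := biprod.fst + biprod.snd ≫ i
  have hm : JointlyMono₂ p₁ p₂ := ⟨fun Y f g h₁ h₂ => by
    ext
    · exact h₁
    · rw [← cancel_mono i]
      simpa [p₂, Preadditive.comp_add, h₁, p₁, show f ≫ biprod.fst = g ≫ biprod.fst from h₁]
        using h₂⟩
  have hr₂ : biprod.inl ≫ p₂ = 𝟙 X := by simp [p₂, Preadditive.comp_add]
  have hj₂ : biprod.inr ≫ p₂ = i := by simp [p₂, Preadditive.comp_add]
  have ht₂ : biprod.lift (pullback.fst p₂ p₁ ≫ p₁)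
      (pullback.fst p₂ p₁ ≫ biprod.snd + pullback.snd p₂ p₁ ≫ biprod.snd) ≫ p₂ =
      pullback.snd p₂ p₁ ≫ p₂ := by
    have h : pullback.fst p₂ p₁ ≫ p₂ = pullback.snd p₂ p₁ ≫ p₁ := pullback.condition
    simp only [p₂, Preadditive.comp_add, biprod.lift_fst, biprod.lift_snd_assoc,
      Preadditive.add_comp, Category.assoc, ← add_assoc]
    simp only [p₂, Preadditive.comp_add] at h
    rw [h]
  let S : EqRel R := {
    X := X
    E := X ⊞ W
    p₁ := p₁
    p₂ := p₂
    isEquivalenceRelation := ⟨⟨{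
      right_cancellation := hm.right_cancellation
      r := biprod.inl
      reflexivity₁ := biprod.inl_fst
      reflexivity₂ := hr₂
      s := biprod.lift p₂ (-biprod.snd)
      symmetry₁ := biprod.lift_fst _ _
      symmetry₂ := by simp [p₁, p₂, Preadditive.comp_add]
      c := _
      isLimit := pullbackIsPullback p₂ p₁
      t := biprod.lift (pullback.fst p₂ p₁ ≫ p₁)
        (pullback.fst p₂ p₁ ≫ biprod.snd + pullback.snd p₂ p₁ ≫ biprod.snd)
      transitivity₁ := biprod.lift_fst _ _
      transitivity₂ := ht₂ }⟩⟩ }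
  exact ⟨S, nonempty_iso_quotient S p (isPullback_of_exact hi hm biprod.inl biprod.inr biprod.snd
    biprod.inl_fst hr₂ biprod.inr_fst hj₂ (by simp [S, p₁, p₂]))⟩

instance : (inducedFunctor (EqRel.quotient (R := R))).Full := InducedCategory.full _

instance : (inducedFunctor (EqRel.quotient (R := R))).Faithful := InducedCategory.faithful _

variable (R) in
/-- The comparison of the two descriptions of the exact completion. -/
noncomputable def completionComparison : ExactCompletion R ⥤ AdditiveCompletion R :=
  Functor.essImage.liftFunctor (inducedFunctor _) (forgetCompletion R) exists_iso_quotient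

variable (R) in
noncomputable def completionComparisonIso :
    completionComparison R ⋙ forgetCompletion R ≅ inducedFunctor _ :=
  Functor.essImage.liftFunctorCompIso _ _ _

instance : (completionComparison R).IsEquivalence where
  faithful := .of_comp_iso (completionComparisonIso R)
  full := .of_comp_faithful_iso (completionComparisonIso R)
  essSurj := ⟨fun Z => by
    obtain ⟨S, ⟨i⟩⟩ := exists_eqRel Z
    exact ⟨S, ⟨(forgetCompletion R).preimageIso ((completionComparisonIso R).app S ≪≫ i.symm)⟩⟩⟩

variable (R) in
noncomputable def toExactCompletionIso :
    toExactCompletion R ⋙ inducedFunctor _ ≅ toSheaves R :=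
  (NatIso.ofComponents (F := toSheaves R) (G := toExactCompletion R ⋙ inducedFunctor _)
    (fun X => (@asIso _ _ _ _ (coequalizer.π ((toSheaves R).map (𝟙 X)) ((toSheaves R).map (𝟙 X)))
      (coequalizer.π_of_self _)))
    (fun _ => (coequalizer.π_desc _ _).symm)).symm

theorem isEnvelope_additiveCompletion : IsEnvelope ((isQuotient (additiveEmbedding R)).lift
    (additiveEmbedding R) isLocalEmbedding_additiveEmbedding.isQuotient_obj) :=
  isLocalEmbedding_additiveEmbedding.isEnvelope_lift

theorem isEnvelope_toExactCompletion : IsEnvelope (toExactCompletion R) :=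
  isEnvelope_additiveCompletion.of_equivalence (completionComparison R)
    (Functor.fullyFaithfulCancelRight (forgetCompletion R)
      (Functor.isoWhiskerLeft (toExactCompletion R) (completionComparisonIso R) ≪≫
        toExactCompletionIso R ≪≫ toSheavesIso R))

/-- The exact completion of an additive regular category is abelian. -/
@[reducible]
noncomputable def abelianExactCompletion : Abelian (ExactCompletion R) :=
  letI := isLocalEmbedding_additiveEmbedding (R := R).abelian
  letI : Preadditive (ExactCompletion R) :=
    .ofFullyFaithful (Functor.FullyFaithful.ofFullyFaithful (completionComparison R))
  haveI : HasFiniteProducts (ExactCompletion R) := ⟨fun _ =>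
    Adjunction.hasLimitsOfShape_of_equivalence (completionComparison R)⟩
  abelianOfEquivalence (completionComparison R)

end ExactCompletion

end TMotives

namespace TMotives

/-! ## Exact functors on ind-objects -/

section IndExtension

variable {C : Type w} [SmallCategory C]

/-- Density means that the restricted Yoneda functor is fully faithful. For ind-objects it is, up to
isomorphism, the inclusion in presheaves followed by the restricted Yoneda functor of the Yoneda
embedding, and both are fully faithful. -/
instance : (Ind.yoneda (C := C)).IsDense :=
  Functor.IsDense.of_fullyFaithful_restrictedULiftYoneda.{w}
    ((Ind.inclusion.fullyFaithful.comp
      (.ofFullyFaithful (Presheaf.restrictedULiftYoneda.{w} (yoneda (C := C))))).ofIso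
        (Functor.isoWhiskerLeft (Ind.inclusion C ⋙ uliftYoneda.{w})
          ((Functor.whiskeringLeft _ _ (Type w)).mapIso
            (NatIso.op (Ind.yonedaCompInclusion (C := C)))) ≪≫
        Functor.isoWhiskerRight
          (Ind.inclusion.fullyFaithful (C := C)).compUliftYonedaCompWhiskeringLeft
            ((Functor.whiskeringLeft _ _ (Type w)).obj Ind.yoneda.op)))

/-- Every ind-object is the canonical colimit of the representables over it. The indexing category
is filtered, so `F` preserves this colimit, which makes the Kan extension pointwise. -/
theorem isLeftKanExtension_of_preservesFilteredColimits {A : Type u} [Category.{v} A]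
    (F : Ind C ⥤ A) [PreservesFilteredColimitsOfSize.{w, w} F] :
    F.IsLeftKanExtension (𝟙 (Ind.yoneda ⋙ F)) := by
  have h (X : Ind C) :
      (Functor.LeftExtension.mk F (𝟙 (Ind.yoneda ⋙ F))).IsPointwiseLeftKanExtensionAt X := by
    have : IsFiltered (CostructuredArrow (Ind.yoneda (C := C)) X) := inferInstance
    have := isColimitOfPreserves F ((Ind.yoneda (C := C)).denseAt X)
    refine IsColimit.ofIsoColimit this (Cocone.ext (Iso.refl _) ?_)
    intro f
    change F.map (𝟙 _ ≫ f.hom) ≫ 𝟙 _ = 𝟙 _ ≫ F.map f.hom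
    simp
  exact Functor.LeftExtension.IsPointwiseLeftKanExtension.isLeftKanExtension h

/-- Restriction of exact functors preserving filtered colimits along `C ⥤ Ind C`. -/
noncomputable def indRestriction (C : Type w) [SmallCategory C] [HasFiniteLimits C] (A : Type u)
    [Category.{v} A] :
    ExactFinitary.{w} (Ind C) A ⥤ (exactFunctors C A).FullSubcategory :=
  (exactFunctors C A).lift (ObjectProperty.ι _ ⋙ (Functor.whiskeringLeft _ _ A).obj Ind.yoneda)
    fun F => ⟨have : PreservesFiniteLimits F.obj := F.property.1
      have : PreservesFiniteLimits (Ind.yoneda (C := C)) := inferInstance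
      comp_preservesFiniteLimits Ind.yoneda F.obj,
      have : PreservesFiniteColimits F.obj := F.property.2.1
      comp_preservesFiniteColimits Ind.yoneda F.obj⟩

section

variable {A : Type u} [Category.{w} A] [HasColimits A] (F : C ⥤ A)

/-- The extension of `F` to ind-objects. -/
noncomputable def indExtension : Ind C ⥤ A :=
  Ind.inclusion C ⋙ (uliftYoneda.{w} (C := C)).leftKanExtension F

noncomputable def yonedaIndExtension : Ind.yoneda ⋙ indExtension F ≅ F :=
  Functor.isoWhiskerRight (Ind.yonedaCompInclusion ≪≫ uliftYonedaIsoYoneda.symm)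
    ((uliftYoneda.{w} (C := C)).leftKanExtension F) ≪≫
      (asIso ((uliftYoneda.{w} (C := C)).leftKanExtensionUnit F)).symm

instance : PreservesFilteredColimitsOfSize.{w, w} (indExtension F) where
  preserves_filtered_colimits J _ _ := by
    have : PreservesColimitsOfSize.{w, w} ((uliftYoneda.{w} (C := C)).leftKanExtension F) :=
      inferInstance
    unfold indExtension
    infer_instance

/-- On the formal colimit of a diagram in C, the extension is the colimit in A of the values of F.
Exactness questions thereby reduce to exactness of F and of filtered colimits in A. -/
noncomputable def limIndExtension (I : Type w) [SmallCategory I] [IsFiltered I] :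
    Ind.lim I ⋙ indExtension F ≅ (Functor.whiskeringRight I C A).obj F ⋙ colim :=
  Functor.isoWhiskerLeft ((Functor.whiskeringRight _ _ _).obj Ind.yoneda)
      (preservesColimitNatIso (indExtension F)) ≪≫
    Functor.isoWhiskerRight ((Functor.whiskeringRight I C A).mapIso (yonedaIndExtension F)) colim

end

section

variable [Abelian C] {A : Type u} [Category.{w} A] [Abelian A] [IsGrothendieckAbelian.{w} A]
  {F : C ⥤ A} (hF : exactFunctors C A F)
include hF

theorem preservesFiniteLimits_lim_indExtension (I : Type w) [SmallCategory I] [IsFiltered I] :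
    PreservesFiniteLimits (Ind.lim I ⋙ indExtension F) := by
  have := hF.1
  have : PreservesFiniteLimits (colim : (I ⥤ A) ⥤ A) := inferInstance
  have : PreservesFiniteLimits ((Functor.whiskeringRight I C A).obj F) := ⟨fun _ => inferInstance⟩
  exact preservesFiniteLimits_of_natIso (limIndExtension F I).symm

theorem preservesFiniteColimits_lim_indExtension (I : Type w) [SmallCategory I] [IsFiltered I] :
    PreservesFiniteColimits (Ind.lim I ⋙ indExtension F) := by
  have := hF.2
  have : PreservesFiniteColimits ((Functor.whiskeringRight I C A).obj F) := ⟨fun _ => inferInstance⟩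
  exact preservesFiniteColimits_of_natIso (limIndExtension F I).symm

/-- A parallel pair of ind-objects is the formal colimit of a diagram of parallel pairs of C over a
single filtered category; equalizers are then computed levelwise. -/
theorem preservesLimit_parallelPair_indExtension {X Y : Ind C} (f g : X ⟶ Y) :
    PreservesLimit (parallelPair f g) (indExtension F) := by
  obtain ⟨P⟩ := nonempty_indParallelPairPresentation X.isIndObject_inclusion_obj
      Y.isIndObject_inclusion_obj ((Ind.inclusion C).map f)
    ((Ind.inclusion C).map g)
  have := preservesFiniteLimits_lim_indExtension hF P.I
  have : PreservesLimit (parallelPair P.φ P.ψ ⋙ Ind.lim P.I) (indExtension F) :=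
    preservesLimit_of_preserves_limit_cone
      (isLimitOfPreserves (Ind.lim P.I) (limit.isLimit (parallelPair P.φ P.ψ)))
      (isLimitOfPreserves (Ind.lim P.I ⋙ indExtension F) (limit.isLimit (parallelPair P.φ P.ψ)))
  exact preservesLimit_of_iso_diagram _ P.parallelPairIsoParallelPairCompIndYoneda.symm

theorem preservesColimit_parallelPair_indExtension {X Y : Ind C} (f g : X ⟶ Y) :
    PreservesColimit (parallelPair f g) (indExtension F) := by
  obtain ⟨P⟩ := nonempty_indParallelPairPresentation X.isIndObject_inclusion_obj
      Y.isIndObject_inclusion_obj ((Ind.inclusion C).map f)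
    ((Ind.inclusion C).map g)
  have := preservesFiniteColimits_lim_indExtension hF P.I
  have : PreservesColimit (parallelPair P.φ P.ψ ⋙ Ind.lim P.I) (indExtension F) :=
    preservesColimit_of_preserves_colimit_cocone
      (isColimitOfPreserves (Ind.lim P.I) (colimit.isColimit (parallelPair P.φ P.ψ)))
      (isColimitOfPreserves (Ind.lim P.I ⋙ indExtension F)
        (colimit.isColimit (parallelPair P.φ P.ψ)))
  exact preservesColimit_of_iso_diagram _ P.parallelPairIsoParallelPairCompIndYoneda.symm

omit [Abelian C] hF in
-- Presenting `f` and `g` over the same index category makes their sum levelwise; this is what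
-- additivity of the extension needs.
theorem exists_lim_map_eq {X Y : Ind C} (f g : X ⟶ Y) :
    ∃ (I : Type w) (_ : SmallCategory I) (_ : IsFiltered I) (F₁ F₂ : I ⥤ C) (φ ψ : F₁ ⟶ F₂)
      (a : X ⟶ (Ind.lim I).obj F₁) (b : (Ind.lim I).obj F₂ ⟶ Y),
      f = a ≫ (Ind.lim I).map φ ≫ b ∧ g = a ≫ (Ind.lim I).map ψ ≫ b := by
  obtain ⟨P⟩ := nonempty_indParallelPairPresentation X.isIndObject_inclusion_obj
    Y.isIndObject_inclusion_obj ((Ind.inclusion C).map f) ((Ind.inclusion C).map g)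
  let i := P.parallelPairIsoParallelPairCompIndYoneda
  exact ⟨P.I, inferInstance, inferInstance, P.F₁, P.F₂, P.φ, P.ψ, i.hom.app .zero, i.inv.app .one,
    (NatIso.naturality_2 i .left).symm, (NatIso.naturality_2 i .right).symm⟩

theorem additive_indExtension : (indExtension F).Additive where
  map_add {X Y f g} := by
    obtain ⟨I, _, _, F₁, F₂, φ, ψ, a, b, rfl, rfl⟩ := exists_lim_map_eq f g
    have := preservesFiniteLimits_lim_indExtension hF I
    have : PreservesFiniteLimits (Ind.lim (C := C) I) := ⟨fun _ _ _ => inferInstance⟩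
    have := additive_of_preservesFiniteLimits (Ind.lim (C := C) I)
    have := additive_of_preservesFiniteLimits (Ind.lim (C := C) I ⋙ indExtension F)
    have h : (indExtension F).map ((Ind.lim (C := C) I).map (φ + ψ)) =
        (indExtension F).map ((Ind.lim I).map φ) + (indExtension F).map ((Ind.lim I).map ψ) :=
      (Ind.lim (C := C) I ⋙ indExtension F).map_add (f := φ) (g := ψ)
    rw [← Preadditive.comp_add, ← Preadditive.add_comp, ← Functor.map_add]
    simp only [Functor.map_comp, h, Preadditive.comp_add, Preadditive.add_comp]

theorem isExactFinitary_indExtension : isExactFinitary.{w} (Ind C) A (indExtension F) := by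
  have := additive_indExtension hF
  refine ⟨?_, ?_, inferInstance⟩
  · have : ∀ {X Y : Ind C} (f : X ⟶ Y), PreservesLimit (parallelPair f 0) (indExtension F) :=
      fun f => preservesLimit_parallelPair_indExtension hF f 0
    exact (indExtension F).preservesFiniteLimits_of_preservesKernels
  · have : ∀ {X Y : Ind C} (f : X ⟶ Y), PreservesColimit (parallelPair f 0) (indExtension F) :=
      fun f => preservesColimit_parallelPair_indExtension hF f 0
    exact (indExtension F).preservesFiniteColimits_of_preservesCokernels

end

/-- Full faithfulness is the universal property of the Kan extension of the source functor;
essential surjectivity is the exactness of `indExtension`. -/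
instance isEquivalence_indRestriction [Abelian C] (A : Type u) [Category.{v} A] [Abelian A]
    [IsGrothendieckAbelian.{w} A] : (indRestriction C A).IsEquivalence where
  faithful := ⟨fun {F G σ τ} h => by
    apply ObjectProperty.hom_ext
    have := F.property.2.2
    have := isLeftKanExtension_of_preservesFilteredColimits F.obj
    exact F.obj.hom_ext_of_isLeftKanExtension (𝟙 _) _ _
      (by
        rw [Category.id_comp, Category.id_comp]
        exact congrArg (fun t => t.hom) h)⟩
  full := ⟨fun {F G} τ => by
    have := F.property.2.2
    have := isLeftKanExtension_of_preservesFilteredColimits F.obj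
    exact ⟨ObjectProperty.homMk (F.obj.descOfIsLeftKanExtension (𝟙 _) _ τ.hom),
      ObjectProperty.hom_ext _ ((Category.id_comp _).symm.trans
        (F.obj.descOfIsLeftKanExtension_fac (𝟙 _) _ τ.hom))⟩⟩
  essSurj := ⟨fun F => by
    -- `indExtension` needs morphisms in the universe `w` of C. A Grothendieck abelian category is
    -- locally `w`-small, so it may be replaced by an equivalent category of this kind.
    let e := ShrinkHoms.equivalence.{w} A
    have hF : exactFunctors C (ShrinkHoms.{u} A) (F.obj ⋙ e.functor) :=
      ⟨have := F.property.1; comp_preservesFiniteLimits _ _,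
        have := F.property.2; comp_preservesFiniteColimits _ _⟩
    obtain ⟨h₁, h₂, h₃⟩ := isExactFinitary_indExtension hF
    exact ⟨⟨indExtension (F.obj ⋙ e.functor) ⋙ e.inverse, comp_preservesFiniteLimits _ _,
      comp_preservesFiniteColimits _ _, inferInstance⟩,
      ⟨(exactFunctors C A).isoMk
        (Functor.isoWhiskerRight (yonedaIndExtension (F.obj ⋙ e.functor)) e.inverse ≪≫
          Functor.isoWhiskerLeft F.obj e.unitIso.symm ≪≫ F.obj.rightUnitor)⟩⟩⟩

end IndExtension

end TMotives

namespace TMotives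

/-! ## Generalized elements of models -/

/-! ### Factorization through subobjects is local for epimorphisms. -/

section Factors

variable {A : Type u} [Category.{v} A] [Abelian A]

theorem factors_of_epi {X Y Z : A} (e : Y ⟶ X) [Epi e] {P : Subobject Z} {g : X ⟶ Z}
    (h : P.Factors (e ≫ g)) : P.Factors g := by
  have : StrongEpi e := strongEpi_of_epi e
  have sq : CommSq (P.factorThru _ h) e P.arrow g := ⟨P.factorThru_arrow _ h⟩
  rw [← sq.fac_right]
  exact Subobject.factors_comp_arrow _

theorem exists_epi_comp_arrow {X Y : A} (f : X ⟶ Y) (P : Subobject X) :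
    ∃ e : (P : A) ⟶ ((Subobject.exists f).obj P : Subobject Y), Epi e ∧
      e ≫ ((Subobject.exists f).obj P).arrow = P.arrow ≫ f := by
  let F := Subobject.imageFactorisation f P
  refine ⟨F.F.e, ?_, F.F.fac⟩
  rw [← IsImage.e_isoExt_hom (Image.isImage (P.arrow ≫ f)) F.isImage]
  exact epi_comp' (inferInstanceAs (Epi (factorThruImage (P.arrow ≫ f))))
    (inferInstanceAs (Epi (IsImage.isoExt (Image.isImage (P.arrow ≫ f)) F.isImage).hom))

/-- The Kripke–Joyal clause for ∃: an element of an image comes from an element of the source after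
passing to an epimorphic cover, here the pullback along the projection onto the image. -/
theorem exists_factors_iff {X Y W : A} (f : X ⟶ Y) (P : Subobject X) (g : W ⟶ Y) :
    ((Subobject.exists f).obj P).Factors g ↔
      ∃ (V : A) (e : V ⟶ W) (a : V ⟶ X), Epi e ∧ P.Factors a ∧ a ≫ f = e ≫ g := by
  obtain ⟨e₀, he₀, h₀⟩ := exists_epi_comp_arrow f P
  constructor
  · intro h
    refine ⟨pullback (Subobject.factorThru _ g h) e₀, pullback.fst _ _,
      pullback.snd _ _ ≫ P.arrow, inferInstance,
      Subobject.factors_of_factors_right _ (Subobject.factors_self P), ?_⟩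
    rw [Category.assoc, ← h₀, ← Category.assoc, ← pullback.condition, Category.assoc,
      Subobject.factorThru_arrow]
  · rintro ⟨V, e, a, he, ha, h⟩
    refine factors_of_epi e ?_
    rw [← h, ← P.factorThru_arrow a ha, Category.assoc, ← h₀, ← Category.assoc]
    exact Subobject.factors_comp_arrow _

end Factors

/-- Valuations of the variables of `Γ` in `M`, with the stage of definition `X`. -/
abbrev Val {S : Type w} {A : Type u} [Category.{v} A] (M : S → A) (Γ : List S) (X : A) :
    Type (max w v) :=
  ∀ s, Var Γ s → (X ⟶ M s)

/-! ### Calculus of valuations. -/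

namespace Val

variable {S : Type w} {A : Type u} [Category.{v} A] {M : S → A} {Γ Δ : List S} {X Y : A}

/-- Restriction of a valuation along a morphism of stages. -/
def res (e : Y ⟶ X) (v : Val M Γ X) : Val M Γ Y := fun s x => e ≫ v s x

def cons {s : S} (a : X ⟶ M s) (v : Val M Γ X) : Val M (s :: Γ) X
  | _, .zero => a
  | _, .succ x => v _ x

def tail {s : S} (v : Val M (s :: Γ) X) : Val M Γ X := fun _ x => v _ x.succ

def append : ∀ {Δ Γ : List S}, Val M Δ X → Val M Γ X → Val M (Δ ++ Γ) X
  | [], _, _, b => b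
  | _ :: _, _, a, b => cons (a _ .zero) (append a.tail b)

theorem cons_eta {s : S} (v : Val M (s :: Γ) X) : cons (v _ .zero) v.tail = v := by
  funext r x; cases x <;> rfl

theorem eq_nil (v v' : Val M [] X) : v = v' := by
  funext s x; cases x

theorem res_cons {s : S} (e : Y ⟶ X) (a : X ⟶ M s) (v : Val M Γ X) :
    (cons a v).res e = cons (e ≫ a) (v.res e) := by
  funext r x; cases x <;> rfl

theorem res_append (e : Y ⟶ X) (a : Val M Δ X) (b : Val M Γ X) :
    (append a b).res e = append (a.res e) (b.res e) := by
  induction Δ with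
  | nil => rfl
  | cons s Δ ih => exact (res_cons _ _ _).trans (congrArg (cons _) (ih a.tail))

theorem res_id (v : Val M Γ X) : v.res (𝟙 X) = v := by
  funext s x; exact Category.id_comp _

theorem res_res {Z : A} (g : Z ⟶ Y) (e : Y ⟶ X) (v : Val M Γ X) :
    (v.res e).res g = v.res (g ≫ e) := by
  funext s x; exact (Category.assoc _ _ _).symm

/-- The image of a valuation under a family of morphisms. -/
def push {N : S → A} (h : ∀ s, M s ⟶ N s) (v : Val M Γ X) : Val N Γ X := fun s x => v s x ≫ h s

theorem push_cons {N : S → A} (h : ∀ s, M s ⟶ N s) {s : S} (a : X ⟶ M s) (v : Val M Γ X) :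
    (cons a v).push h = cons (a ≫ h s) (v.push h) := by
  funext r x; cases x <;> rfl

theorem push_append {N : S → A} (h : ∀ s, M s ⟶ N s) (a : Val M Δ X) (b : Val M Γ X) :
    (append a b).push h = append (a.push h) (b.push h) := by
  induction Δ with
  | nil => rfl
  | cons s Δ ih => exact (push_cons _ _ _).trans (congrArg (cons _) (ih a.tail))

theorem push_res {N : S → A} (h : ∀ s, M s ⟶ N s) (e : Y ⟶ X) (v : Val M Γ X) :
    (v.res e).push h = (v.push h).res e := by
  funext s x; exact Category.assoc _ _ _

end Val

section Ctx

variable {S : Type w} {A : Type u} [Category.{v} A] [HasFiniteProducts A] {M : S → A}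
  {Γ : List S} {X : A}

theorem ctxLift_comp_proj (p : X ⟶ ctxObj M Γ) : ctxLift (fun _ x => p ≫ ctxProj x) = p := by
  rw [← Str.comp_ctxLift, Str.ctxLift_ctxProj, Category.comp_id]

theorem ctxLift_injective {v v' : Val M Γ X} (h : ctxLift v = ctxLift v') : v = v' := by
  funext s x
  rw [← Str.ctxLift_proj v, h, Str.ctxLift_proj]

theorem ctxLift_res {Y : A} (e : Y ⟶ X) (v : Val M Γ X) : ctxLift (v.res e) = e ≫ ctxLift v :=
  (Str.comp_ctxLift e v).symm

end Ctx

/-! ### Evaluation of terms and satisfaction of formulas at generalized elements. -/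

namespace Str

variable {L : Sig.{w}} {A : Type u} [Category.{v} A]

section

variable [HasFiniteProducts A] (M : Str L A) {Γ Δ Θ : List L.Sorts} {X Y : A}

/-- The value of a term. -/
noncomputable def eval (v : Val M.obj Γ X) {s : L.Sorts} (t : Term L Γ s) : X ⟶ M.obj s :=
  ctxLift v ≫ M.term t

theorem eval_var (v : Val M.obj Γ X) {s : L.Sorts} (x : Var Γ s) : M.eval v (.var x) = v s x :=
  ctxLift_proj _ _

theorem eval_app (v : Val M.obj Γ X) {s : L.Sorts} (f : L.Ops Δ s)
    (a : ∀ t, Var Δ t → Term L Γ t) :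
    M.eval v (.app f a) = ctxLift (fun t x => M.eval v (a t x)) ≫ M.op f := by
  change ctxLift v ≫ ctxLift _ ≫ M.op f = _
  rw [← Category.assoc, comp_ctxLift]
  rfl

theorem eval_res (e : Y ⟶ X) (v : Val M.obj Γ X) {s : L.Sorts} (t : Term L Γ s) :
    M.eval (v.res e) t = e ≫ M.eval v t := by
  rw [eval, ctxLift_res, Category.assoc]; rfl

/-- The value of a string of terms. -/
noncomputable def evals (σ : Subst L Γ Δ) (v : Val M.obj Δ X) : Val M.obj Γ X :=
  fun s x => M.eval v (σ s x)

theorem eval_subst (σ : Subst L Γ Δ) (v : Val M.obj Δ X) {s : L.Sorts} (t : Term L Γ s) :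
    M.eval v (t.subst σ) = M.eval (M.evals σ v) t := by
  induction t with
  | var x => exact (M.eval_var (M.evals σ v) x).symm
  | app f a ih =>
    simp only [Term.subst, eval_app, ih]

theorem evals_comp (σ : Subst L Γ Δ) (τ : Subst L Δ Θ) (v : Val M.obj Θ X) :
    M.evals (σ.comp τ) v = M.evals σ (M.evals τ v) := by
  funext s x; exact M.eval_subst _ _ _

theorem evals_id (v : Val M.obj Γ X) : M.evals (.id Γ) v = v := by
  funext s x; exact M.eval_var _ _

theorem evals_wk {s : L.Sorts} (v : Val M.obj (s :: Γ) X) : M.evals (.wk Γ s) v = v.tail := by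
  funext s x; exact M.eval_var _ _

theorem evals_cons {s : L.Sorts} (t : Term L Δ s) (σ : Subst L Γ Δ) (v : Val M.obj Δ X) :
    M.evals (.cons t σ) v = .cons (M.eval v t) (M.evals σ v) := by
  funext r x; cases x <;> rfl

theorem evals_up {s : L.Sorts} (σ : Subst L Γ Δ) (a : X ⟶ M.obj s) (v : Val M.obj Δ X) :
    M.evals (σ.up s) (.cons a v) = .cons a (M.evals σ v) := by
  rw [Subst.up, evals_cons, eval_var, evals_comp, evals_wk]; rfl

theorem evals_append (σ : Subst L Δ Θ) (τ : Subst L Γ Θ) (v : Val M.obj Θ X) :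
    M.evals (.append σ τ) v = .append (M.evals σ v) (M.evals τ v) := by
  induction Δ with
  | nil => rfl
  | cons s Δ ih => exact (M.evals_cons _ _ _).trans (congrArg (Val.cons _) (ih _))

theorem evals_inl (a : Val M.obj Δ X) (b : Val M.obj Γ X) :
    M.evals (.inl Δ Γ) (.append a b) = a := by
  induction Δ with
  | nil => exact Val.eq_nil _ _
  | cons s Δ ih =>
    funext r x
    cases x with
    | zero => exact M.eval_var _ _
    | succ x =>
      refine Eq.trans ?_ (congrFun (congrFun (ih a.tail) r) x)
      exact (M.eval_var _ _).trans (M.eval_var (.append a.tail b) _).symm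

theorem evals_inr (a : Val M.obj Δ X) (b : Val M.obj Γ X) :
    M.evals (.inr Δ Γ) (.append a b) = b := by
  induction Δ with
  | nil => exact M.evals_id _
  | cons s Δ ih =>
    refine Eq.trans ?_ (ih a.tail)
    funext r x
    exact (M.eval_var _ _).trans (M.eval_var (.append a.tail b) _).symm

theorem append_evals (v : Val M.obj (Δ ++ Γ) X) :
    Val.append (M.evals (.inl Δ Γ) v) (M.evals (.inr Δ Γ) v) = v := by
  rw [← evals_append, Subst.append_inl_inr, evals_id]

theorem evals_res (e : Y ⟶ X) (σ : Subst L Γ Δ) (v : Val M.obj Δ X) :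
    M.evals σ (v.res e) = (M.evals σ v).res e := by
  funext s x; exact M.eval_res _ _ _

theorem eval_push {N : Str L A} (h : M ⟶ N) (v : Val M.obj Γ X) {s : L.Sorts}
    (t : Term L Γ s) : N.eval (v.push h.app) t = M.eval v t ≫ h.app s := by
  induction t with
  | var x => rw [eval_var, eval_var]; rfl
  | app f a ih =>
    rw [eval_app, eval_app, Category.assoc, h.comm, ← Category.assoc, comp_ctxLift]
    simp only [← Category.assoc, ctxLift_proj, ih]

end

section

variable [Abelian A] (M : Str L A) {Γ Δ : List L.Sorts} {X Y : A}

/-- Satisfaction of a formula by a valuation. -/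
def Sat (φ : Formula L Γ) (v : Val M.obj Γ X) : Prop := (M.formula φ).Factors (ctxLift v)

variable {M}

theorem Sat.res {φ : Formula L Γ} {v : Val M.obj Γ X} (h : M.Sat φ v) (e : Y ⟶ X) :
    M.Sat φ (v.res e) := by
  rw [Sat, ctxLift_res]
  exact Subobject.factors_of_factors_right e h

theorem sat_of_epi {φ : Formula L Γ} {v : Val M.obj Γ X} (e : Y ⟶ X) [Epi e]
    (h : M.Sat φ (v.res e)) : M.Sat φ v := by
  rw [Sat, ctxLift_res] at h
  exact factors_of_epi e h

theorem sat_top (v : Val M.obj Γ X) : M.Sat .top v := Subobject.top_factors _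

theorem sat_eq {s : L.Sorts} {t t' : Term L Γ s} {v : Val M.obj Γ X} :
    M.Sat (.eq t t') v ↔ M.eval v t = M.eval v t' :=
  equalizerSubobject_factors_iff _ _ _

theorem sat_and {φ ψ : Formula L Γ} {v : Val M.obj Γ X} :
    M.Sat (.and φ ψ) v ↔ M.Sat φ v ∧ M.Sat ψ v :=
  Subobject.inf_factors _

theorem sat_ex {s : L.Sorts} {φ : Formula L (s :: Γ)} {v : Val M.obj Γ X} :
    M.Sat (.ex s φ) v ↔ ∃ (Y : A) (e : Y ⟶ X) (a : Y ⟶ M.obj s), Epi e ∧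
      M.Sat φ (.cons a (v.res e)) := by
  refine (exists_factors_iff _ _ _).trans ⟨?_, ?_⟩
  · rintro ⟨Y, e, a, he, h, h'⟩
    refine ⟨Y, e, a ≫ prod.fst, he, ?_⟩
    have : a = ctxLift (Val.cons (a ≫ prod.fst) (v.res e)) := by
      change a = prod.lift _ (ctxLift (v.res e))
      rw [ctxLift_res, ← h']
      exact Limits.prod.hom_ext (prod.lift_fst _ _).symm (prod.lift_snd _ _).symm
    rwa [Sat, ← this]
  · rintro ⟨Y, e, a, he, h⟩
    refine ⟨Y, e, _, he, h, ?_⟩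
    rw [← ctxLift_res]
    exact prod.lift_snd _ _

theorem sat_subst {σ : Subst L Γ Δ} {φ : Formula L Γ} {v : Val M.obj Δ X} :
    M.Sat (φ.subst σ) v ↔ M.Sat φ (M.evals σ v) := by
  induction φ generalizing Δ X with
  | top => exact iff_of_true (sat_top _) (sat_top _)
  | eq t t' => simp only [Formula.subst, sat_eq, eval_subst]
  | and φ ψ ih1 ih2 => simp only [Formula.subst, sat_and, ih1, ih2]
  | ex s φ ih => simp only [Formula.subst, sat_ex, ih, evals_up, evals_res]

theorem sat_exs {φ : Formula L (Δ ++ Γ)} {v : Val M.obj Γ X} :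
    M.Sat (.exs Δ φ) v ↔ ∃ (Y : A) (e : Y ⟶ X) (a : Val M.obj Δ Y), Epi e ∧
      M.Sat φ (.append a (v.res e)) := by
  induction Δ with
  | nil =>
    refine ⟨fun h => ⟨X, 𝟙 X, (fun _ x => nomatch x), inferInstance, h.res _⟩, ?_⟩
    rintro ⟨Y, e, a, he, h⟩
    exact sat_of_epi e h
  | cons s Δ ih =>
    refine ih.trans ⟨?_, ?_⟩
    · rintro ⟨Y, e, a, he, h⟩
      obtain ⟨Z, g, b, hg, h⟩ := sat_ex.1 h
      refine ⟨Z, g ≫ e, .cons b (a.res g), epi_comp _ _, ?_⟩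
      rw [Val.res_append, Val.res_res] at h
      exact h
    · rintro ⟨Y, e, a, he, h⟩
      refine ⟨Y, e, a.tail, he, sat_ex.2 ⟨Y, 𝟙 Y, a _ .zero, inferInstance, ?_⟩⟩
      rw [Val.res_id]
      exact h

theorem sat_eqs {σ τ : Subst L Γ Δ} {v : Val M.obj Δ X} :
    M.Sat (.eqs σ τ) v ↔ M.evals σ v = M.evals τ v := by
  induction Γ with
  | nil => exact iff_of_true (sat_top _) (Val.eq_nil _ _)
  | cons s Γ ih =>
    simp only [Formula.eqs, sat_and, sat_eq, ih]
    refine ⟨fun h => ?_, fun h => ⟨congrFun (congrFun h _) _, congrArg Val.tail h⟩⟩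
    rw [← Val.cons_eta (M.evals σ v), ← Val.cons_eta (M.evals τ v)]
    exact congrArg₂ Val.cons h.1 h.2

/-- It suffices to test the generic valuation, the one given by the inclusion of the interpretation
of φ. -/
theorem formula_le_iff {φ ψ : Formula L Γ} :
    M.formula φ ≤ M.formula ψ ↔ ∀ (X : A) (v : Val M.obj Γ X), M.Sat φ v → M.Sat ψ v := by
  refine ⟨fun h X v => Subobject.factors_of_le _ h, fun h => Subobject.le_of_factors ?_⟩
  have := h _ (fun _ x => (M.formula φ).arrow ≫ ctxProj x)
  simp only [Sat, ctxLift_comp_proj] at this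
  exact this (Subobject.factors_self _)

/-- Regular formulas are positive, so homomorphisms of structures preserve them; witnesses of ∃ are
pushed forward too. This is how a morphism of models acts on every object of `Syn T`. -/
theorem Sat.push {N : Str L A} (h : M ⟶ N) {φ : Formula L Γ} {v : Val M.obj Γ X}
    (k : M.Sat φ v) : N.Sat φ (v.push h.app) := by
  induction φ generalizing X with
  | top => exact sat_top _
  | eq t t' => rw [sat_eq, eval_push, eval_push, sat_eq.1 k]
  | and φ ψ ih1 ih2 => exact sat_and.2 ⟨ih1 (sat_and.1 k).1, ih2 (sat_and.1 k).2⟩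
  | ex s φ ih =>
    obtain ⟨Y, e, a, he, k⟩ := sat_ex.1 k
    refine sat_ex.2 ⟨Y, e, a ≫ h.app s, he, ?_⟩
    rw [← Val.push_res, ← Val.push_cons]
    exact ih k

end

end Str

/-! ### Soundness -/

theorem Str.Sat.of_provable {T : RegularTheory.{w}} {A : Type u} [Category.{v} A] [Abelian A]
    {M : Str T.sig A} (hM : isModel T A M) {Γ : List T.sig.Sorts} {φ ψ : Formula T.sig Γ}
    (h : Provable T φ ψ) {X : A} {v : Val M.obj Γ X} (k : M.Sat φ v) : M.Sat ψ v := by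
  induction h generalizing X with
  | ax h => exact formula_le_iff.1 (hM _ _ h) _ _ k
  | refl => exact k
  | cut _ _ ih1 ih2 => exact ih2 (ih1 k)
  | subst σ _ ih => exact sat_subst.2 (ih (sat_subst.1 k))
  | eq_refl t => exact sat_eq.2 rfl
  | eq_subst φ σ τ =>
    have k := sat_and.1 k
    rw [sat_subst, ← sat_eqs.1 k.1]
    exact sat_subst.1 k.2
  | top_intro => exact sat_top _
  | and_left => exact (sat_and.1 k).1
  | and_right => exact (sat_and.1 k).2
  | and_intro _ _ ih1 ih2 => exact sat_and.2 ⟨ih1 k, ih2 k⟩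
  | ex_intro _ ih =>
    rw [sat_subst, evals_wk]
    refine ih (sat_ex.2 ⟨X, 𝟙 X, v _ .zero, inferInstance, ?_⟩)
    rw [Val.res_id, Val.cons_eta]
    exact k
  | ex_elim _ ih =>
    obtain ⟨Y, e, a, he, k⟩ := sat_ex.1 k
    have := sat_subst.1 (ih k)
    rw [evals_wk] at this
    exact sat_of_epi e this
  | frobenius φ ψ =>
    obtain ⟨k1, k2⟩ := sat_and.1 k
    obtain ⟨Y, e, a, he, k2⟩ := sat_ex.1 k2
    refine sat_ex.2 ⟨Y, e, a, he, sat_and.2 ⟨sat_subst.2 ?_, k2⟩⟩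
    rw [evals_wk]
    exact k1.res e

end TMotives

namespace TMotives

/-! ## The functor given by a model -/

namespace Str

variable {T : RegularTheory.{w}} {A : Type u} [Category.{v} A] [Abelian A] {M : Str T.sig A}
  (hM : isModel T A M) {X Y Z : Syn T} {V W : A}

/-- `Graph M f y x`: the values `x` and `y` satisfy `f x = y`. -/
def Graph (M : Str T.sig A) (f : X ⟶ Y) (y : Val M.obj Y.ctx W) (x : Val M.obj X.ctx W) : Prop :=
  M.Sat (Quotient.out (s := FunctionalFormula.setoid X Y) f).graph (.append y x)

theorem Graph.res {f : X ⟶ Y} {y : Val M.obj Y.ctx W} {x : Val M.obj X.ctx W}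
    (h : Graph M f y x) (e : V ⟶ W) : Graph M f (y.res e) (x.res e) := by
  rw [Graph, ← Val.res_append]
  exact Sat.res h e

theorem graph_of_epi {f : X ⟶ Y} {y : Val M.obj Y.ctx W} {x : Val M.obj X.ctx W}
    (e : V ⟶ W) [Epi e] (h : Graph M f (y.res e) (x.res e)) : Graph M f y x := by
  rw [Graph, ← Val.res_append] at h
  exact sat_of_epi e h

section

include hM

theorem graph_homMk {θ : FunctionalFormula X Y} {y : Val M.obj Y.ctx W}
    {x : Val M.obj X.ctx W} : Graph M (Syn.homMk θ) y x ↔ M.Sat θ.graph (.append y x) := by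
  have h : Provable T _ _ ∧ Provable T _ _ :=
    Quotient.mk_out (s := FunctionalFormula.setoid X Y) θ
  exact ⟨fun k => k.of_provable hM h.1, fun k => k.of_provable hM h.2⟩

variable {f : X ⟶ Y} {g : Y ⟶ Z} {y y' : Val M.obj Y.ctx W} {x : Val M.obj X.ctx W}

theorem Graph.dom (h : Graph M f y x) : M.Sat X.formula x := by
  have := sat_subst.1
    (Sat.of_provable hM (Quotient.out (s := FunctionalFormula.setoid X Y) f).dom h)
  rwa [evals_inr] at this

theorem Graph.cod (h : Graph M f y x) : M.Sat Y.formula y := by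
  have := sat_subst.1
    (Sat.of_provable hM (Quotient.out (s := FunctionalFormula.setoid X Y) f).cod h)
  rwa [evals_inl] at this

theorem Graph.unique (h : Graph M f y x) (h' : Graph M f y' x) : y = y' := by
  have := Sat.of_provable hM (Quotient.out (s := FunctionalFormula.setoid X Y) f).unique
    (v := .append y (.append y' x)) (by
      simp only [sat_and, sat_subst, evals_append, evals_comp, evals_inl, evals_inr]
      exact ⟨h, h'⟩)
  simpa only [sat_eqs, evals_comp, evals_inl, evals_inr] using this

theorem graph_total (f : X ⟶ Y) (h : M.Sat X.formula x) :
    ∃ (V : A) (e : V ⟶ W) (y : Val M.obj Y.ctx V), Epi e ∧ Graph M f y (x.res e) :=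
  sat_exs.1 (h.of_provable hM (Quotient.out (s := FunctionalFormula.setoid X Y) f).total)

theorem Graph.comp {z : Val M.obj Z.ctx W} (h : Graph M f y x) (h' : Graph M g z y) :
    Graph M (f ≫ g) z x := by
  obtain ⟨θ, rfl⟩ := Syn.homMk_surjective f
  obtain ⟨η, rfl⟩ := Syn.homMk_surjective g
  refine (graph_homMk hM (θ := θ.comp η)).2 (sat_exs.2 ⟨W, 𝟙 W, y, inferInstance, ?_⟩)
  simp only [Val.res_id, sat_and, sat_subst, evals_append, evals_comp, evals_inl, evals_inr]
  exact ⟨(graph_homMk hM).1 h, (graph_homMk hM).1 h'⟩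

theorem graph_ofTerms {t : Subst T.sig Y.ctx X.ctx}
    {ht : Provable T X.formula (Y.formula.subst t)} :
    Graph M (Syn.ofTerms t ht) y x ↔ M.Sat X.formula x ∧ M.evals t x = y := by
  refine (graph_homMk hM).trans ?_
  simp only [FunctionalFormula.ofTerms, sat_and, sat_subst, sat_eqs, evals_comp, evals_inl,
    evals_inr]

/-- Totality yields a value only after an epimorphism `e`. By uniqueness the value descends, so the
functional formula has a value at the original stage. -/
theorem exists_graph (f : X ⟶ Y) (h : M.Sat X.formula x) :
    ∃ y : Val M.obj Y.ctx W, Graph M f y x := by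
  obtain ⟨V, e, y, he, hy⟩ := graph_total hM f h
  -- Restriction along `kernel.ι e` and along 0 yields two values at the same argument, since both
  -- composites with `e` vanish; uniqueness equates them.
  have key : ∀ s i, kernel.ι e ≫ y s i = 0 := by
    have h1 := hy.res (kernel.ι e)
    have h2 := hy.res (0 : kernel e ⟶ V)
    rw [Val.res_res, kernel.condition] at h1
    rw [Val.res_res, zero_comp] at h2
    intro s i
    exact (congrFun (congrFun (h1.unique hM h2) s) i).trans zero_comp
  refine ⟨fun s i => Abelian.epiDesc e (y s i) (key s i), graph_of_epi e ?_⟩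
  convert hy
  funext s i
  exact Abelian.comp_epiDesc _ _ _

end

/-- The interpretation of an object of the syntactic category. -/
noncomputable abbrev ext (M : Str T.sig A) (X : Syn T) : A := (M.formula X.formula : Subobject _)

/-- The valuation that corresponds to a generalized element of the interpretation of `X`. -/
noncomputable def coords (p : W ⟶ M.ext X) : Val M.obj X.ctx W :=
  fun _ x => p ≫ (M.formula X.formula).arrow ≫ ctxProj x

theorem ctxLift_coords (p : W ⟶ M.ext X) :
    ctxLift (coords p) = p ≫ (M.formula X.formula).arrow := by
  rw [← ctxLift_comp_proj (p ≫ (M.formula X.formula).arrow)]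
  exact congrArg ctxLift (by funext s x; exact (Category.assoc _ _ _).symm)

theorem coords_injective {p q : W ⟶ M.ext X} (h : coords p = coords q) : p = q := by
  have := congrArg ctxLift h
  rwa [ctxLift_coords, ctxLift_coords, cancel_mono] at this

theorem coords_comp (e : V ⟶ W) (p : W ⟶ M.ext X) : coords (e ≫ p) = (coords p).res e := by
  funext s x
  exact Category.assoc _ _ _

theorem sat_coords (p : W ⟶ M.ext X) : M.Sat X.formula (coords p) := by
  rw [Sat, ctxLift_coords]
  exact Subobject.factors_comp_arrow _

theorem exists_coords {x : Val M.obj X.ctx W} (h : M.Sat X.formula x) :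
    ∃ p : W ⟶ M.ext X, coords p = x := by
  refine ⟨(M.formula X.formula).factorThru _ h, ctxLift_injective ?_⟩
  exact (ctxLift_coords _).trans (Subobject.factorThru_arrow _ _ _)

/-- The interpretation of a morphism of the syntactic category. -/
noncomputable def extMap (f : X ⟶ Y) : M.ext X ⟶ M.ext Y :=
  (exists_coords ((exists_graph hM f (sat_coords (𝟙 (M.ext X)))).choose_spec.cod hM)).choose

/-- The interpretation of `f` is determined by its graph on all generalized elements. Functoriality,
pullbacks and epimorphisms are all checked through this equivalence. -/
theorem comp_extMap_iff {f : X ⟶ Y} {p : W ⟶ M.ext X} {q : W ⟶ M.ext Y} :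
    p ≫ extMap hM f = q ↔ Graph M f (coords q) (coords p) := by
  have h : Graph M f (coords (extMap hM f)) (coords (𝟙 (M.ext X))) := by
    rw [extMap, (exists_coords
      ((exists_graph hM f (sat_coords (𝟙 (M.ext X)))).choose_spec.cod hM)).choose_spec]
    exact (exists_graph hM f (sat_coords (𝟙 (M.ext X)))).choose_spec
  have h' := h.res p
  rw [← coords_comp, ← coords_comp, Category.comp_id] at h'
  exact ⟨fun e => e ▸ h', fun k => coords_injective (h'.unique hM k)⟩

theorem graph_extMap (f : X ⟶ Y) (p : W ⟶ M.ext X) :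
    Graph M f (coords (p ≫ extMap hM f)) (coords p) := (comp_extMap_iff hM).1 rfl

/-- The functor on the syntactic category given by a model. -/
noncomputable def toFunctor : Syn T ⥤ A where
  obj X := M.ext X
  map f := extMap hM f
  map_id X := by
    rw [← Category.id_comp (extMap hM (𝟙 X)), comp_extMap_iff, Syn.id_eq_ofTerms, graph_ofTerms hM,
      evals_id]
    exact ⟨sat_coords _, rfl⟩
  map_comp f g := by
    rw [← Category.id_comp (extMap hM (f ≫ g)), comp_extMap_iff]
    have h1 := graph_extMap hM f (𝟙 _)
    rw [Category.id_comp] at h1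
    exact h1.comp hM (graph_extMap hM g _)

theorem exists_unique_ext_free_nil (W : A) : ∃! _ : W ⟶ M.ext (Syn.free T []), True := by
  obtain ⟨p, -⟩ := exists_coords (X := Syn.free T [])
    (sat_top (M := M) (X := W) (Γ := []) (fun _ x => nomatch x))
  exact ⟨p, trivial, fun q _ => coords_injective (Val.eq_nil _ _)⟩

/-- By soundness, generalized elements of the interpreted pullback object are exactly the pairs with
a common value, so it has the universal property in A. -/
theorem isPullback_extMap (f : X ⟶ Z) (g : Y ⟶ Z) :
    IsPullback (extMap hM (Syn.fst (Syn.pullbackFormula_left f g)))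
      (extMap hM (Syn.snd (Syn.pullbackFormula_right f g))) (extMap hM f) (extMap hM g) := by
  have w := congrArg (toFunctor hM).map (Syn.isPullback_pullbackFormula f g).w
  rw [Functor.map_comp, Functor.map_comp] at w
  have h₁ : ∀ {W : A} (x : Val M.obj X.ctx W) (x' : Val M.obj X.ctx W) (y : Val M.obj Y.ctx W),
      Graph M (Syn.fst (Syn.pullbackFormula_left f g)) x' (.append x y) → x = x' :=
    fun x x' y h => by
      have := ((graph_ofTerms hM).1 h).2
      rwa [evals_inl] at this
  have h₂ : ∀ {W : A} (x : Val M.obj X.ctx W) (y' : Val M.obj Y.ctx W) (y : Val M.obj Y.ctx W),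
      Graph M (Syn.snd (Syn.pullbackFormula_right f g)) y' (.append x y) → y = y' :=
    fun x x' y h => by
      have := ((graph_ofTerms hM).1 h).2
      rwa [evals_inr] at this
  have hc : ∀ {W : A} (p : W ⟶ M.ext (Syn.mk (X.ctx ++ Y.ctx) (Syn.pullbackFormula f g))),
      coords p = .append (coords (p ≫ extMap hM (Syn.fst (Syn.pullbackFormula_left f g))))
        (coords (p ≫ extMap hM (Syn.snd (Syn.pullbackFormula_right f g)))) := fun p => by
    have k₁ := graph_extMap hM (Syn.fst (Syn.pullbackFormula_left f g)) p
    have k₂ := graph_extMap hM (Syn.snd (Syn.pullbackFormula_right f g)) p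
    have e := M.append_evals (Δ := X.ctx) (Γ := Y.ctx) (coords p)
    rw [← e] at k₁ k₂
    rw [← h₁ _ _ _ k₁, ← h₂ _ _ _ k₂]
    exact e.symm
  have hl : ∀ s : PullbackCone (extMap hM f) (extMap hM g),
      ∃ l : s.pt ⟶ M.ext (Syn.mk (X.ctx ++ Y.ctx) (Syn.pullbackFormula f g)),
        coords l = .append (coords s.fst) (coords s.snd) := fun s => by
    -- The common value of the two legs of the cone serves as the existential witness, without any
    -- refinement.
    refine exists_coords (sat_exs.2 ⟨s.pt, 𝟙 _, coords (s.fst ≫ extMap hM f), inferInstance, ?_⟩)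
    simp only [Val.res_id, sat_and, sat_subst, evals_append, evals_comp, evals_inl, evals_inr]
    exact ⟨graph_extMap hM f _, by rw [s.condition]; exact graph_extMap hM g _⟩
  refine ⟨⟨w⟩, ⟨PullbackCone.IsLimit.mk _ (fun s => (hl s).choose) ?_ ?_ ?_⟩⟩
  · intro s
    have e := hc (hl s).choose
    rw [(hl s).choose_spec] at e
    have := congrArg (M.evals (.inl _ _)) e
    rw [evals_inl, evals_inl] at this
    exact (coords_injective this).symm
  · intro s
    have e := hc (hl s).choose
    rw [(hl s).choose_spec] at e
    have := congrArg (M.evals (.inr _ _)) e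
    rw [evals_inr, evals_inr] at this
    exact (coords_injective this).symm
  · intro s m e₁ e₂
    refine coords_injective ?_
    rw [(hl s).choose_spec, hc m, e₁, e₂]

/-- Surjectivity is the provable sequent Y(y) ⊢ ∃ x, f x = y. Applied to the generic element of the
interpretation of Y it produces an epimorphism that factors through the interpretation of `f`. -/
theorem epi_extMap {f : X ⟶ Y} (hf : Syn.Surj f) : Epi (extMap hM f) := by
  have h : Provable T Y.formula ((Syn.imageFormula f).subst (.id _)) :=
    (hf.cov Y.formula (.id _) (by rw [Formula.subst_id]; exact .refl _)).provable
      fun _ _ _ ⟨_, h⟩ => Syn.imageFormula_mk h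
  rw [Formula.subst_id] at h
  obtain ⟨V, e, x, he, hx⟩ := sat_exs.1 ((sat_coords (𝟙 (M.ext Y))).of_provable hM h)
  simp only [sat_subst, evals_append, evals_inl, evals_inr] at hx
  obtain ⟨p, rfl⟩ := exists_coords (Graph.dom hM hx)
  rw [← coords_comp, Category.comp_id] at hx
  have := (comp_extMap_iff hM).2 hx
  exact epi_of_epi_fac this

theorem isRegularFunctor_toFunctor : IsRegularFunctor (toFunctor hM) where
  preservesFiniteLimits := by
    have h₁ : PreservesLimitsOfShape (Discrete PEmpty.{1}) (toFunctor hM) := by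
      have : PreservesLimit (Functor.empty.{0} (Syn T)) (toFunctor hM) :=
        preservesLimit_of_preserves_limit_cone (Syn.isTerminalFreeNil T)
          ((isLimitMapConeEmptyConeEquiv _ _).symm
            (IsTerminal.ofUniqueHom (fun W => (exists_unique_ext_free_nil W).choose)
              fun W m => (exists_unique_ext_free_nil W).unique trivial trivial))
      exact preservesLimitsOfShape_pempty_of_preservesTerminal _
    have h₂ : PreservesLimitsOfShape WalkingCospan (toFunctor hM) := by
      refine ⟨fun {K} => ?_⟩
      have h := Syn.isPullback_pullbackFormula (K.map WalkingCospan.Hom.inl)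
        (K.map WalkingCospan.Hom.inr)
      have : PreservesLimit (cospan (K.map WalkingCospan.Hom.inl)
          (K.map WalkingCospan.Hom.inr)) (toFunctor hM) :=
        preservesLimit_of_preserves_limit_cone h.isLimit
          ((isLimitMapConePullbackConeEquiv (toFunctor hM) h.w).symm
            (isPullback_extMap hM _ _).isLimit)
      exact preservesLimit_of_iso_diagram _ (diagramIsoCospan K).symm
    exact preservesFiniteLimits_of_preservesTerminal_and_pullbacks _
  epi_map f _ := epi_extMap hM (Syn.surj_of_isRegularEpi f)

end Str

end TMotives

namespace TMotives

/-! ## The model given by a regular functor -/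

namespace Syn

variable {T : RegularTheory.{w}} {X Y Z : Syn T} {Γ : List T.sig.Sorts}

theorem ofTerms_comp {t : Subst T.sig Y.ctx X.ctx} {ht : Provable T X.formula (Y.formula.subst t)}
    {t' : Subst T.sig Z.ctx Y.ctx} {ht' : Provable T Y.formula (Z.formula.subst t')}
    (h : Provable T X.formula (Z.formula.subst (t'.comp t))) :
    ofTerms t ht ≫ ofTerms t' ht' = ofTerms (t'.comp t) h :=
  (hom_ext_ofTerms fun χ x hx => by
    rw [Subst.comp_assoc]
    exact Rel.comp (rel_ofTerms_self hx)
      (rel_ofTerms_self (rel_ofTerms_self (ht := ht) hx).cod)).symm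

theorem ofTerms_congr {t t' : Subst T.sig Y.ctx X.ctx}
    {ht : Provable T X.formula (Y.formula.subst t)} (h : t = t') :
    ofTerms t ht = ofTerms t' (h ▸ ht) := by
  subst h; rfl

theorem incl_comp_incl {φ ψ θ : Formula T.sig Γ} (h : Provable T φ ψ) (h' : Provable T ψ θ) :
    incl h ≫ incl h' = incl (h.cut h') :=
  ofTerms_comp _

/-- The coordinate functions on `{x⃗ . φ}`. -/
def coord (X : Syn T) {s : T.sig.Sorts} (x : Var X.ctx s) : X ⟶ free T [s] :=
  ofTerms (.cons (.var x) (.nil _)) (.top_intro _)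

theorem ofTerms_comp_coord {t : Subst T.sig Y.ctx X.ctx}
    {ht : Provable T X.formula (Y.formula.subst t)} {s : T.sig.Sorts} (x : Var Y.ctx s) :
    ofTerms t ht ≫ coord Y x =
      ofTerms (Y := free T [s]) (.cons (t _ x) (.nil _)) (.top_intro _) :=
  (ofTerms_comp (.top_intro _)).trans (ofTerms_congr (by
    funext r y; cases y with | zero => rfl | succ y => nomatch y))

theorem coord_free_singleton (s : T.sig.Sorts) : coord (free T [s]) .zero = 𝟙 _ :=
  (ofTerms_congr (by funext r y; cases y with | zero => rfl | succ y => nomatch y)).trans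
    (id_eq_ofTerms _).symm

theorem ofTerms_comp_termHom {Δ : List T.sig.Sorts} (σ : Subst T.sig Δ Γ) {s : T.sig.Sorts}
    (t : Term T.sig Δ s) :
    ofTerms (X := free T Γ) (Y := free T Δ) σ (.top_intro _) ≫ termHom t = termHom (t.subst σ) :=
  (ofTerms_comp (.top_intro _)).trans (ofTerms_congr (by
    funext r y; cases y with | zero => rfl | succ y => nomatch y))

theorem provable_free (Γ : List T.sig.Sorts) {Δ : List T.sig.Sorts} {φ : Formula T.sig Δ}
    (σ : Subst T.sig Γ Δ) : Provable T φ ((free T Γ).formula.subst σ) :=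
  .top_intro _

/-- The inclusion of `{x⃗ . φ}` in `{x⃗ . ⊤}`. -/
def toFree (X : Syn T) : X ⟶ free T X.ctx := ofTerms (.id _) (provable_free _ _)

instance (X : Syn T) : Mono (toFree X) := mono_incl (.top_intro X.formula)

theorem toFree_comp_termHom_var (X : Syn T) {s : T.sig.Sorts} (x : Var X.ctx s) :
    toFree X ≫ termHom (.var x) = coord X x :=
  ofTerms_comp_coord _

theorem incl_comp_toFree {φ ψ : Formula T.sig Γ} (h : Provable T φ ψ) :
    incl h ≫ toFree (.mk Γ ψ) = toFree (.mk Γ φ) :=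
  incl_comp_incl h (.top_intro ψ)

/-- The projection of `{s, x⃗ . ⊤}` to `{y : s . ⊤}`. -/
def consFst (s : T.sig.Sorts) (Γ : List T.sig.Sorts) : free T (s :: Γ) ⟶ free T [s] :=
  termHom (.var .zero)

/-- The projection of `{s, x⃗ . ⊤}` to `{x⃗ . ⊤}`. -/
def consSnd (s : T.sig.Sorts) (Γ : List T.sig.Sorts) : free T (s :: Γ) ⟶ free T Γ :=
  ofTerms (.wk Γ s) (provable_free _ _)

theorem consSnd_comp_termHom_var {s : T.sig.Sorts} {r : T.sig.Sorts} (x : Var Γ r) :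
    consSnd s Γ ≫ termHom (.var x) = termHom (.var x.succ) :=
  ofTerms_comp_termHom _ _

/-- A context is the product of its first sort and the remaining context; by induction, a functor
preserving finite limits is known on all contexts from its values at single sorts. -/
theorem isPullback_cons (s : T.sig.Sorts) (Γ : List T.sig.Sorts) :
    IsPullback (consFst s Γ) (consSnd s Γ) ((isTerminalFreeNil T).from _)
      ((isTerminalFreeNil T).from _) := by
  have h := isPullback_of_rel (X := free T [s]) (Y := free T Γ) (ζ := .top)
    (f := (isTerminalFreeNil T).from _) (g := (isTerminalFreeNil T).from _) (provable_free [s] _)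
    (provable_free Γ _) ((isTerminalFreeNil T).hom_ext _ _) fun _ _ _ _ _ _ => .top_intro _
  have e : fst (X := free T [s]) (Y := free T Γ) (ζ := .top) (provable_free [s] _) =
      consFst s Γ :=
    ofTerms_congr (by funext r y; cases y with | zero => rfl | succ y => nomatch y)
  rw [e] at h
  exact h

/-- Together with `isLimitEq` for equations and `surj_exProj` for ∃, this expresses each connective
by a finite limit or a regular epimorphism, which regular functors respect. -/
theorem isPullback_incl_and (φ ψ : Formula T.sig Γ) :
    IsPullback (incl (.and_left φ ψ)) (incl (.and_right φ ψ)) (toFree (.mk Γ φ))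
      (toFree (.mk Γ ψ)) := by
  suffices key : ∀ s : PullbackCone (toFree (.mk Γ φ)) (toFree (.mk Γ ψ)),
      ∃ l : s.pt ⟶ Syn.mk Γ (.and φ ψ), l ≫ incl (.and_left φ ψ) = s.fst from
    ⟨⟨by rw [incl_comp_toFree, incl_comp_toFree]⟩, ⟨PullbackCone.IsLimit.mk _
      (fun s => (key s).choose) (fun s => (key s).choose_spec)
      (fun s => by
        rw [← cancel_mono (toFree (.mk Γ ψ)), ← s.condition]
        refine Eq.trans ?_ (congrArg (· ≫ toFree _) (key s).choose_spec)
        simp only [Category.assoc, incl_comp_toFree])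
      (fun s m e₁ e₂ => by
        rw [← cancel_mono (incl (.and_left φ ψ)), e₁, (key s).choose_spec])⟩⟩
  intro s
  refine exists_lift_incl _ _ fun χ y x k => .and_intro k.cod ?_
  have k' := k.comp (rel_incl (h := .top_intro φ).2 ⟨k.cod, .eqs_refl _ _⟩)
  have e : s.fst ≫ incl (.top_intro φ) = s.snd ≫ incl (.top_intro ψ) := s.condition
  rw [e] at k'
  exact k'.cov_comp.provable fun χ' ρ h1 ⟨z, h2, h3⟩ =>
    .leibniz (rel_incl.1 h3).2 _ (rel_incl.1 h3).1

theorem rel_termHom {s : T.sig.Sorts} (t : Term T.sig Γ s) {Ξ : List T.sig.Sorts}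
    {χ : Formula T.sig Ξ} (x : Subst T.sig Γ Ξ) :
    Rel (termHom t) χ (.cons (t.subst x) (.nil _)) x := by
  have h := rel_ofTerms_self (X := free T Γ) (Y := free T [s]) (t := .cons t (.nil Γ))
    (ht := .refl _) (x := x) (χ := χ) (.top_intro _)
  refine h.congr_left (.eqs_of_eq ?_)
  funext r y; cases y with | zero => rfl | succ y => nomatch y

theorem toFree_comp_termHom_eq {s : T.sig.Sorts} (t t' : Term T.sig Γ s) :
    toFree (.mk Γ (.eq t t')) ≫ termHom t = toFree (.mk Γ (.eq t t')) ≫ termHom t' := by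
  refine hom_ext_cov fun χ x hx => .pure ⟨.cons (t.subst x) (.nil _), ?_⟩
  rw [Subst.comp_id]
  have h : Rel (toFree (.mk Γ (.eq t t'))) χ x x := rel_ofTerms.2 ⟨hx, .eqs_refl _ _⟩
  exact ⟨h.comp (rel_termHom t x), (h.comp (rel_termHom t' x)).congr_left
    (.eqs_symm (.and_intro hx (.top_intro _)))⟩

theorem provable_eq_of_comp_termHom {s : T.sig.Sorts} {t t' : Term T.sig Γ s} {f : X ⟶ free T Γ}
    (e : f ≫ termHom t = f ≫ termHom t') {Ξ : List T.sig.Sorts} {χ : Formula T.sig Ξ}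
    {y : Subst T.sig Γ Ξ} {x : Subst T.sig X.ctx Ξ} (k : Rel f χ y x) :
    Provable T χ ((Formula.eq t t').subst y) := by
  have h := k.comp (rel_termHom t y)
  rw [e] at h
  exact (h.unique (k.comp (rel_termHom t' y))).cut (.and_left _ _)

/-- `{x⃗ . t = t'}` is an equalizer. -/
noncomputable def isLimitEq {s : T.sig.Sorts} (t t' : Term T.sig Γ s) :
    IsLimit (Fork.ofι (f := termHom t) (g := termHom t') _ (toFree_comp_termHom_eq t t')) :=
  Fork.IsLimit.ofExistsUnique fun c => by
    obtain ⟨l, hl⟩ := exists_lift_incl (.top_intro (.eq t t')) c.ι fun _ _ _ k =>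
      provable_eq_of_comp_termHom c.condition k
    exact ⟨l, hl, fun m hm => by
      rw [← cancel_mono (toFree (.mk Γ (.eq t t')))]
      exact hm.trans hl.symm⟩

/-- The projection of `{s, x⃗ . φ}` to `{x⃗ . ∃ s, φ}`. -/
def exProj (s : T.sig.Sorts) (φ : Formula T.sig (s :: Γ)) :
    Syn.mk (s :: Γ) φ ⟶ Syn.mk Γ (.ex s φ) :=
  ofTerms (.wk Γ s) (.ex_intro (.refl _))

theorem surj_exProj (s : T.sig.Sorts) (φ : Formula T.sig (s :: Γ)) : Surj (exProj s φ) where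
  cov _ y h := fun _ hG => .ex_cases h fun χ' ρ t h1 h2 =>
    hG χ' ρ h1 ⟨.cons t (y.comp ρ), rel_ofTerms.2 ⟨h2, .eqs_refl _ _⟩⟩

/-- The graph of a morphism. -/
noncomputable abbrev graphObj (f : X ⟶ Y) : Syn T :=
  ⟨Y.ctx ++ X.ctx, (Quotient.out (s := FunctionalFormula.setoid X Y) f).graph⟩

noncomputable def graphFst (f : X ⟶ Y) : graphObj f ⟶ Y :=
  fst (Quotient.out (s := FunctionalFormula.setoid X Y) f).cod

noncomputable def graphSnd (f : X ⟶ Y) : graphObj f ⟶ X :=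
  snd (Quotient.out (s := FunctionalFormula.setoid X Y) f).dom

theorem graphSnd_comp (f : X ⟶ Y) : graphSnd f ≫ f = graphFst f := by
  refine (hom_ext_ofTerms fun χ p hp => ?_).symm
  rw [← Subst.append_eta p] at hp ⊢
  rw [Subst.inl_append]
  exact Rel.comp (rel_snd.2 ⟨hp, .eqs_refl _ _⟩) hp

/-- The section is x ↦ (f x, x). -/
theorem exists_graph_section (f : X ⟶ Y) :
    ∃ l : X ⟶ graphObj f, l ≫ graphFst f = f ∧ l ≫ graphSnd f = 𝟙 X :=
  exists_lift_pair _ _ f (𝟙 X) fun χ y x z h h' => by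
    have := h'
    rw [id_eq_ofTerms, rel_ofTerms, Subst.id_comp] at this
    exact h.congr (.eqs_refl _ _) this.2

end Syn

end TMotives

namespace TMotives

theorem exists_lift_of_epi_of_mono {A : Type u} [Category.{v} A] [Abelian A] {V W B C : A}
    (e : V ⟶ W) [Epi e] (m : B ⟶ C) [Mono m] {q : V ⟶ B} {p : W ⟶ C} (h : q ≫ m = e ≫ p) :
    ∃ l : W ⟶ B, l ≫ m = p := by
  have : StrongEpi e := strongEpi_of_epi e
  have sq : CommSq q e m p := ⟨h⟩
  exact ⟨sq.lift, sq.fac_right⟩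

/-! ### Generalized elements of the values of a regular functor. -/

namespace Syn

section

variable {T : RegularTheory.{w}} {A : Type u} [Category.{v} A] (N : Syn T ⥤ A)

/-- The values of a functor at the objects `{y : s . ⊤}`. -/
abbrev freeObj (s : T.sig.Sorts) : A := N.obj (free T [s])

variable {X Y : Syn T} {V W : A} {Γ Δ : List T.sig.Sorts}

/-- The coordinates of a generalized element of `N X`. -/
def vals (p : W ⟶ N.obj X) : Val (freeObj N) X.ctx W := fun _ x => p ≫ N.map (coord X x)

variable {N}

theorem vals_comp (e : V ⟶ W) (p : W ⟶ N.obj X) : vals N (e ≫ p) = (vals N p).res e := by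
  funext s x; exact Category.assoc _ _ _

theorem vals_ofTerms {t : Subst T.sig Y.ctx X.ctx} {ht : Provable T X.formula (Y.formula.subst t)}
    (p : W ⟶ N.obj X) : vals N (p ≫ N.map (ofTerms t ht)) = fun s x =>
      p ≫ N.map (ofTerms (Y := free T [s]) (.cons (t _ x) (.nil _)) (.top_intro _)) := by
  funext s x
  rw [← ofTerms_comp_coord (ht := ht), N.map_comp, ← Category.assoc]
  rfl

theorem vals_incl {φ ψ : Formula T.sig Γ} (h : Provable T φ ψ) (p : W ⟶ N.obj (.mk Γ φ)) :
    vals N (p ≫ N.map (incl h)) = vals N p :=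
  vals_ofTerms p

theorem vals_naturality {N' : Syn T ⥤ A} (η : N ⟶ N') (p : W ⟶ N.obj X) :
    vals N' (p ≫ η.app X) = (vals N p).push fun s => η.app (free T [s]) := by
  funext s x
  change (p ≫ η.app X) ≫ N'.map _ = (p ≫ N.map _) ≫ η.app _
  rw [Category.assoc, Category.assoc, η.naturality]

/-- The coordinates of a generalized element of `N {x⃗ . ⊤}`. -/
def freeVals (N : Syn T ⥤ A) (p : W ⟶ N.obj (free T Γ)) : Val (freeObj N) Γ W :=
  fun _ x => p ≫ N.map (termHom (.var x))

theorem freeVals_comp (e : V ⟶ W) (p : W ⟶ N.obj (free T Γ)) :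
    freeVals N (e ≫ p) = (freeVals N p).res e := by
  funext s x; exact Category.assoc _ _ _

theorem freeVals_toFree (p : W ⟶ N.obj X) : freeVals N (p ≫ N.map (toFree X)) = vals N p := by
  funext s x
  rw [vals, freeVals, Category.assoc, ← N.map_comp, toFree_comp_termHom_var]

/-- The value of `N` at a context is the product of its values at the sorts: a generalized element
is the same as a valuation. -/
theorem existsUnique_freeVals (hN : IsRegularFunctor N) (v : Val (freeObj N) Γ W) :
    ∃! p : W ⟶ N.obj (free T Γ), freeVals N p = v := by
  have := hN.preservesFiniteLimits
  have ht := (isTerminalFreeNil T).isTerminalObj N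
  induction Γ with
  | nil => exact ⟨ht.from _, Val.eq_nil _ _, fun _ _ => ht.hom_ext _ _⟩
  | cons s Γ ih =>
    obtain ⟨p, hp, hu⟩ := ih v.tail
    have h := (isPullback_cons s Γ).map N
    refine ⟨h.lift (v _ .zero) p (ht.hom_ext _ _), ?_, fun q hq => h.hom_ext ?_ ?_⟩
    · funext r x
      cases x with
      | zero => exact h.lift_fst _ _ _
      | succ x =>
        rw [freeVals, ← consSnd_comp_termHom_var, N.map_comp, h.lift_snd_assoc]
        exact congrFun (congrFun hp r) x
    · rw [h.lift_fst]
      exact congrFun (congrFun hq s) .zero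
    · rw [h.lift_snd]
      refine hu _ ?_
      funext r x
      refine Eq.trans ?_ (congrFun (congrFun hq r) x.succ)
      rw [freeVals, freeVals, ← consSnd_comp_termHom_var, N.map_comp, Category.assoc]

theorem freeVals_injective (hN : IsRegularFunctor N) {p q : W ⟶ N.obj (free T Γ)}
    (h : freeVals N p = freeVals N q) : p = q :=
  (existsUnique_freeVals hN _).unique h rfl

theorem vals_injective (hN : IsRegularFunctor N) {p q : W ⟶ N.obj X}
    (h : vals N p = vals N q) : p = q := by
  have := hN.preservesFiniteLimits
  rw [← cancel_mono (N.map (toFree X))]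
  refine freeVals_injective hN ?_
  rw [freeVals_toFree, freeVals_toFree, h]

variable [Abelian A]

/-- The identification of a product of values of `N` with a value of `N`. -/
noncomputable def ctxPt (hN : IsRegularFunctor N) (Δ : List T.sig.Sorts) :
    ctxObj (freeObj N) Δ ⟶ N.obj (free T Δ) :=
  (existsUnique_freeVals hN (fun _ x => ctxProj x)).choose

theorem freeVals_ctxPt (hN : IsRegularFunctor N) (Δ : List T.sig.Sorts) :
    freeVals N (ctxPt hN Δ) = fun _ x => ctxProj x :=
  (existsUnique_freeVals hN (fun _ x => ctxProj x)).choose_spec.1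

/-- The structure given by a regular functor. -/
noncomputable abbrev toStr (hN : IsRegularFunctor N) : Str T.sig A where
  obj := freeObj N
  op f := ctxPt hN _ ≫ N.map (termHom (.app f fun _ x => .var x))

theorem ctxLift_comp_op (hN : IsRegularFunctor N) {s : T.sig.Sorts} (f : T.sig.Ops Δ s)
    (p : W ⟶ N.obj (free T Δ)) :
    ctxLift (freeVals N p) ≫ (toStr hN).op f =
      p ≫ N.map (termHom (.app f fun _ x => .var x)) := by
  rw [← Category.assoc]
  congr 1
  refine freeVals_injective hN ?_
  rw [freeVals_comp, freeVals_ctxPt]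
  funext s x
  exact Str.ctxLift_proj _ _

theorem eval_freeVals (hN : IsRegularFunctor N) (p : W ⟶ N.obj (free T Γ)) {s : T.sig.Sorts}
    (t : Term T.sig Γ s) : (toStr hN).eval (freeVals N p) t = p ≫ N.map (termHom t) := by
  induction t with
  | var x => exact Str.eval_var _ _ _
  | @app Δ s f a ih =>
    rw [Str.eval_app]
    simp only [ih]
    let q : free T Γ ⟶ free T Δ := ofTerms a (provable_free _ _)
    have h : freeVals N (p ≫ N.map q) = fun s x => p ≫ N.map (termHom (a s x)) := by
      funext s x
      rw [freeVals, Category.assoc, ← N.map_comp]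
      exact congrArg (fun f => p ≫ N.map f) (ofTerms_comp_termHom _ _)
    rw [← h, ctxLift_comp_op hN, Category.assoc, ← N.map_comp]
    exact congrArg (fun f => p ≫ N.map f) (ofTerms_comp_termHom _ _)

/-- In the structure of `N` the formula φ is interpreted by N{x⃗ . φ}, by induction along the limit
descriptions of the connectives. This makes the structure a model and recovers `N` from it. -/
theorem sat_toStr_iff (hN : IsRegularFunctor N) {φ : Formula T.sig Γ}
    {v : Val (freeObj N) Γ W} :
    (toStr hN).Sat φ v ↔ ∃ q : W ⟶ N.obj (.mk Γ φ), vals N q = v := by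
  have := hN.preservesFiniteLimits
  induction φ generalizing W with
  | top => exact iff_of_true (Str.sat_top _) (by
      obtain ⟨p, hp, -⟩ := existsUnique_freeVals hN v
      exact ⟨p, hp⟩)
  | eq t t' =>
    refine Str.sat_eq.trans ⟨fun h => ?_, ?_⟩
    · obtain ⟨p, rfl⟩ := (existsUnique_freeVals hN v).exists
      rw [eval_freeVals, eval_freeVals] at h
      obtain ⟨q, hq⟩ := Fork.IsLimit.lift' (isLimitForkMapOfIsLimit N _ (isLimitEq t t')) p h
      refine ⟨q, ?_⟩
      rw [← freeVals_toFree]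
      exact congrArg (freeVals N) hq
    · rintro ⟨q, rfl⟩
      rw [← freeVals_toFree, eval_freeVals, eval_freeVals, Category.assoc, Category.assoc,
        ← N.map_comp, ← N.map_comp, toFree_comp_termHom_eq]
  | and φ ψ ih1 ih2 =>
    refine Str.sat_and.trans ((and_congr ih1 ih2).trans ⟨?_, ?_⟩)
    · rintro ⟨⟨q₁, h₁⟩, ⟨q₂, h₂⟩⟩
      have h := (isPullback_incl_and φ ψ).map N
      refine ⟨h.lift q₁ q₂ (freeVals_injective hN ?_), ?_⟩
      · rw [freeVals_toFree, freeVals_toFree, h₁, h₂]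
      · rw [← vals_incl (.and_left φ ψ), h.lift_fst, h₁]
    · rintro ⟨q, rfl⟩
      exact ⟨⟨q ≫ N.map (incl (.and_left φ ψ)), vals_incl _ _⟩,
        ⟨q ≫ N.map (incl (.and_right φ ψ)), vals_incl _ _⟩⟩
  | ex s φ ih =>
    have hv : ∀ {V : A} (q : V ⟶ N.obj (.mk (s :: _) φ)),
        vals N (q ≫ N.map (exProj s φ)) = (vals N q).tail := fun q => vals_ofTerms q
    refine Str.sat_ex.trans ⟨?_, ?_⟩
    · rintro ⟨V, e, a, he, h⟩
      obtain ⟨q, hq⟩ := ih.1 h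
      obtain ⟨p, rfl⟩ := (existsUnique_freeVals hN v).exists
      -- The witness gives an element of N{x⃗ . ∃ s, φ} only over the cover `e`; it descends because
      -- `e` is epic and the inclusion in N{x⃗ . ⊤} is monic.
      obtain ⟨l, hl⟩ := exists_lift_of_epi_of_mono e (N.map (toFree (.mk _ (.ex s φ))))
        (q := q ≫ N.map (exProj s φ)) (p := p) (freeVals_injective hN (by
          rw [freeVals_toFree, hv, hq]
          exact (freeVals_comp e p).symm))
      exact ⟨l, by rw [← freeVals_toFree, hl]⟩
    · rintro ⟨q, rfl⟩
      have := hN.epi_map _ (surj_exProj s φ).isRegularEpi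
      refine ⟨_, pullback.fst q (N.map (exProj s φ)),
        vals N (pullback.snd q (N.map (exProj s φ))) _ .zero, inferInstance,
        ih.2 ⟨pullback.snd q (N.map (exProj s φ)), ?_⟩⟩
      refine (Val.cons_eta _).symm.trans (congrArg (Val.cons _) ?_)
      rw [← hv, ← pullback.condition, vals_comp]

theorem isModel_toStr (hN : IsRegularFunctor N) : isModel T A (toStr hN) := by
  intro Γ φ ψ h
  refine Str.formula_le_iff.2 fun W v k => ?_
  obtain ⟨q, rfl⟩ := (sat_toStr_iff hN).1 k
  exact (sat_toStr_iff hN).2 ⟨q ≫ N.map (incl (.ax h)), vals_incl _ _⟩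

theorem vals_graphObj (hN : IsRegularFunctor N) (f : X ⟶ Y) (r : W ⟶ N.obj (graphObj f)) :
    Val.append (vals N (r ≫ N.map (graphFst f))) (vals N (r ≫ N.map (graphSnd f))) =
      vals N r := by
  rw [← (toStr hN).append_evals (Δ := Y.ctx) (Γ := X.ctx) (vals N r)]
  congr 1
  · refine (vals_ofTerms r).trans ?_
    funext s x
    exact ((toStr hN).eval_var (vals N r) _).symm
  · refine (vals_ofTerms r).trans ?_
    funext s x
    exact ((toStr hN).eval_var (vals N r) _).symm

/-- The graph of `f` is itself an object of `Syn T`, with a section x ↦ (f x, x) over X; its image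
under `N` is the graph of N f. -/
theorem graph_vals_iff (hN : IsRegularFunctor N) (f : X ⟶ Y) {x : W ⟶ N.obj X}
    {y : W ⟶ N.obj Y} : Str.Graph (toStr hN) f (vals N y) (vals N x) ↔ x ≫ N.map f = y := by
  refine (sat_toStr_iff hN).trans ⟨?_, ?_⟩
  · rintro ⟨r, hr⟩
    replace hr : vals N (X := graphObj f) r = _ := hr
    rw [← vals_graphObj hN f] at hr
    have h₁ := congrArg ((toStr hN).evals (.inl _ _)) hr
    have h₂ := congrArg ((toStr hN).evals (.inr _ _)) hr
    rw [Str.evals_inl, Str.evals_inl] at h₁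
    rw [Str.evals_inr, Str.evals_inr] at h₂
    rw [← vals_injective hN h₁, ← vals_injective hN h₂, Category.assoc, ← N.map_comp,
      graphSnd_comp]
  · rintro rfl
    obtain ⟨l, h₁, h₂⟩ := exists_graph_section f
    refine ⟨x ≫ N.map l, (vals_graphObj hN f _).symm.trans ?_⟩
    rw [Category.assoc, Category.assoc, ← N.map_comp, ← N.map_comp, h₁, h₂,
      CategoryTheory.Functor.map_id, Category.comp_id]

end

end Syn

end TMotives

namespace TMotives

/-! ## Regular functors and models -/

/-- Isomorphisms of structures. -/
noncomputable def Str.isoOfApp {L : Sig.{w}} {A : Type u} [Category.{v} A] [HasFiniteProducts A]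
    {M N : Str L A} (h : M ⟶ N) (hh : ∀ s, IsIso (h.app s)) : M ≅ N where
  hom := h
  inv := ⟨fun s => inv (h.app s), fun {Δ s} f => by
    rw [IsIso.comp_inv_eq, Category.assoc, h.comm, ← Category.assoc, comp_ctxLift]
    simp only [← Category.assoc, ctxLift_proj]
    simp only [Category.assoc, IsIso.inv_hom_id, Category.comp_id, ctxLift_ctxProj,
      Category.id_comp]⟩
  hom_inv_id := Str.Hom.ext (by funext s; exact IsIso.hom_inv_id _)
  inv_hom_id := Str.Hom.ext (by funext s; exact IsIso.inv_hom_id _)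

namespace Syn

variable {T : RegularTheory.{w}} {A : Type u} [Category.{v} A] [Abelian A] {N N' : Syn T ⥤ A}

/-- The morphism of structures given by a natural transformation. -/
def toStrMap (hN : IsRegularFunctor N) (hN' : IsRegularFunctor N') (η : N ⟶ N') :
    toStr hN ⟶ toStr hN' where
  app s := η.app (free T [s])
  comm {Δ s} f := by
    have h' : freeVals N' (ctxPt hN Δ ≫ η.app (free T Δ)) =
        fun s (x : Var Δ s) => ctxProj x ≫ η.app (free T [s]) := by
      refine Eq.trans ?_ (congrArg (Val.push fun s => η.app (free T [s])) (freeVals_ctxPt hN Δ))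
      funext s x
      rw [freeVals, Val.push, freeVals, Category.assoc, Category.assoc, η.naturality]
    refine Eq.trans ?_ (congrArg (fun v => ctxLift v ≫ (toStr hN').op f) h')
    rw [ctxLift_comp_op]
    simp only [Category.assoc, η.naturality]

theorem toStr_hom_ext (hN : IsRegularFunctor N) (hN' : IsRegularFunctor N') {η θ : N ⟶ N'}
    (h : toStrMap hN hN' η = toStrMap hN hN' θ) : η = θ := by
  ext X
  refine vals_injective hN' ?_
  have e : ∀ s, η.app (free T [s]) = θ.app (free T [s]) := fun s =>
    congrArg (fun k : toStr hN ⟶ toStr hN' => Str.Hom.app k s) h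
  rw [← Category.id_comp (η.app X), ← Category.id_comp (θ.app X), vals_naturality,
    vals_naturality, funext e]

/-- The generic element of N X satisfies the formula of X, hence so does its image under `h`; this
image is an element of N' X, the component at X. Naturality holds because `h` also preserves the
graph formula of each morphism. -/
theorem exists_toStrMap_eq (hN : IsRegularFunctor N) (hN' : IsRegularFunctor N')
    (h : toStr hN ⟶ toStr hN') : ∃ η, toStrMap hN hN' η = h := by
  have key : ∀ X : Syn T, ∃ p : N.obj X ⟶ N'.obj X,
      vals N' p = (vals N (𝟙 (N.obj X))).push h.app := fun X =>
    (sat_toStr_iff hN').1 (Str.Sat.push h ((sat_toStr_iff hN).2 ⟨𝟙 (N.obj X), rfl⟩))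
  choose p hp using key
  have hp' : ∀ {X : Syn T} {W : A} (x : W ⟶ N.obj X),
      vals N' (x ≫ p X) = (vals N x).push h.app := fun {X W} x => by
    rw [vals_comp, hp, ← Val.push_res, ← vals_comp, Category.comp_id]
  let η : N ⟶ N' :=
    { app := p
      naturality := fun X Y f => by
        refine ((graph_vals_iff hN' f).1 ?_).symm
        have k := (graph_vals_iff hN f (x := 𝟙 _)).2 (Category.id_comp _)
        have k' := Str.Sat.push h k
        rw [Val.push_append] at k'
        rw [Str.Graph, hp', hp]
        exact k' }
  refine ⟨η, Str.Hom.ext (funext fun s => ?_)⟩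
  have := congrFun (congrFun (hp (free T [s])) s) .zero
  change p _ ≫ N'.map (coord (free T [s]) .zero) =
    (𝟙 _ ≫ N.map (coord (free T [s]) .zero)) ≫ h.app s
    at this
  rw [coord_free_singleton, CategoryTheory.Functor.map_id, CategoryTheory.Functor.map_id,
    Category.comp_id, Category.comp_id, Category.id_comp] at this
  exact this

variable (T A)

/-- The functor from regular functors on the syntactic category to models. -/
noncomputable def toModel : (regularFunctors (Syn T) A).FullSubcategory ⥤ Model T A where
  obj N := ⟨toStr N.property, isModel_toStr N.property⟩
  map {N N'} η := ObjectProperty.homMk (toStrMap N.property N'.property η.hom)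

instance : (toModel T A).Faithful where
  map_injective {N N'} η θ h := by
    ext1
    exact toStr_hom_ext N.property N'.property (congrArg (·.hom) h)

instance : (toModel T A).Full where
  map_surjective {N N'} h := by
    obtain ⟨η, hη⟩ := exists_toStrMap_eq N.property N'.property h.hom
    exact ⟨ObjectProperty.homMk η, ObjectProperty.hom_ext _ hη⟩

end Syn

/-! ### A model is recovered from its functor. -/

namespace Str

variable {T : RegularTheory.{w}} {A : Type u} [Category.{v} A] [Abelian A] {M : Str T.sig A}
  (hM : isModel T A M)

theorem isIso_coord_free (s : T.sig.Sorts) :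
    IsIso ((M.formula (Syn.free T [s]).formula).arrow ≫ ctxProj (.zero : Var [s] s)) := by
  obtain ⟨p, hp⟩ := exists_coords (X := Syn.free T [s]) (W := M.obj s) (M := M)
    (x := Val.cons (𝟙 _) (fun _ x => nomatch x)) (sat_top _)
  have h : p ≫ (M.formula (Syn.free T [s]).formula).arrow ≫ ctxProj (.zero : Var [s] s) = 𝟙 _ :=
    congrFun (congrFun hp s) .zero
  refine ⟨p, coords_injective ?_, h⟩
  funext r x
  cases x with
  | zero =>
    change ((_ ≫ _) ≫ p) ≫ _ ≫ _ = 𝟙 _ ≫ _ ≫ _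
    rw [Category.assoc, h, Category.comp_id, Category.id_comp]
  | succ x => nomatch x

/-- The universal elements of the functor given by a model. -/
noncomputable def extIso (M : Str T.sig A) (s : T.sig.Sorts) : M.ext (Syn.free T [s]) ⟶ M.obj s :=
  (M.formula (Syn.free T [s]).formula).arrow ≫ ctxProj (.zero : Var [s] s)

instance (s : T.sig.Sorts) : IsIso (M.extIso s) := isIso_coord_free s

/-- The valuation that corresponds to a generalized element of the interpretation of `⊤`. -/
noncomputable def freeCoords {Γ : List T.sig.Sorts} {W : A} (p : W ⟶ M.ext (Syn.free T Γ)) :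
    Val M.obj Γ W :=
  coords p

theorem extMap_termHom {Γ : List T.sig.Sorts} {s : T.sig.Sorts} (t : Term T.sig Γ s) {W : A}
    (p : W ⟶ M.ext (Syn.free T Γ)) :
    (p ≫ (toFunctor hM).map (Syn.termHom t)) ≫ M.extIso s =
      M.eval (freeCoords p) t := by
  have h := (graph_ofTerms hM (X := Syn.free T Γ) (Y := Syn.free T [s])).1
    (graph_extMap hM (Syn.termHom t) p)
  exact (congrFun (congrFun h.2 s) .zero).symm

/-- A model is recovered from its functor. -/
noncomputable def toStrToFunctor : Syn.toStr (isRegularFunctor_toFunctor hM) ⟶ M where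
  app s := M.extIso s
  comm {Δ s} f := by
    refine (extMap_termHom hM _ _).trans ?_
    rw [eval_app]
    refine Eq.trans (congrArg (fun v : Val M.obj Δ _ => ctxLift v ≫ M.op f)
      (funext fun t => funext fun x => (extMap_termHom hM (.var x) _).symm)) ?_
    exact congrArg (fun v : Val (Syn.freeObj (toFunctor hM)) Δ _ =>
      ctxLift (fun s x => v s x ≫ M.extIso s) ≫ M.op f)
      (Syn.freeVals_ctxPt (isRegularFunctor_toFunctor hM) Δ)

instance (T : RegularTheory.{w}) (A : Type u) [Category.{v} A] [Abelian A] :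
    (Syn.toModel T A).EssSurj where
  mem_essImage M := by
    let h := toStrToFunctor M.property
    have : ∀ s, IsIso (h.app s) := fun s => inferInstanceAs (IsIso (M.obj.extIso s))
    exact ⟨⟨toFunctor M.property, isRegularFunctor_toFunctor M.property⟩,
      ⟨ObjectProperty.isoMk _ (Str.isoOfApp h this)⟩⟩

instance (T : RegularTheory.{w}) (A : Type u) [Category.{v} A] [Abelian A] :
    (Syn.toModel T A).IsEquivalence where

end Str

end TMotives

/-! ### The composite equivalence and its identification with evaluation. -/

namespace TMotives

/-- The evaluation at the universal model of exact functors on ind-objects. -/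
noncomputable def evaluationAtUniversalModel (T : RegularTheory.{w}) [AdditiveTheory T]
    (A : Type u) [Category.{v} A] [Abelian A] :
    ExactFinitary.{w} (Ind (ConstructibleMotives T)) A ⥤ Model T A :=
  letI := abelianExactCompletion (R := Syn T)
  indRestriction (ConstructibleMotives T) A ⋙
    restriction A (isEnvelope_toExactCompletion (R := Syn T)).isRegularFunctor ⋙ Syn.toModel T A

theorem isEquivalence_evaluationAtUniversalModel (T : RegularTheory.{w}) [AdditiveTheory T]
    (A : Type u) [Category.{v} A] [Abelian A] [IsGrothendieckAbelian.{w} A] :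
    (evaluationAtUniversalModel T A).IsEquivalence := by
  let := abelianExactCompletion (R := Syn T)
  have := (isEnvelope_toExactCompletion (R := Syn T)).isEquivalence_restriction (A := A)
  exact inferInstanceAs (indRestriction (ConstructibleMotives T) A ⋙
    restriction A (isEnvelope_toExactCompletion (R := Syn T)).isRegularFunctor ⋙
      Syn.toModel T A).IsEquivalence

theorem isEvaluationAtUniversalModel_evaluationAtUniversalModel (T : RegularTheory.{w})
    [AdditiveTheory T] (A : Type u) [Category.{v} A] [Abelian A] :
    IsEvaluationAtUniversalModel (evaluationAtUniversalModel T A) := by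
  let := abelianExactCompletion (R := Syn T)
  -- The object of sort `s` in the model of `F` is by definition the value of `F` at {y : s . ⊤};
  -- only the comparison of contexts with products remains for the operations.
  refine ⟨fun s => Iso.refl _, fun F {Δ s} f => ?_⟩
  let N := (indRestriction (ConstructibleMotives T) A ⋙
    restriction A (isEnvelope_toExactCompletion (R := Syn T)).isRegularFunctor).obj F
  have h := Syn.ctxLift_comp_op N.property f (𝟙 _)
  rw [Category.id_comp] at h
  refine (Category.comp_id _).trans (h.symm.trans ?_)
  refine congrArg (fun v : Val (Syn.freeObj N.obj) Δ _ =>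
    ctxLift v ≫ (Syn.toStr N.property).op f) ?_
  funext t x
  exact (Category.id_comp _).trans (Category.comp_id _).symm

end TMotives

theorem mainTheorem5 {C : Type w} [SmallCategory C] (M : TMotives.Subcat C)
    (T : TMotives.RegularTheory.{w})
    (hT : T = TMotives.homologyTheory M ∨ T = TMotives.cohomologyTheory M) :
    (∃ _ : Abelian (Ind (TMotives.ConstructibleMotives T)),
      IsGrothendieckAbelian.{w} (Ind (TMotives.ConstructibleMotives T))) ∧
    ∀ (A : Type u) [Category.{v} A] [Abelian A] [IsGrothendieckAbelian.{w} A],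
      ∃ Φ : TMotives.ExactFinitary.{w} (Ind (TMotives.ConstructibleMotives T)) A ⥤
          TMotives.Model T A,
        Φ.IsEquivalence ∧ TMotives.IsEvaluationAtUniversalModel Φ := by
  -- From here on additivity is all that is used, so homology and cohomology are treated alike.
  obtain ⟨_⟩ : Nonempty (TMotives.AdditiveTheory T) := by
    rcases hT with rfl | rfl <;> exact ⟨inferInstance⟩
  let := TMotives.abelianExactCompletion (R := TMotives.Syn T)
  exact ⟨⟨inferInstance, isGrothendieckAbelian_ind⟩, fun A _ _ _ =>
    ⟨TMotives.evaluationAtUniversalModel T A,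
      TMotives.isEquivalence_evaluationAtUniversalModel T A,
      TMotives.isEvaluationAtUniversalModel_evaluationAtUniversalModel T A⟩⟩
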